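/- For every real $c>0$ there is a constant $B=B(c)>1$, depending only on $c$, such that the following holds. Let $\epsilon>0$ be real, let $d\ge 1$ and $n\ge 0$ be integers, and let $N,k$ be any integers with $N\ge B^{d}\epsilon^{-4-c}$ and $k\ge B d$. Let $X_1,\dots,X_N$ be independent random vectors in $\mathbb{R}^n$ such that for each $i$ the coordinates of $X_i$ form a $k$-independent family of standard Gaussians (each coordinate has law $\mathcal N(0,1)$, and any at most $k$ of the coordinates of $X_i$ are mutually independent), and let $X=\frac1{\sqrt N}\sum_{i=1}^N X_i$. Let $Y$ be a random vector in $\mathbb{R}^n$ whose coordinates are fully independent standard Gaussians. Then for every degree-$d$ polynomial threshold function $f$ on $\mathbb{R}^n$, that is, every $f(x)=\operatorname{sgn}(p(x))$ with $p$ a real polynomial in $n$ variables of total degree at most $d$ (and $\operatorname{sgn}(0)=0$), $$\bigl|\mathbb{E}[f(X)]-\mathbb{E}[f(Y)]\bigr|<\epsilon .$$ -/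

import Mathlib

open MeasureTheory ProbabilityTheory

/-- `f : ℝⁿ → ℝ` is a degree-`d` polynomial threshold function: `f = sgn ∘ p` for some real
polynomial `p` in `n` variables of (total) degree at most `d`. -/
def IsPTF {n : ℕ} (d : ℕ) (f : (Fin n → ℝ) → ℝ) : Prop :=
  ∃ p : MvPolynomial (Fin n) ℝ, p.totalDegree ≤ d ∧ ∀ x, f x = Real.sign (MvPolynomial.eval x p)

/-- The coordinates of the random vector `X` form a `k`-independent family of standard
Gaussians: each coordinate is a standard Gaussian, and any at most `k` of them are independent. -/
structure IsKIndepStdGaussian {Ω : Type*} [MeasurableSpace Ω] {n : ℕ} (k : ℕ)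
    (X : Ω → Fin n → ℝ) (μ : Measure Ω) : Prop where
  hasLaw : ∀ j, HasLaw (fun ω => X ω j) (gaussianReal 0 1) μ
  indep : ∀ s : Finset (Fin n), s.card ≤ k → iIndepFun (fun (j : s) ω => X ω j) μ

/-- The coordinates of the random vector `Y` form a fully independent family of standard
Gaussians. -/
structure IsIndepStdGaussian {Ω : Type*} [MeasurableSpace Ω] {n : ℕ}
    (Y : Ω → Fin n → ℝ) (μ : Measure Ω) : Prop where
  hasLaw : ∀ j, HasLaw (fun ω => Y ω j) (gaussianReal 0 1) μ
  indep : iIndepFun (fun j ω => Y ω j) μ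

/-!
For a polynomial `p` of degree at most `d`, let `|∇ˡp(x)|²` be the squared norm of its `l`-th
derivative tensor. Gaussian anticoncentration says that `|∇ˡp| ≥ κ |∇ˡ⁺¹p|` for all `l < d` outside
a set of Gaussian measure `O(d ^ 4 κ)`: a Gaussian vector may be rotated along
`cos θ • x + sin θ • y`, where a polynomial becomes a trigonometric polynomial of degree `d`, and
such a polynomial is small compared to its derivative for few `θ` only. Hence `sgn ∘ p` may be
multiplied by a smooth function `G` of the ratios `κ² |∇ˡ⁺¹p|² / |∇ˡp|²` that cuts off the bad set;
`G` is treated by the same argument with the constant `1` in place of the sign.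

The truncated function `(sgn ∘ p) G` is compared by Lindeberg's method, exchanging one summand
`X i / √N` for a Gaussian one at a time. Conditioning on the other summands and rescaling turn one
exchange into the comparison of the standard Gaussian measure with a measure having the same moments
of order `O(d)`, for a polynomial `q` and the cutoff scale `κ √N`. If the Gaussian means of
`|∇ˡq|²` decay fast in `l`, then `q` and all `|∇ˡq|²` are nearly constant: the sign does not change,
and `G` is, up to an error of eighth order in the relative fluctuations, a polynomial in them; its
expectation is determined by the moments. Otherwise let `l` be the last index at which the decay
fails: `|∇ˡ⁺¹q|²` is nearly constant and too large compared to `|∇ˡq|²`, so `G` nearly vanishes.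
Hypercontractivity on the Wiener chaos bounds the fluctuations, and each exchange costs
`Dᵈ (κ √N) ^ (-8)`. All exchanges together cost `Dᵈ κ ^ (-8) N ^ (-3)`, and `κ = ε / Mᵈ` gives the
theorem, even with `N ≥ Aᵈ ε ^ (-3)`.
-/

section StandardGaussian

/-- The standard Gaussian measure on `σ → ℝ`. -/
noncomputable abbrev stdGauss (σ : Type*) [Fintype σ] : Measure (σ → ℝ) :=
  Measure.pi fun _ => gaussianReal 0 1

theorem integrable_pow_gaussianReal (m : ℕ) :
    Integrable (fun x : ℝ => x ^ m) (gaussianReal 0 1) := by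
  have h := (memLp_id_gaussianReal (μ := 0) (v := 1) (m : NNReal)).integrable_norm_pow'
  exact h.mono (by fun_prop) (Filter.Eventually.of_forall fun x => by simp)

theorem integrable_pow_mul_gaussianPDFReal (m : ℕ) :
    Integrable fun x : ℝ => x ^ m * gaussianPDFReal 0 1 x := by
  have h := integrable_pow_gaussianReal m
  rw [gaussianReal_of_var_ne_zero _ one_ne_zero,
    integrable_withDensity_iff_integrable_smul' (measurable_gaussianPDF 0 1)
      (by simp [gaussianPDF_lt_top])] at h
  refine h.congr (Filter.Eventually.of_forall fun x => ?_)
  simp [gaussianPDF, gaussianPDFReal_nonneg, mul_comm]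

theorem hasDerivAt_gaussianPDFReal (x : ℝ) :
    HasDerivAt (gaussianPDFReal 0 1) (-(x * gaussianPDFReal 0 1 x)) x := by
  have hexponent : HasDerivAt (fun x : ℝ => -(x - 0) ^ 2 / (2 * ((1 : NNReal) : ℝ))) (-x) x := by
    convert! ((((hasDerivAt_id x).sub_const 0).pow 2).neg).div_const (2 * ((1 : NNReal) : ℝ))
      using 1
    simp [neg_div]
  rw [gaussianPDFReal_def]
  convert! hexponent.exp.const_mul (√(2 * Real.pi * ((1 : NNReal) : ℝ)))⁻¹ using 1
  simp
  ring

theorem integral_pow_succ_gaussianReal (m : ℕ) :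
    ∫ x : ℝ, x ^ (m + 1) ∂(gaussianReal 0 1) = m * ∫ x : ℝ, x ^ (m - 1) ∂(gaussianReal 0 1) := by
  have hparts := integral_mul_deriv_eq_deriv_mul_of_integrable (A := ℝ)
    (u := fun x : ℝ => x ^ m) (u' := fun x => m * x ^ (m - 1)) (v := gaussianPDFReal 0 1)
    (v' := fun x => -(x * gaussianPDFReal 0 1 x))
    (fun x _ => hasDerivAt_pow m x) (fun x _ => hasDerivAt_gaussianPDFReal x)
    ((integrable_pow_mul_gaussianPDFReal (m + 1)).neg.congr
      (Filter.Eventually.of_forall fun x => by simp only [Pi.neg_apply, Pi.mul_apply]; ring))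
    (((integrable_pow_mul_gaussianPDFReal (m - 1)).const_mul (m : ℝ)).congr
      (Filter.Eventually.of_forall fun x => by simp only [Pi.mul_apply]; ring))
    (integrable_pow_mul_gaussianPDFReal m)
  simp only [mul_neg, integral_neg, neg_inj] at hparts
  simp only [integral_gaussianReal_eq_integral_smul one_ne_zero, smul_eq_mul]
  rw [← integral_const_mul]
  refine Eq.trans ?_ (hparts.trans ?_) <;> congr 1 <;> funext x <;> ring

open MvPolynomial

theorem hasLaw_restrict_stdGauss {σ Ω : Type*} [MeasurableSpace Ω] {μ : Measure Ω}
    {X : Ω → σ → ℝ} {s : Finset σ} (hX : ∀ j, HasLaw (fun ω => X ω j) (gaussianReal 0 1) μ)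
    (hind : iIndepFun (fun (j : s) ω => X ω j) μ) :
    HasLaw (fun ω (j : s) => X ω j) (stdGauss s) μ :=
  hind.hasLaw_pi fun j => hX j

theorem eval_monomial_eq_prod_support {σ R : Type*} [CommSemiring R] (x : σ → R) (α : σ →₀ ℕ)
    (a : R) : eval x (monomial α a) = a * ∏ j : α.support, x j ^ α j := by
  rw [eval_monomial, Finsupp.prod, Finset.prod_coe_sort α.support (fun j => x j ^ α j)]

section Monomial

variable {σ Ω : Type*} [MeasurableSpace Ω] {μ : Measure Ω} {X : Ω → σ → ℝ}
  (hX : ∀ j, HasLaw (fun ω => X ω j) (gaussianReal 0 1) μ) {α : σ →₀ ℕ}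
  (hind : iIndepFun (fun (j : α.support) ω => X ω j) μ)

include hX hind

theorem integrable_eval_monomial (a : ℝ) : Integrable (fun ω => eval (X ω) (monomial α a)) μ := by
  simp only [eval_monomial_eq_prod_support]
  have hlaw := hasLaw_restrict_stdGauss hX hind
  have hprod : Integrable (fun x : α.support → ℝ => ∏ j, x j ^ α j) (stdGauss α.support) :=
    Integrable.fintype_prod (f := fun (j : α.support) (x : ℝ) => x ^ α j)
      fun j => integrable_pow_gaussianReal (α j)
  rw [← hlaw.map_eq] at hprod
  exact (hprod.comp_aemeasurable hlaw.aemeasurable).const_mul a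

theorem integral_eval_monomial (a : ℝ) : ∫ ω, eval (X ω) (monomial α a) ∂μ =
    a * ∏ j ∈ α.support, ∫ x, x ^ α j ∂(gaussianReal 0 1) := by
  simp only [eval_monomial_eq_prod_support]
  have hlaw := hasLaw_restrict_stdGauss hX hind
  rw [integral_const_mul,
    ← Finset.prod_coe_sort α.support fun j => ∫ x, x ^ α j ∂(gaussianReal 0 1),
    ← integral_fintype_prod_eq_prod (f := fun (j : α.support) (x : ℝ) => x ^ α j)]
  congr 1
  exact hlaw.integral_comp (f := fun x => ∏ j, x j ^ α j)
    (by fun_prop : Continuous _).aestronglyMeasurable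

end Monomial

variable {σ : Type*} [Fintype σ]

theorem hasLaw_eval_stdGauss (j : σ) :
    HasLaw (fun x : σ → ℝ => x j) (gaussianReal 0 1) (stdGauss σ) :=
  (measurePreserving_eval (fun _ : σ => gaussianReal 0 1) j).hasLaw

theorem iIndepFun_eval_stdGauss : iIndepFun (fun j (x : σ → ℝ) => x j) (stdGauss σ) :=
  iIndepFun_pi (X := fun _ x => x) fun _ => aemeasurable_id

theorem integrable_eval_stdGauss (q : MvPolynomial σ ℝ) :
    Integrable (fun x => eval x q) (stdGauss σ) := by
  induction q using MvPolynomial.induction_on' with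
  | monomial α a =>
    exact integrable_eval_monomial hasLaw_eval_stdGauss
      (iIndepFun_eval_stdGauss.precomp Subtype.val_injective) a
  | add p q hp hq =>
    simp only [map_add]
    exact hp.add hq

/-- The expectation of a polynomial under the standard Gaussian measure. As a linear functional on
polynomials it can be manipulated without integrability side conditions. -/
noncomputable def gaussE (σ : Type*) [Fintype σ] : MvPolynomial σ ℝ →ₗ[ℝ] ℝ where
  toFun q := ∫ x, eval x q ∂(stdGauss σ)
  map_add' p q := by
    simp only [map_add]
    exact integral_add (integrable_eval_stdGauss p) (integrable_eval_stdGauss q)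
  map_smul' c q := by
    simp only [smul_eval, RingHom.id_apply, smul_eq_mul]
    exact integral_const_mul _ _

theorem gaussE_apply (q : MvPolynomial σ ℝ) : gaussE σ q = ∫ x, eval x q ∂(stdGauss σ) := rfl

@[simp]
theorem gaussE_C (a : ℝ) : gaussE σ (C a) = a := by simp [gaussE_apply]

theorem gaussE_C_mul (a : ℝ) (q : MvPolynomial σ ℝ) : gaussE σ (C a * q) = a * gaussE σ q := by
  rw [C_mul', map_smul, smul_eq_mul]

theorem gaussE_monomial_eq_prod_support (α : σ →₀ ℕ) (a : ℝ) :
    gaussE σ (monomial α a) = a * ∏ j ∈ α.support, ∫ x, x ^ α j ∂(gaussianReal 0 1) :=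
  integral_eval_monomial hasLaw_eval_stdGauss
    (iIndepFun_eval_stdGauss.precomp Subtype.val_injective) a

theorem gaussE_monomial (α : σ →₀ ℕ) (a : ℝ) :
    gaussE σ (monomial α a) = a * ∏ j, ∫ x, x ^ α j ∂(gaussianReal 0 1) := by
  rw [gaussE_monomial_eq_prod_support]
  congr 1
  refine Finset.prod_subset (Finset.subset_univ _) fun j _ hj => ?_
  simp [Finsupp.notMem_support_iff.1 hj]

theorem gaussE_X_mul (i : σ) (q : MvPolynomial σ ℝ) :
    gaussE σ (X i * q) = gaussE σ (pderiv i q) := by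
  classical
  induction q using MvPolynomial.induction_on' with
  | add p q hp hq => simp only [mul_add, map_add, hp, hq]
  | monomial α a =>
    have hother : ∏ j ∈ Finset.univ.erase i,
          ∫ x : ℝ, x ^ ((Finsupp.single i 1 + α : σ →₀ ℕ) j) ∂(gaussianReal 0 1)
        = ∏ j ∈ Finset.univ.erase i,
          ∫ x : ℝ, x ^ ((α - Finsupp.single i 1 : σ →₀ ℕ) j) ∂(gaussianReal 0 1) :=
      Finset.prod_congr rfl fun j hj => by
        simp [Finsupp.single_eq_of_ne' (Finset.ne_of_mem_erase hj).symm]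
    rw [pderiv_monomial, X, monomial_mul, gaussE_monomial, gaussE_monomial, one_mul,
      ← Finset.mul_prod_erase _ _ (Finset.mem_univ i),
      ← Finset.mul_prod_erase (a := i) _ _ (Finset.mem_univ i), hother]
    simp only [Finsupp.coe_add, Pi.add_apply, Finsupp.single_eq_same, Finsupp.coe_tsub,
      Pi.sub_apply, add_comm 1 (α i), integral_pow_succ_gaussianReal]
    ring

theorem gaussE_nonneg {q : MvPolynomial σ ℝ} (hq : ∀ x, 0 ≤ eval x q) : 0 ≤ gaussE σ q :=
  integral_nonneg hq

theorem gaussE_mono {p q : MvPolynomial σ ℝ} (hq : ∀ x, eval x p ≤ eval x q) :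
    gaussE σ p ≤ gaussE σ q :=
  integral_mono (integrable_eval_stdGauss p) (integrable_eval_stdGauss q) hq

theorem gaussE_pow_nonneg {m : ℕ} (hm : Even m) (q : MvPolynomial σ ℝ) : 0 ≤ gaussE σ (q ^ m) :=
  gaussE_nonneg fun x => by rw [map_pow]; exact hm.pow_nonneg _

theorem gaussE_mul_sq_le (p q : MvPolynomial σ ℝ) :
    gaussE σ (p * q) ^ 2 ≤ gaussE σ (p ^ 2) * gaussE σ (q ^ 2) := by
  have hquadratic : ∀ t : ℝ, 0 ≤ gaussE σ (q ^ 2) * (t * t) + (2 * gaussE σ (p * q)) * t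
      + gaussE σ (p ^ 2) := by
    intro t
    have hsq : (p + C t * q) ^ 2 = p ^ 2 + C (2 * t) * (p * q) + C (t * t) * q ^ 2 := by
      rw [map_mul, map_mul, map_ofNat]; ring
    have hnonneg := gaussE_pow_nonneg even_two (p + C t * q)
    rw [hsq, map_add, map_add, gaussE_C_mul, gaussE_C_mul] at hnonneg
    linarith
  have hdiscrim := discrim_le_zero hquadratic
  rw [discrim] at hdiscrim
  nlinarith

end StandardGaussian

section MomentMatching

open MvPolynomial

variable {σ : Type*} [Fintype σ]

/-- `ν` integrates polynomials of degree at most `k` like the standard Gaussian measure. Through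
this property the `k`-independence of Gaussians enters the argument. -/
structure MatchesGaussian (k : ℕ) (ν : Measure (σ → ℝ)) : Prop where
  integrable : ∀ q : MvPolynomial σ ℝ, q.totalDegree ≤ k → Integrable (fun x => eval x q) ν
  integral_eq : ∀ q : MvPolynomial σ ℝ, q.totalDegree ≤ k → ∫ x, eval x q ∂ν = gaussE σ q

theorem matchesGaussian_stdGauss (k : ℕ) : MatchesGaussian k (stdGauss σ) :=
  ⟨fun q _ => integrable_eval_stdGauss q, fun _ _ => rfl⟩

theorem MatchesGaussian.mono {k l : ℕ} {ν : Measure (σ → ℝ)} (hν : MatchesGaussian l ν)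
    (hkl : k ≤ l) : MatchesGaussian k ν :=
  ⟨fun q hq => hν.integrable q (hq.trans hkl), fun q hq => hν.integral_eq q (hq.trans hkl)⟩

theorem MatchesGaussian.of_monomials {Ω : Type*} [MeasurableSpace Ω] {μ : Measure Ω}
    {X : Ω → σ → ℝ} {k : ℕ} (hX : AEMeasurable X μ)
    (hint : ∀ α : σ →₀ ℕ, (α.sum fun _ e => e) ≤ k → ∀ a,
      Integrable (fun ω => eval (X ω) (monomial α a)) μ)
    (heq : ∀ α : σ →₀ ℕ, (α.sum fun _ e => e) ≤ k → ∀ a,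
      ∫ ω, eval (X ω) (monomial α a) ∂μ = gaussE σ (monomial α a)) :
    MatchesGaussian k (μ.map X) := by
  have hmeas : ∀ q : MvPolynomial σ ℝ, AEStronglyMeasurable (fun x => eval x q) (μ.map X) :=
    fun q => (MvPolynomial.continuous_eval q).aestronglyMeasurable
  have hsum : ∀ q : MvPolynomial σ ℝ, (fun ω => eval (X ω) q) =
      fun ω => ∑ α ∈ q.support, eval (X ω) (monomial α (q.coeff α)) := fun q => by
    conv_lhs => rw [q.as_sum]
    simp only [map_sum]
  refine ⟨fun q hq => ?_, fun q hq => ?_⟩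
  · rw [integrable_map_measure (hmeas q) hX]
    rw [Function.comp_def, hsum]
    exact integrable_finsetSum _ fun α hα => hint α ((le_totalDegree hα).trans hq) _
  · rw [integral_map hX (hmeas q)]
    rw [hsum, integral_finsetSum _ fun α hα => hint α ((le_totalDegree hα).trans hq) _,
      Finset.sum_congr rfl fun α hα => heq α ((le_totalDegree hα).trans hq) _, ← map_sum,
      ← q.as_sum]

theorem IsKIndepStdGaussian.aemeasurable {Ω : Type*} [MeasurableSpace Ω] {μ : Measure Ω}
    {n k : ℕ} {X : Ω → Fin n → ℝ} (hX : IsKIndepStdGaussian k X μ) : AEMeasurable X μ :=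
  aemeasurable_pi_iff.2 fun j => (hX.hasLaw j).aemeasurable

theorem IsKIndepStdGaussian.matchesGaussian {Ω : Type*} [MeasurableSpace Ω] {μ : Measure Ω}
    {n k : ℕ} {X : Ω → Fin n → ℝ} (hX : IsKIndepStdGaussian k X μ) :
    MatchesGaussian k (μ.map X) := by
  have hind : ∀ α : Fin n →₀ ℕ, (α.sum fun _ e => e) ≤ k →
      iIndepFun (fun (j : α.support) ω => X ω j) μ := fun α hα => by
    refine hX.indep _ (le_trans ?_ hα)
    rw [Finsupp.sum, Finset.card_eq_sum_ones]
    exact Finset.sum_le_sum fun j hj => Nat.one_le_iff_ne_zero.2 (Finsupp.mem_support_iff.1 hj)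
  refine MatchesGaussian.of_monomials hX.aemeasurable
    (fun α hα a => integrable_eval_monomial hX.hasLaw (hind α hα) a) fun α hα a => ?_
  rw [integral_eval_monomial hX.hasLaw (hind α hα), gaussE_monomial_eq_prod_support]

theorem IsIndepStdGaussian.hasLaw_stdGauss {Ω : Type*} [MeasurableSpace Ω] {ν : Measure Ω}
    {n : ℕ} {Y : Ω → Fin n → ℝ} (hY : IsIndepStdGaussian Y ν) : HasLaw Y (stdGauss (Fin n)) ν :=
  hY.indep.hasLaw_pi hY.hasLaw

end MomentMatching

section Chaos

open MvPolynomial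

theorem pderiv_pderiv_comm {σ R : Type*} [CommRing R] (i j : σ) (q : MvPolynomial σ R) :
    pderiv i (pderiv j q) = pderiv j (pderiv i q) := by
  classical
  have hbracket : ⁅pderiv (R := R) i, pderiv j⁆ = 0 := derivation_ext fun k => by
    rw [Derivation.commutator_apply, pderiv_X, pderiv_X, Pi.single_apply, Pi.single_apply]
    split_ifs <;> simp
  have hcomm := DFunLike.congr_fun hbracket q
  rw [Derivation.commutator_apply] at hcomm
  exact sub_eq_zero.1 hcomm

theorem totalDegree_pderiv_le {σ R : Type*} [CommSemiring R] (i : σ) (q : MvPolynomial σ R) :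
    (pderiv i q).totalDegree ≤ q.totalDegree - 1 := by
  classical
  refine Finset.sup_le fun α hα => Nat.le_sub_of_add_le ?_
  have hmem : α + Finsupp.single i 1 ∈ q.support := by
    rw [mem_support_iff, coeff_pderiv] at hα
    exact mem_support_iff.2 (left_ne_zero_of_mul hα)
  simpa [Finsupp.sum_add_index'] using le_totalDegree hmem

theorem totalDegree_pderiv_le_of_le {σ R : Type*} [CommSemiring R] {d : ℕ} {q : MvPolynomial σ R}
    (hq : q.totalDegree ≤ d) (i : σ) : (pderiv i q).totalDegree ≤ d :=
  (totalDegree_pderiv_le i q).trans ((Nat.sub_le _ _).trans hq)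

variable {σ : Type*} [Fintype σ]

/-- The number operator `∑ i, (x i * ∂ i - ∂ i ^ 2)`, minus the Ornstein-Uhlenbeck generator. -/
noncomputable def numberOp : Module.End ℝ (MvPolynomial σ ℝ) :=
  ∑ i, (LinearMap.mulLeft ℝ (X i) ∘ₗ (pderiv i).toLinearMap
    - (pderiv i).toLinearMap ∘ₗ (pderiv i).toLinearMap)

theorem numberOp_apply (q : MvPolynomial σ ℝ) :
    numberOp q = ∑ i, (X i * pderiv i q - pderiv i (pderiv i q)) := by
  simp [numberOp]

theorem pderiv_numberOp (j : σ) (q : MvPolynomial σ ℝ) :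
    pderiv j (numberOp q) = numberOp (pderiv j q) + pderiv j q := by
  classical
  have hterm : ∀ i, pderiv j (X i * pderiv i q - pderiv i (pderiv i q)) =
      (X i * pderiv i (pderiv j q) - pderiv i (pderiv i (pderiv j q)))
        + if i = j then pderiv j q else 0 := by
    intro i
    rw [map_sub, Derivation.leibniz, pderiv_X, pderiv_pderiv_comm j i (pderiv i q),
      pderiv_pderiv_comm j i q, Pi.single_apply]
    split_ifs with h
    · subst h; simp; ring
    · simp
  rw [numberOp_apply, map_sum, Finset.sum_congr rfl fun i _ => hterm i, Finset.sum_add_distrib,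
    numberOp_apply]
  simp

theorem numberOp_X_mul (j : σ) (q : MvPolynomial σ ℝ) :
    numberOp (X j * q) = X j * numberOp q + X j * q - 2 * pderiv j q := by
  classical
  have hterm : ∀ i, X i * pderiv i (X j * q) - pderiv i (pderiv i (X j * q)) =
      X j * (X i * pderiv i q - pderiv i (pderiv i q))
        + if i = j then X j * q - 2 * pderiv j q else 0 := by
    intro i
    simp only [Derivation.leibniz, map_add, smul_eq_mul, pderiv_X, Pi.single_apply]
    split_ifs with h h' h'
    · subst h; simp; ring
    · exact absurd h.symm h'
    · exact absurd h'.symm h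
    · simp; ring
  rw [numberOp_apply, Finset.sum_congr rfl fun i _ => hterm i, Finset.sum_add_distrib,
    ← Finset.mul_sum, ← numberOp_apply, Finset.sum_ite_eq' Finset.univ j,
    if_pos (Finset.mem_univ j), add_sub_assoc]

theorem gaussE_mul_numberOp (f g : MvPolynomial σ ℝ) :
    gaussE σ (f * numberOp g) = ∑ i, gaussE σ (pderiv i f * pderiv i g) := by
  rw [numberOp_apply, Finset.mul_sum, map_sum]
  refine Finset.sum_congr rfl fun i _ => ?_
  have hparts := gaussE_X_mul i (f * pderiv i g)
  rw [Derivation.leibniz, smul_eq_mul, smul_eq_mul, map_add] at hparts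
  rw [mul_sub, map_sub, mul_left_comm, hparts, mul_comm (pderiv i g), add_sub_cancel_left]

variable (σ) in
/-- The `k`-th Wiener chaos, as a space of polynomials: the eigenvectors of the number operator with
eigenvalue `k`. The degree bound makes `wienerChaos σ 0` visibly the space of constants. -/
noncomputable def wienerChaos (k : ℕ) : Submodule ℝ (MvPolynomial σ ℝ) :=
  restrictTotalDegree σ ℝ k ⊓ Module.End.eigenspace numberOp (k : ℝ)

theorem mem_wienerChaos {k : ℕ} {f : MvPolynomial σ ℝ} :
    f ∈ wienerChaos σ k ↔ f.totalDegree ≤ k ∧ numberOp f = (k : ℝ) • f := by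
  rw [wienerChaos, Submodule.mem_inf, mem_restrictTotalDegree, Module.End.mem_eigenspace_iff]

theorem C_mem_wienerChaos_zero (a : ℝ) : (C a : MvPolynomial σ ℝ) ∈ wienerChaos σ 0 :=
  mem_wienerChaos.2 ⟨by simp, by simp [numberOp_apply]⟩

theorem exists_eq_C_of_mem_wienerChaos_zero {f : MvPolynomial σ ℝ} (hf : f ∈ wienerChaos σ 0) :
    ∃ a, f = C a :=
  ⟨_, totalDegree_eq_zero_iff_eq_C.1 (Nat.le_zero.1 (mem_wienerChaos.1 hf).1)⟩

theorem pderiv_eq_zero_of_mem_wienerChaos_zero {f : MvPolynomial σ ℝ} (hf : f ∈ wienerChaos σ 0)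
    (j : σ) : pderiv j f = 0 := by
  obtain ⟨a, rfl⟩ := exists_eq_C_of_mem_wienerChaos_zero hf
  simp

theorem numberOp_pderiv_of_mem_wienerChaos {k : ℕ} {f : MvPolynomial σ ℝ}
    (hf : f ∈ wienerChaos σ k) (j : σ) : numberOp (pderiv j f) = ((k : ℝ) - 1) • pderiv j f := by
  have hcomm := pderiv_numberOp j f
  rw [(mem_wienerChaos.1 hf).2, Derivation.map_smul] at hcomm
  rw [sub_smul, one_smul, hcomm, add_sub_cancel_right]

theorem pderiv_mem_wienerChaos {k : ℕ} {f : MvPolynomial σ ℝ} (hf : f ∈ wienerChaos σ (k + 1))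
    (j : σ) : pderiv j f ∈ wienerChaos σ k := by
  refine mem_wienerChaos.2 ⟨(totalDegree_pderiv_le j f).trans ?_, ?_⟩
  · have := (mem_wienerChaos.1 hf).1
    omega
  · rw [numberOp_pderiv_of_mem_wienerChaos hf]
    simp

theorem X_mul_sub_pderiv_mem_wienerChaos {k : ℕ} {f : MvPolynomial σ ℝ}
    (hf : f ∈ wienerChaos σ k) (j : σ) : X j * f - pderiv j f ∈ wienerChaos σ (k + 1) := by
  obtain ⟨hdeg, heigen⟩ := mem_wienerChaos.1 hf
  refine mem_wienerChaos.2 ⟨(totalDegree_sub _ _).trans (max_le ?_ ?_), ?_⟩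
  · refine (totalDegree_mul _ _).trans ?_
    rw [totalDegree_X, add_comm]
    exact Nat.add_le_add_right hdeg 1
  · exact (totalDegree_pderiv_le_of_le hdeg j).trans k.le_succ
  · rw [map_sub, numberOp_X_mul, heigen, numberOp_pderiv_of_mem_wienerChaos hf]
    simp only [smul_eq_C_mul, Nat.cast_add, Nat.cast_one, map_add, map_sub, map_one]
    ring

theorem gaussE_mul_eq_zero_of_mem_wienerChaos {j k : ℕ} {f g : MvPolynomial σ ℝ}
    (hf : f ∈ wienerChaos σ j) (hg : g ∈ wienerChaos σ k) (hjk : j ≠ k) :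
    gaussE σ (f * g) = 0 := by
  have hk := gaussE_mul_numberOp f g
  have hj := gaussE_mul_numberOp g f
  rw [(mem_wienerChaos.1 hg).2, mul_smul_comm, map_smul, smul_eq_mul] at hk
  rw [(mem_wienerChaos.1 hf).2, mul_smul_comm, map_smul, smul_eq_mul, mul_comm g] at hj
  have hsymm : ((j : ℝ) - k) * gaussE σ (f * g) = 0 := by
    rw [sub_mul, hk, hj, sub_eq_zero]
    exact Finset.sum_congr rfl fun i _ => by rw [mul_comm]
  exact (mul_eq_zero.1 hsymm).resolve_left (sub_ne_zero.2 (Nat.cast_injective.ne hjk))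

theorem sum_gaussE_pderiv_sq_of_mem_wienerChaos {k : ℕ} {f : MvPolynomial σ ℝ}
    (hf : f ∈ wienerChaos σ k) : ∑ i, gaussE σ (pderiv i f ^ 2) = k * gaussE σ (f ^ 2) := by
  have h := gaussE_mul_numberOp f f
  rw [(mem_wienerChaos.1 hf).2, mul_smul_comm, map_smul, smul_eq_mul] at h
  simpa only [sq] using h.symm

/-- `q = ∑ k ≤ d, f k` is the chaos decomposition of `q`. -/
structure ChaosDecomp (d : ℕ) (f : ℕ → MvPolynomial σ ℝ) (q : MvPolynomial σ ℝ) : Prop where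
  mem : ∀ k, f k ∈ wienerChaos σ k
  eq_zero : ∀ k, d < k → f k = 0
  eq_sum : q = ∑ k ∈ Finset.range (d + 1), f k

theorem X_mul_mem_iSup_wienerChaos {d : ℕ} {q : MvPolynomial σ ℝ}
    (hq : q ∈ ⨆ k ∈ Finset.range (d + 1), wienerChaos σ k) (j : σ) :
    X j * q ∈ ⨆ k ∈ Finset.range (d + 2), wienerChaos σ k := by
  obtain ⟨f, rfl⟩ := (Submodule.mem_iSup_finset_iff_exists_sum _ q).1 hq
  rw [Finset.mul_sum]
  refine Submodule.sum_mem _ fun k hk => ?_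
  have hk' : k < d + 1 := Finset.mem_range.1 hk
  rw [← sub_add_cancel (X j * (f k : MvPolynomial σ ℝ)) (pderiv j (f k))]
  refine Submodule.add_mem _ ?_ ?_
  · exact le_biSup (wienerChaos σ) (Finset.mem_range.2 (by omega))
      (X_mul_sub_pderiv_mem_wienerChaos (f k).2 j)
  · rcases k with _ | k
    · rw [pderiv_eq_zero_of_mem_wienerChaos_zero (f 0).2 j]
      exact Submodule.zero_mem _
    · exact le_biSup (wienerChaos σ) (Finset.mem_range.2 (by omega))
        (pderiv_mem_wienerChaos (f (k + 1)).2 j)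

theorem monomial_mem_iSup_wienerChaos (α : σ →₀ ℕ) (a : ℝ) :
    monomial α a ∈ ⨆ k ∈ Finset.range (α.degree + 1), wienerChaos σ k := by
  classical
  induction hm : α.degree generalizing α with
  | zero =>
    rw [(Finsupp.degree_eq_zero_iff α).1 hm]
    exact le_biSup (wienerChaos σ) (by simp) (C_mem_wienerChaos_zero a)
  | succ m ih =>
    have hne : α ≠ 0 := by rintro rfl; simp at hm
    obtain ⟨i, hi⟩ := Finsupp.ne_iff.1 hne
    have hle : Finsupp.single i 1 ≤ α := by
      simpa [Finsupp.single_le_iff, Nat.one_le_iff_ne_zero] using hi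
    have hsplit : Finsupp.single i 1 + (α - Finsupp.single i 1) = α := add_tsub_cancel_of_le hle
    have hdeg : (α - Finsupp.single i 1).degree = m := by
      have := congrArg Finsupp.degree hsplit
      rw [map_add, Finsupp.degree_single] at this
      omega
    have hmul : monomial α a = X i * monomial (α - Finsupp.single i 1) a := by
      rw [X, monomial_mul, one_mul, hsplit]
    rw [hmul]
    exact X_mul_mem_iSup_wienerChaos (ih _ hdeg) i

theorem exists_chaosDecomp {d : ℕ} {q : MvPolynomial σ ℝ} (hq : q.totalDegree ≤ d) :
    ∃ f, ChaosDecomp d f q := by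
  have hmem : q ∈ ⨆ k ∈ Finset.range (d + 1), wienerChaos σ k := by
    rw [q.as_sum]
    refine Submodule.sum_mem _ fun α hα => ?_
    have hdeg : α.degree ≤ d := (le_totalDegree hα).trans hq
    have hmono : ⨆ k ∈ Finset.range (α.degree + 1), wienerChaos σ k
        ≤ ⨆ k ∈ Finset.range (d + 1), wienerChaos σ k :=
      biSup_mono fun k hk => Finset.range_subset_range.2 (by omega) hk
    exact hmono (monomial_mem_iSup_wienerChaos α _)
  obtain ⟨f, hf⟩ := (Submodule.mem_iSup_finset_iff_exists_sum _ q).1 hmem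
  refine ⟨fun k => if k ≤ d then f k else 0, fun k => ?_, fun k hk => if_neg hk.not_ge, ?_⟩
  · split_ifs
    exacts [(f k).2, Submodule.zero_mem _]
  · rw [← hf]
    exact Finset.sum_congr rfl fun k hk =>
      (if_pos (Nat.lt_succ_iff.1 (Finset.mem_range.1 hk))).symm

namespace ChaosDecomp

variable {d : ℕ} {f : ℕ → MvPolynomial σ ℝ} {q : MvPolynomial σ ℝ}

theorem mono {e : ℕ} (h : ChaosDecomp d f q) (hde : d ≤ e) : ChaosDecomp e f q :=
  ⟨h.mem, fun k hk => h.eq_zero k (hde.trans_lt hk), by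
    rw [h.eq_sum]
    exact Finset.sum_subset (Finset.range_subset_range.2 (by omega)) fun k _ hk =>
      h.eq_zero k (by rw [Finset.mem_range] at hk; omega)⟩

theorem pderiv (h : ChaosDecomp (d + 1) f q) (i : σ) :
    ChaosDecomp d (fun k => MvPolynomial.pderiv i (f (k + 1))) (MvPolynomial.pderiv i q) :=
  ⟨fun k => pderiv_mem_wienerChaos (h.mem (k + 1)) i,
    fun k hk => by rw [h.eq_zero (k + 1) (by omega), map_zero], by
    rw [h.eq_sum, Finset.sum_range_succ', map_add,
      pderiv_eq_zero_of_mem_wienerChaos_zero (h.mem 0), add_zero, map_sum]⟩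

theorem gaussE_sq (h : ChaosDecomp d f q) :
    gaussE σ (q ^ 2) = ∑ k ∈ Finset.range (d + 1), gaussE σ (f k ^ 2) := by
  rw [h.eq_sum, sq, Finset.sum_mul_sum, map_sum]
  refine Finset.sum_congr rfl fun k hk => ?_
  rw [map_sum, Finset.sum_eq_single_of_mem k hk, sq]
  exact fun j _ hj => gaussE_mul_eq_zero_of_mem_wienerChaos (h.mem k) (h.mem j) hj.symm

theorem gaussE_eq (h : ChaosDecomp d f q) : gaussE σ q = gaussE σ (f 0) := by
  rw [h.eq_sum, map_sum]
  refine Finset.sum_eq_single_of_mem 0 (by simp) fun k _ hk => ?_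
  simpa using gaussE_mul_eq_zero_of_mem_wienerChaos (h.mem k) (C_mem_wienerChaos_zero 1) hk

end ChaosDecomp

/-- The squared Frobenius norm of the Gaussian expectation of the `k`-th derivative tensor. -/
noncomputable def meanDerivSq : ℕ → MvPolynomial σ ℝ → ℝ
  | 0, q => gaussE σ q ^ 2
  | k + 1, q => ∑ i, meanDerivSq k (pderiv i q)

theorem meanDerivSq_nonneg (k : ℕ) (q : MvPolynomial σ ℝ) : 0 ≤ meanDerivSq k q := by
  induction k generalizing q with
  | zero => exact sq_nonneg _
  | succ k ih => exact Finset.sum_nonneg fun i _ => ih _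

theorem ChaosDecomp.meanDerivSq_eq {d : ℕ} {f : ℕ → MvPolynomial σ ℝ} {q : MvPolynomial σ ℝ}
    (h : ChaosDecomp d f q) (k : ℕ) : meanDerivSq k q = k.factorial * gaussE σ (f k ^ 2) := by
  induction k generalizing d f q with
  | zero =>
    obtain ⟨a, ha⟩ := exists_eq_C_of_mem_wienerChaos_zero (h.mem 0)
    rw [meanDerivSq, h.gaussE_eq, ha, ← C_pow, gaussE_C, gaussE_C, Nat.factorial_zero,
      Nat.cast_one, one_mul]
  | succ k ih =>
    rw [meanDerivSq, Finset.sum_congr rfl fun i _ => ih ((h.mono d.le_succ).pderiv i),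
      ← Finset.mul_sum, sum_gaussE_pderiv_sq_of_mem_wienerChaos (h.mem (k + 1)),
      Nat.factorial_succ]
    push_cast
    ring

theorem gaussE_sq_eq_sum_meanDerivSq {d : ℕ} {q : MvPolynomial σ ℝ} (hq : q.totalDegree ≤ d) :
    gaussE σ (q ^ 2) = ∑ k ∈ Finset.range (d + 1), meanDerivSq k q / k.factorial := by
  obtain ⟨f, hf⟩ := exists_chaosDecomp hq
  rw [hf.gaussE_sq]
  refine Finset.sum_congr rfl fun k _ => ?_
  rw [hf.meanDerivSq_eq, mul_div_cancel_left₀ _ (by positivity)]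

end Chaos

section Hypercontractivity

open MvPolynomial

theorem sqrt_le_of_deriv_le {A A' W W' : ℝ → ℝ} (hA : ∀ s, HasDerivAt A (A' s) s)
    (hW : ∀ s, HasDerivAt W (W' s) s) (hA_nonneg : ∀ s, 0 ≤ A s) (h_zero : √(A 0) ≤ W 0)
    (hle : ∀ s, 0 < s → A' s ≤ 2 * √(A s) * W' s) (hW' : ∀ s, 0 < s → 0 ≤ W' s) :
    √(A 1) ≤ W 1 := by
  -- `√A` need not be differentiable where `A = 0`, so `A` is shifted by `δ ^ 2`.
  refine le_of_forall_pos_le_add fun δ hδ => ?_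
  have hderiv : ∀ s, HasDerivAt (fun s => √(A s + δ ^ 2) - W s)
      (A' s / (2 * √(A s + δ ^ 2)) - W' s) s := fun s =>
    (((hA s).add_const _).sqrt (by have := hA_nonneg s; positivity)).sub (hW s)
  have hanti : AntitoneOn (fun s => √(A s + δ ^ 2) - W s) (Set.Icc 0 1) := by
    refine antitoneOn_of_deriv_nonpos (convex_Icc 0 1)
      (fun s _ => (hderiv s).continuousAt.continuousWithinAt)
      (fun s _ => (hderiv s).differentiableAt.differentiableWithinAt) fun s hs => ?_
    rw [interior_Icc] at hs
    have hpos : 0 < √(A s + δ ^ 2) := Real.sqrt_pos.2 (by have := hA_nonneg s; positivity)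
    rw [(hderiv s).deriv, sub_nonpos, div_le_iff₀ (by positivity)]
    have hsqrt : √(A s) * W' s ≤ √(A s + δ ^ 2) * W' s :=
      mul_le_mul_of_nonneg_right (Real.sqrt_le_sqrt (by nlinarith)) (hW' s hs.1)
    linarith [hle s hs.1]
  have h_zero_one : √(A 1 + δ ^ 2) - W 1 ≤ √(A 0 + δ ^ 2) - W 0 :=
    hanti (by simp) (by simp) zero_le_one
  have h_one : √(A 1) ≤ √(A 1 + δ ^ 2) := Real.sqrt_le_sqrt (by nlinarith)
  have h_shift : √(A 0 + δ ^ 2) ≤ √(A 0) + δ := by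
    refine Real.sqrt_le_iff.2 ⟨by positivity, ?_⟩
    nlinarith [Real.sq_sqrt (hA_nonneg 0), mul_nonneg (Real.sqrt_nonneg (A 0)) hδ.le]
  linarith

variable {σ : Type*} [Fintype σ]

theorem hasDerivAt_gaussE_eval (R : Polynomial (MvPolynomial σ ℝ)) (s : ℝ) :
    HasDerivAt (fun s => gaussE σ (R.eval (C s))) (gaussE σ (R.derivative.eval (C s))) s := by
  induction R using Polynomial.induction_on' with
  | add p q hp hq =>
    simp only [Polynomial.eval_add, map_add]
    exact hp.add hq
  | monomial n p =>
    have heval : ∀ (m : ℕ) (q : MvPolynomial σ ℝ) (s : ℝ),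
        gaussE σ ((Polynomial.monomial m q).eval (C s)) = gaussE σ q * s ^ m := by
      intro m q s
      rw [Polynomial.eval_monomial, mul_comm, ← C_pow, gaussE_C_mul, mul_comm]
    have hcast : gaussE σ (p * (n : MvPolynomial σ ℝ)) = n * gaussE σ p := by
      rw [mul_comm, ← gaussE_C_mul, map_natCast]
    simp only [Polynomial.derivative_monomial, heval, hcast]
    rw [mul_comm (n : ℝ), mul_assoc]
    exact (hasDerivAt_pow n s).const_mul (gaussE σ p)

theorem hasDerivAt_gaussE_eval_pow (R : Polynomial (MvPolynomial σ ℝ)) (m : ℕ) (s : ℝ) :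
    HasDerivAt (fun s => gaussE σ (R.eval (C s) ^ m))
      (gaussE σ ((R ^ m).derivative.eval (C s))) s := by
  simpa only [Polynomial.eval_pow] using hasDerivAt_gaussE_eval (R ^ m) s

theorem gaussE_sq_mul_sq_le (p q : MvPolynomial σ ℝ) :
    gaussE σ (p ^ 2 * q ^ 2) ≤ √(gaussE σ (p ^ 4)) * √(gaussE σ (q ^ 4)) := by
  have hCS := gaussE_mul_sq_le (p ^ 2) (q ^ 2)
  rw [← pow_mul, ← pow_mul] at hCS
  rw [← Real.sqrt_mul (gaussE_pow_nonneg (by decide) p)]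
  exact Real.le_sqrt_of_sq_le hCS

theorem sqrt_gaussE_C_pow_four (a : ℝ) : √(gaussE σ (C a ^ 4)) = gaussE σ (C a ^ 2) := by
  rw [← C_pow, ← C_pow, gaussE_C, gaussE_C, show a ^ 4 = (a ^ 2) ^ 2 by ring,
    Real.sqrt_sq (sq_nonneg a)]

/-- The curve `s ↦ ∑ k ≤ d, s ^ k f k`, as a polynomial in `s`. For a chaos decomposition `f` of
`q` and `s = exp (-t)` its value is the Ornstein-Uhlenbeck semigroup at time `t` applied to `q`. -/
noncomputable def noiseCurve (d : ℕ) (f : ℕ → MvPolynomial σ ℝ) : Polynomial (MvPolynomial σ ℝ) :=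
  ∑ k ∈ Finset.range (d + 1), Polynomial.monomial k (f k)

omit [Fintype σ] in
theorem eval_noiseCurve (d : ℕ) (f : ℕ → MvPolynomial σ ℝ) (s : ℝ) :
    (noiseCurve d f).eval (C s) = ∑ k ∈ Finset.range (d + 1), s ^ k • f k := by
  simp only [noiseCurve, Polynomial.eval_finsetSum, Polynomial.eval_monomial, smul_eq_C_mul, C_pow,
    mul_comm]

theorem C_mul_eval_derivative_noiseCurve {f : ℕ → MvPolynomial σ ℝ}
    (hf : ∀ k, f k ∈ wienerChaos σ k) (d : ℕ) (s : ℝ) :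
    C s * (noiseCurve d f).derivative.eval (C s) = numberOp ((noiseCurve d f).eval (C s)) := by
  rw [eval_noiseCurve, map_sum, noiseCurve, Polynomial.derivative_sum, Polynomial.eval_finsetSum,
    Finset.mul_sum]
  refine Finset.sum_congr rfl fun k _ => ?_
  rw [map_smul, (mem_wienerChaos.1 (hf k)).2, Polynomial.derivative_monomial,
    Polynomial.eval_monomial, smul_eq_C_mul, smul_eq_C_mul, C_pow, map_natCast]
  rcases k with _ | k
  · simp
  · rw [Nat.add_sub_cancel, pow_succ]; ring

theorem mul_gaussE_derivative_noiseCurve_pow_four {f : ℕ → MvPolynomial σ ℝ}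
    (hf : ∀ k, f k ∈ wienerChaos σ k) (d : ℕ) (s : ℝ) :
    s * gaussE σ ((noiseCurve d f ^ 4).derivative.eval (C s)) =
      12 * ∑ i, gaussE σ
        ((noiseCurve d f).eval (C s) ^ 2 * pderiv i ((noiseCurve d f).eval (C s)) ^ 2) := by
  set q := (noiseCurve d f).eval (C s) with hq
  have hderiv : C s * (noiseCurve d f ^ 4).derivative.eval (C s) = C 4 * q ^ 3 * numberOp q := by
    rw [← C_mul_eval_derivative_noiseCurve hf, Polynomial.derivative_pow]
    simp only [Polynomial.eval_mul, Polynomial.eval_pow, Polynomial.eval_C, ← hq,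
      show (C 4 : MvPolynomial σ ℝ) = 4 from map_ofNat C 4]
    push_cast
    ring
  rw [← gaussE_C_mul, hderiv, gaussE_mul_numberOp, Finset.mul_sum]
  refine Finset.sum_congr rfl fun i _ => ?_
  rw [← gaussE_C_mul, pderiv_C_mul, pderiv_pow, show (C 12 : MvPolynomial σ ℝ) = C 4 * C 3 by
    rw [← C_mul]; norm_num, show (C 3 : MvPolynomial σ ℝ) = 3 from map_ofNat C 3]
  congr 1
  push_cast
  ring

theorem sum_gaussE_pderiv_smul_sq {f : ℕ → MvPolynomial σ ℝ} (hf : ∀ k, f k ∈ wienerChaos σ k)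
    (d : ℕ) (s : ℝ) :
    6 * ∑ i, ∑ k ∈ Finset.range (d + 1), 3 ^ k * gaussE σ (pderiv i (s ^ (k + 1) • f (k + 1)) ^ 2)
      = s * ∑ k ∈ Finset.range (d + 2), 3 ^ k * ((2 * k : ℕ) * s ^ (2 * k - 1))
        * gaussE σ (f k ^ 2) := by
  rw [Finset.sum_range_succ', Finset.sum_comm, mul_add, Finset.mul_sum, Finset.mul_sum]
  simp only [mul_zero, Nat.cast_zero, zero_mul, add_zero]
  refine Finset.sum_congr rfl fun k _ => ?_
  have hsmul : s ^ (k + 1) • f (k + 1) ∈ wienerChaos σ (k + 1) :=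
    Submodule.smul_mem _ _ (hf (k + 1))
  rw [← Finset.mul_sum, sum_gaussE_pderiv_sq_of_mem_wienerChaos hsmul, smul_pow, map_smul,
    smul_eq_mul, show 2 * (k + 1) - 1 = 2 * k + 1 by omega]
  push_cast
  ring

namespace ChaosDecomp

variable {d : ℕ} {f : ℕ → MvPolynomial σ ℝ} {q : MvPolynomial σ ℝ}

theorem eval_noiseCurve (h : ChaosDecomp d f q) (s : ℝ) :
    ChaosDecomp d (fun k => s ^ k • f k) ((noiseCurve d f).eval (C s)) :=
  ⟨fun k => Submodule.smul_mem _ _ (h.mem k), fun k hk => by rw [h.eq_zero k hk, smul_zero],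
    _root_.eval_noiseCurve d f s⟩

theorem eval_noiseCurve_zero (h : ChaosDecomp d f q) :
    ∃ a, f 0 = C a ∧ (noiseCurve d f).eval (C 0) = C a := by
  obtain ⟨a, ha⟩ := exists_eq_C_of_mem_wienerChaos_zero (h.mem 0)
  refine ⟨a, ha, ?_⟩
  rw [_root_.eval_noiseCurve, Finset.sum_range_succ', ha]
  simp

theorem eval_noiseCurve_one (h : ChaosDecomp d f q) : (noiseCurve d f).eval (C 1) = q := by
  rw [_root_.eval_noiseCurve, h.eq_sum]
  simp only [one_pow, one_smul]

/-- The induction step: along the noise curve, `A s = 𝔼[q_s⁴]` and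
`W s = ∑ k, 3 ^ k s ^ (2 k) 𝔼[f_k²]` satisfy `A' ≤ 2 √A W'`, because integration by parts gives
`s A' = 12 ∑ i, 𝔼[q_s² (∂ᵢ q_s)²]`. -/
theorem sqrt_gaussE_pow_four_le_of_pderiv (h : ChaosDecomp (d + 1) f q)
    (hpderiv : ∀ (s : ℝ) (i : σ),
      √(gaussE σ (MvPolynomial.pderiv i ((noiseCurve (d + 1) f).eval (C s)) ^ 4)) ≤
        ∑ k ∈ Finset.range (d + 1),
          3 ^ k * gaussE σ (MvPolynomial.pderiv i (s ^ (k + 1) • f (k + 1)) ^ 2)) :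
    √(gaussE σ (q ^ 4)) ≤ ∑ k ∈ Finset.range (d + 2), 3 ^ k * gaussE σ (f k ^ 2) := by
  have hsq : ∀ p : MvPolynomial σ ℝ, 0 ≤ gaussE σ (p ^ 2) := gaussE_pow_nonneg even_two
  have hA : ∀ s, HasDerivAt (fun s => gaussE σ ((noiseCurve (d + 1) f).eval (C s) ^ 4))
      (gaussE σ ((noiseCurve (d + 1) f ^ 4).derivative.eval (C s))) s :=
    hasDerivAt_gaussE_eval_pow _ 4
  have hW : ∀ s : ℝ, HasDerivAt
      (fun s => ∑ k ∈ Finset.range (d + 2), 3 ^ k * s ^ (2 * k) * gaussE σ (f k ^ 2))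
      (∑ k ∈ Finset.range (d + 2), 3 ^ k * ((2 * k : ℕ) * s ^ (2 * k - 1)) * gaussE σ (f k ^ 2))
      s := fun s =>
    HasDerivAt.fun_sum fun k _ => ((hasDerivAt_pow (2 * k) s).const_mul _).mul_const _
  have hW_one : ∑ k ∈ Finset.range (d + 2), 3 ^ k * gaussE σ (f k ^ 2) =
      ∑ k ∈ Finset.range (d + 2), 3 ^ k * 1 ^ (2 * k) * gaussE σ (f k ^ 2) := by
    simp only [one_pow, mul_one]
  have h_zero : √(gaussE σ ((noiseCurve (d + 1) f).eval (C 0) ^ 4)) ≤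
      ∑ k ∈ Finset.range (d + 2), 3 ^ k * 0 ^ (2 * k) * gaussE σ (f k ^ 2) := by
    obtain ⟨a, hf, hq⟩ := h.eval_noiseCurve_zero
    rw [hq, sqrt_gaussE_C_pow_four, Finset.sum_range_succ', hf]
    simp
  rw [← h.eval_noiseCurve_one, hW_one]
  refine sqrt_le_of_deriv_le hA hW (fun s => gaussE_pow_nonneg (by decide) _) h_zero
    (fun s hs => le_of_mul_le_mul_left ?_ hs)
    (fun s hs => Finset.sum_nonneg fun k _ => by have := hsq (f k); positivity)
  rw [mul_gaussE_derivative_noiseCurve_pow_four h.mem, mul_left_comm,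
    ← sum_gaussE_pderiv_smul_sq h.mem]
  have hsum := Finset.sum_le_sum fun i (_ : i ∈ Finset.univ) =>
    (gaussE_sq_mul_sq_le ((noiseCurve (d + 1) f).eval (C s)) _).trans
      (mul_le_mul_of_nonneg_left (hpderiv s i) (Real.sqrt_nonneg _))
  rw [← Finset.mul_sum] at hsum
  linarith

theorem sqrt_gaussE_pow_four_le (h : ChaosDecomp d f q) :
    √(gaussE σ (q ^ 4)) ≤ ∑ k ∈ Finset.range (d + 1), 3 ^ k * gaussE σ (f k ^ 2) := by
  induction d generalizing f q with
  | zero =>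
    obtain ⟨a, hf, -⟩ := h.eval_noiseCurve_zero
    obtain rfl : q = C a := by rw [h.eq_sum, Finset.sum_range_one, hf]
    rw [sqrt_gaussE_C_pow_four, Finset.sum_range_one, pow_zero, one_mul, hf]
  | succ d ih =>
    exact h.sqrt_gaussE_pow_four_le_of_pderiv fun s i => ih ((h.eval_noiseCurve s).pderiv i)

end ChaosDecomp

theorem sqrt_gaussE_pow_four_le {d : ℕ} {q : MvPolynomial σ ℝ} (hq : q.totalDegree ≤ d) :
    √(gaussE σ (q ^ 4)) ≤ 3 ^ d * gaussE σ (q ^ 2) := by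
  obtain ⟨f, hf⟩ := exists_chaosDecomp hq
  rw [hf.gaussE_sq, Finset.mul_sum]
  refine hf.sqrt_gaussE_pow_four_le.trans (Finset.sum_le_sum fun k hk => ?_)
  exact mul_le_mul_of_nonneg_right
    (pow_le_pow_right₀ (by norm_num) (Nat.lt_succ_iff.1 (Finset.mem_range.1 hk)))
    (gaussE_pow_nonneg even_two _)

theorem nine_pow_mul_sq (d : ℕ) (a : ℝ) : 9 ^ d * a ^ 2 = (3 ^ d * a) ^ 2 := by
  rw [mul_pow, pow_right_comm]; norm_num

theorem gaussE_pow_four_le {d : ℕ} {q : MvPolynomial σ ℝ} (hq : q.totalDegree ≤ d) :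
    gaussE σ (q ^ 4) ≤ 9 ^ d * gaussE σ (q ^ 2) ^ 2 := by
  rw [nine_pow_mul_sq]
  exact (Real.sqrt_le_iff.1 (sqrt_gaussE_pow_four_le hq)).2

theorem gaussE_sum_sq_sq_le {ι : Type*} {d : ℕ} (s : Finset ι) {t : ι → MvPolynomial σ ℝ}
    (ht : ∀ a ∈ s, (t a).totalDegree ≤ d) :
    gaussE σ ((∑ a ∈ s, t a ^ 2) ^ 2) ≤ 9 ^ d * gaussE σ (∑ a ∈ s, t a ^ 2) ^ 2 := by
  calc gaussE σ ((∑ a ∈ s, t a ^ 2) ^ 2)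
      = ∑ a ∈ s, ∑ b ∈ s, gaussE σ (t a ^ 2 * t b ^ 2) := by
        simp only [sq (∑ a ∈ s, t a ^ 2), Finset.sum_mul_sum, map_sum]
    _ ≤ ∑ a ∈ s, ∑ b ∈ s, √(gaussE σ (t a ^ 4)) * √(gaussE σ (t b ^ 4)) :=
        Finset.sum_le_sum fun a _ => Finset.sum_le_sum fun b _ => gaussE_sq_mul_sq_le _ _
    _ = (∑ a ∈ s, √(gaussE σ (t a ^ 4))) ^ 2 := by rw [sq, Finset.sum_mul_sum]
    _ ≤ (∑ a ∈ s, 3 ^ d * gaussE σ (t a ^ 2)) ^ 2 := by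
        gcongr with a ha
        exact sqrt_gaussE_pow_four_le (ht a ha)
    _ = 9 ^ d * gaussE σ (∑ a ∈ s, t a ^ 2) ^ 2 := by
        rw [nine_pow_mul_sq, map_sum, Finset.mul_sum]

theorem gaussE_pow_two_pow_le (r : ℕ) {d : ℕ} {q : MvPolynomial σ ℝ} (hq : q.totalDegree ≤ d) :
    gaussE σ (q ^ 2 ^ (r + 1)) ≤ 9 ^ (d * (r * 2 ^ r)) * gaussE σ (q ^ 2) ^ 2 ^ r := by
  have hE : 0 ≤ gaussE σ (q ^ 2) := gaussE_pow_nonneg even_two q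
  induction r with
  | zero => simp
  | succ r ih =>
    have hdeg : (q ^ 2 ^ r).totalDegree ≤ 2 ^ r * d :=
      (totalDegree_pow _ _).trans (Nat.mul_le_mul_left _ hq)
    have hE' : 0 ≤ gaussE σ (q ^ 2 ^ (r + 1)) :=
      gaussE_pow_nonneg (even_two.pow_of_ne_zero r.succ_ne_zero) q
    calc gaussE σ (q ^ 2 ^ (r + 1 + 1))
        = gaussE σ ((q ^ 2 ^ r) ^ 4) := by rw [← pow_mul]; congr 2; ring
      _ ≤ 9 ^ (2 ^ r * d) * gaussE σ (q ^ 2 ^ (r + 1)) ^ 2 := by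
        simpa only [← pow_mul, ← pow_succ] using gaussE_pow_four_le hdeg
      _ ≤ 9 ^ (2 ^ r * d) * (9 ^ (d * (r * 2 ^ r)) * gaussE σ (q ^ 2) ^ 2 ^ r) ^ 2 := by gcongr
      _ = 9 ^ (2 ^ r * d + d * (r * 2 ^ r) * 2) * gaussE σ (q ^ 2) ^ 2 ^ (r + 1) := by
        rw [mul_pow, ← pow_mul, ← pow_mul, ← mul_assoc, ← pow_add, pow_succ 2 r]
      _ ≤ 9 ^ (d * ((r + 1) * 2 ^ (r + 1))) * gaussE σ (q ^ 2) ^ 2 ^ (r + 1) := by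
        gcongr
        · norm_num
        · rw [pow_succ]; nlinarith [Nat.zero_le (2 ^ r * d)]

end Hypercontractivity

section TrigPolynomial

open MvPolynomial

theorem hasDerivAt_eval_curve {σ : Type*} [Fintype σ] (q : MvPolynomial σ ℝ) {c c' : ℝ → σ → ℝ}
    {s : ℝ} (hc : ∀ i, HasDerivAt (fun s => c s i) (c' s i) s) :
    HasDerivAt (fun s => eval (c s) q) (∑ i, c' s i * eval (c s) (pderiv i q)) s := by
  classical
  induction q using MvPolynomial.induction_on with
  | C a => simpa using hasDerivAt_const s a
  | add p q hp hq =>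
    simp only [map_add, mul_add, Finset.sum_add_distrib]
    exact hp.add hq
  | mul_X p j hp =>
    have hleibniz : ∑ i, c' s i * eval (c s) (pderiv i (p * X j)) =
        (∑ i, c' s i * eval (c s) (pderiv i p)) * c s j + eval (c s) p * c' s j := by
      simp only [Derivation.leibniz, pderiv_X, Pi.single_apply, smul_eq_mul, map_add, map_mul,
        eval_X, mul_add, Finset.sum_add_distrib, Finset.sum_mul, apply_ite (eval (c s)),
        map_zero, mul_ite, mul_one, mul_zero, Finset.sum_ite_eq, Finset.mem_univ, if_true]
      rw [add_comm, mul_comm (c' s j)]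
      exact congrArg (· + _) (Finset.sum_congr rfl fun i _ => by ring)
    simp only [hleibniz, map_mul, eval_X]
    exact hp.mul (hc j)

/-- `r` is a real trigonometric polynomial of degree at most `d`, encoded through the algebraic
polynomial that agrees with `z ^ d * r` on the unit circle `z = exp (i φ)`. -/
def IsTrigPolynomial (d : ℕ) (r : ℝ → ℝ) : Prop :=
  ∃ Q : Polynomial ℂ, Q.natDegree ≤ 2 * d ∧ ∀ φ : ℝ,
    Q.eval (Complex.exp (φ * Complex.I)) = Complex.exp (φ * Complex.I) ^ d * (r φ : ℝ)

namespace IsTrigPolynomial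

theorem const (a : ℝ) : IsTrigPolynomial 0 fun _ => a :=
  ⟨Polynomial.C (a : ℂ), by simp, fun φ => by simp⟩

theorem mono {d e : ℕ} {r : ℝ → ℝ} (h : IsTrigPolynomial d r) (hde : d ≤ e) :
    IsTrigPolynomial e r := by
  obtain ⟨Q, hdeg, hQ⟩ := h
  refine ⟨Polynomial.X ^ (e - d) * Q, Polynomial.natDegree_mul_le.trans ?_, fun φ => ?_⟩
  · rw [Polynomial.natDegree_X_pow]; omega
  · rw [Polynomial.eval_mul, Polynomial.eval_pow, Polynomial.eval_X, hQ, ← mul_assoc, ← pow_add,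
      Nat.sub_add_cancel hde]

theorem mul {d e : ℕ} {r t : ℝ → ℝ} (hr : IsTrigPolynomial d r) (ht : IsTrigPolynomial e t) :
    IsTrigPolynomial (d + e) fun φ => r φ * t φ := by
  obtain ⟨Q, hQdeg, hQ⟩ := hr
  obtain ⟨R, hRdeg, hR⟩ := ht
  refine ⟨Q * R, Polynomial.natDegree_mul_le.trans (by omega), fun φ => ?_⟩
  rw [Polynomial.eval_mul, hQ, hR]
  push_cast
  ring

theorem pow {d : ℕ} {r : ℝ → ℝ} (h : IsTrigPolynomial d r) (n : ℕ) :
    IsTrigPolynomial (n * d) fun φ => r φ ^ n := by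
  induction n with
  | zero => simpa using const 1
  | succ n ih => simpa only [pow_succ, add_mul, one_mul] using ih.mul h

theorem prod {ι : Type*} (s : Finset ι) {d : ι → ℕ} {r : ι → ℝ → ℝ}
    (h : ∀ i ∈ s, IsTrigPolynomial (d i) (r i)) :
    IsTrigPolynomial (∑ i ∈ s, d i) fun φ => ∏ i ∈ s, r i φ := by
  classical
  induction s using Finset.induction_on with
  | empty => simpa using const 1
  | insert i s hi ih =>
    simp only [Finset.sum_insert hi, Finset.prod_insert hi]
    exact (h i (Finset.mem_insert_self i s)).mul
      (ih fun j hj => h j (Finset.mem_insert_of_mem hj))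

theorem sum {ι : Type*} (s : Finset ι) {d : ℕ} {r : ι → ℝ → ℝ}
    (h : ∀ i ∈ s, IsTrigPolynomial d (r i)) : IsTrigPolynomial d fun φ => ∑ i ∈ s, r i φ := by
  choose! Q hdeg hQ using h
  refine ⟨∑ i ∈ s, Q i, Polynomial.natDegree_sum_le_of_forall_le _ _ hdeg, fun φ => ?_⟩
  rw [Polynomial.eval_finsetSum, Complex.ofReal_sum, Finset.mul_sum]
  exact Finset.sum_congr rfl fun i hi => hQ i hi φ

theorem cos_mul_add_sin_mul (a b : ℝ) :
    IsTrigPolynomial 1 fun φ => Real.cos φ * a + Real.sin φ * b := by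
  refine ⟨Polynomial.C (((a : ℂ) - Complex.I * b) / 2) * Polynomial.X ^ 2
    + Polynomial.C (((a : ℂ) + Complex.I * b) / 2), by compute_degree, fun φ => ?_⟩
  simp only [Polynomial.eval_add, Polynomial.eval_mul, Polynomial.eval_C, Polynomial.eval_pow,
    Polynomial.eval_X, Complex.exp_mul_I]
  push_cast
  linear_combination (-(a : ℂ) / 2 - Complex.I * b / 2) * Complex.cos_sq_add_sin_sq (φ : ℂ) +
    (a / 2 * Complex.sin φ ^ 2 - b * Complex.cos φ * Complex.sin φ
      - Complex.I * b / 2 * Complex.sin φ ^ 2) * Complex.I_sq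

theorem eval_circle {σ : Type*} {d : ℕ} {q : MvPolynomial σ ℝ} (hq : q.totalDegree ≤ d)
    (a b : σ → ℝ) :
    IsTrigPolynomial d fun φ => eval (fun i => Real.cos φ * a i + Real.sin φ * b i) q := by
  simp only [eval_eq]
  refine sum _ fun α hα => ?_
  have hprod : IsTrigPolynomial (∑ i ∈ α.support, α i * 1) fun φ =>
      ∏ i ∈ α.support, (Real.cos φ * a i + Real.sin φ * b i) ^ α i :=
    prod _ fun i _ => (cos_mul_add_sin_mul (a i) (b i)).pow (α i)
  refine ((const (q.coeff α)).mul hprod).mono ?_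
  simp only [zero_add, mul_one]
  exact (le_totalDegree hα).trans hq

end IsTrigPolynomial

theorem abs_sub_le_two_mul_abs_sin_sub {x y : ℝ} (hx : x ∈ Set.Icc (0 : ℝ) 1)
    (hy : y ∈ Set.Icc (0 : ℝ) 1) : |x - y| ≤ 2 * |Real.sin x - Real.sin y| := by
  wlog hxy : x ≤ y generalizing x y
  · rw [abs_sub_comm x, abs_sub_comm (Real.sin x)]
    exact this hy hx (le_of_not_ge hxy)
  have hderiv : ∀ x, HasDerivAt (fun x => Real.sin x - x / 2) (Real.cos x - 1 / 2) x := fun x =>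
    (Real.hasDerivAt_sin x).sub ((hasDerivAt_id x).div_const 2)
  have hmono : MonotoneOn (fun x => Real.sin x - x / 2) (Set.Icc 0 1) := by
    refine monotoneOn_of_deriv_nonneg (convex_Icc 0 1)
      (fun x _ => (hderiv x).continuousAt.continuousWithinAt)
      (fun x _ => (hderiv x).differentiableAt.differentiableWithinAt) fun x hx => ?_
    rw [interior_Icc] at hx
    rw [(hderiv x).deriv]
    nlinarith [hx.1, hx.2, Real.one_sub_sq_div_two_le_cos (x := x)]
  have hle : Real.sin x - x / 2 ≤ Real.sin y - y / 2 := hmono hx hy hxy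
  rw [abs_sub_comm x, abs_sub_comm (Real.sin x), abs_of_nonneg (sub_nonneg.2 hxy)]
  linarith [le_abs_self (Real.sin y - Real.sin x)]

theorem volume_exp_near_le (w : ℂ) (δ : ℝ) :
    volume {φ : ℝ | φ ∈ Set.Icc (0 : ℝ) 1 ∧ ‖Complex.exp (φ * Complex.I) - w‖ < δ}
      ≤ ENNReal.ofReal (4 * δ) := by
  refine (Real.volume_le_diam _).trans (Metric.ediam_le fun x hx y hy => ?_)
  rw [edist_dist, Real.dist_eq]
  refine ENNReal.ofReal_le_ofReal ((abs_sub_le_two_mul_abs_sin_sub hx.1 hy.1).trans ?_)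
  have him : |Real.sin x - Real.sin y|
      ≤ ‖Complex.exp (x * Complex.I) - Complex.exp (y * Complex.I)‖ := by
    have := Complex.abs_im_le_norm (Complex.exp (x * Complex.I) - Complex.exp (y * Complex.I))
    simpa [Complex.exp_ofReal_mul_I_im] using this
  have htriangle : ‖Complex.exp (x * Complex.I) - Complex.exp (y * Complex.I)‖ ≤
      ‖Complex.exp (x * Complex.I) - w‖ + ‖Complex.exp (y * Complex.I) - w‖ := by
    simpa only [dist_eq_norm] using dist_triangle_right _ _ w
  linarith [hx.2, hy.2]

theorem norm_eval_derivative_le_of_far {Q : Polynomial ℂ} {z : ℂ} {δ : ℝ} (hδ : 0 < δ)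
    (hfar : ∀ w ∈ Q.roots, δ ≤ ‖z - w‖) :
    ‖Q.derivative.eval z‖ ≤ Q.natDegree / δ * ‖Q.eval z‖ := by
  rcases eq_or_ne Q 0 with rfl | hQ
  · simp
  have hev : Q.eval z ≠ 0 := fun h => by
    simpa using hδ.trans_le (hfar z ((Polynomial.mem_roots hQ).2 h))
  have hsum : ‖(Q.roots.map fun w => 1 / (z - w)).sum‖ ≤ Q.natDegree / δ := by
    calc ‖(Q.roots.map fun w => 1 / (z - w)).sum‖
        ≤ (Q.roots.map fun w => ‖1 / (z - w)‖).sum := by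
          simpa using norm_multiset_sum_le (Q.roots.map fun w => 1 / (z - w))
      _ ≤ (Q.roots.map fun w => ‖1 / (z - w)‖).card • (1 / δ) := by
          refine Multiset.sum_le_card_nsmul _ _ fun x hx => ?_
          obtain ⟨w, hw, rfl⟩ := Multiset.mem_map.1 hx
          rw [norm_div, norm_one]
          exact one_div_le_one_div_of_le hδ (hfar w hw)
      _ ≤ Q.natDegree / δ := by
          rw [Multiset.card_map, nsmul_eq_mul, mul_one_div]
          gcongr
          exact Polynomial.card_roots' Q
  rw [(IsAlgClosed.splits Q).eval_derivative_eq_eval_mul_sum hev, norm_mul, mul_comm]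
  exact mul_le_mul_of_nonneg_right hsum (norm_nonneg _)

theorem hasDerivAt_exp_ofReal_mul_I (φ : ℝ) :
    HasDerivAt (fun s : ℝ => Complex.exp (s * Complex.I))
      (Complex.exp (φ * Complex.I) * Complex.I) φ := by
  have hlin : HasDerivAt (fun s : ℝ => (s : ℂ) * Complex.I) Complex.I φ := by
    simpa using (Complex.ofRealCLM.hasDerivAt (x := φ)).mul_const Complex.I
  exact hlin.cexp

theorem norm_derivative_eval_exp_eq {d : ℕ} {Q : Polynomial ℂ} {r : ℝ → ℝ} {r' φ : ℝ}
    (hr : HasDerivAt r r' φ) (hQ : ∀ φ : ℝ,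
      Q.eval (Complex.exp (φ * Complex.I)) = Complex.exp (φ * Complex.I) ^ d * (r φ : ℝ)) :
    ‖Q.derivative.eval (Complex.exp (φ * Complex.I))‖ = ‖d * Complex.I * r φ + r'‖ := by
  set z := Complex.exp (φ * Complex.I)
  have hz_norm : ‖z‖ = 1 := Complex.norm_exp_ofReal_mul_I φ
  have hleft : HasDerivAt (fun s : ℝ => Q.eval (Complex.exp (s * Complex.I)))
      (Q.derivative.eval z * (z * Complex.I)) φ :=
    HasDerivAt.comp (h₂ := fun w => Q.eval w) φ (Q.hasDerivAt z) (hasDerivAt_exp_ofReal_mul_I φ)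
  have hright : HasDerivAt (fun s : ℝ => Complex.exp (s * Complex.I) ^ d * (r s : ℂ))
      (d * z ^ (d - 1) * (z * Complex.I) * r φ + z ^ d * r') φ :=
    ((hasDerivAt_exp_ofReal_mul_I φ).pow d).mul hr.ofReal_comp
  rw [funext hQ] at hleft
  have heq : Q.derivative.eval z * (z * Complex.I) = z ^ d * (d * Complex.I * r φ + r') := by
    rw [hleft.unique hright]
    rcases d with _ | d
    · simp
    · rw [Nat.add_sub_cancel]; ring
  simpa [hz_norm] using congrArg norm heq

theorem abs_deriv_le_of_far {d : ℕ} {Q : Polynomial ℂ} (hdeg : Q.natDegree ≤ 2 * d)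
    {r : ℝ → ℝ} {r' φ : ℝ} (hr : HasDerivAt r r' φ) (hQ : ∀ φ : ℝ,
      Q.eval (Complex.exp (φ * Complex.I)) = Complex.exp (φ * Complex.I) ^ d * (r φ : ℝ))
    {δ : ℝ} (hδ : 0 < δ) (hfar : ∀ w ∈ Q.roots, δ ≤ ‖Complex.exp (φ * Complex.I) - w‖) :
    |r'| ≤ (2 * d / δ + d) * |r φ| := by
  have hdeg' : (Q.natDegree : ℝ) ≤ 2 * d := by exact_mod_cast hdeg
  have hder := norm_eval_derivative_le_of_far hδ hfar
  rw [norm_derivative_eval_exp_eq hr hQ, hQ φ, norm_mul, norm_pow,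
    Complex.norm_exp_ofReal_mul_I, one_pow, one_mul, Complex.norm_real, Real.norm_eq_abs] at hder
  have htriangle := norm_sub_le (d * Complex.I * r φ + r') (d * Complex.I * r φ)
  rw [add_sub_cancel_left, Complex.norm_real, norm_mul, norm_mul, Complex.norm_I, Complex.norm_real,
    Complex.norm_natCast, mul_one, Real.norm_eq_abs, Real.norm_eq_abs] at htriangle
  have hle : Q.natDegree / δ * |r φ| ≤ 2 * d / δ * |r φ| := by gcongr
  linarith

theorem IsTrigPolynomial.volume_abs_lt_mul_abs_deriv_le {d : ℕ} (hd : 0 < d) {r r' : ℝ → ℝ}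
    (h : IsTrigPolynomial d r) (hr : ∀ φ, HasDerivAt r (r' φ) φ) {ε : ℝ} (hε : 0 < ε) :
    volume {φ : ℝ | φ ∈ Set.Icc (0 : ℝ) 1 ∧ |r φ| < ε * |r' φ|}
      ≤ ENNReal.ofReal (24 * d ^ 2 * ε) := by
  obtain ⟨Q, hdeg, hQ⟩ := h
  have hd' : (1 : ℝ) ≤ d := by exact_mod_cast hd
  set δ : ℝ := 3 * d * ε with hδ
  have hδ_pos : 0 < δ := by positivity
  rcases lt_or_ge 1 δ with hδ_large | hδ_le
  · calc volume {φ : ℝ | φ ∈ Set.Icc (0 : ℝ) 1 ∧ |r φ| < ε * |r' φ|}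
        ≤ volume (Set.Icc (0 : ℝ) 1) := measure_mono fun φ h => h.1
      _ ≤ ENNReal.ofReal (24 * d ^ 2 * ε) := by
        rw [Real.volume_Icc]
        refine ENNReal.ofReal_le_ofReal ?_
        nlinarith [mul_le_mul_of_nonneg_right hd' hδ_pos.le]
  have hnear : {φ : ℝ | φ ∈ Set.Icc (0 : ℝ) 1 ∧ |r φ| < ε * |r' φ|} ⊆ ⋃ w ∈ Q.roots.toFinset,
      {φ : ℝ | φ ∈ Set.Icc (0 : ℝ) 1 ∧ ‖Complex.exp (φ * Complex.I) - w‖ < δ} := by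
    rintro φ ⟨hφ, hlt⟩
    by_contra hfar
    simp only [Set.mem_iUnion, Multiset.mem_toFinset, Set.mem_ofPred_eq, not_exists, not_and,
      not_lt] at hfar
    have hderiv := abs_deriv_le_of_far hdeg (hr φ) hQ hδ_pos fun w hw => hfar w hw hφ
    have hε_mul : ε * (2 * d / δ + d) ≤ 1 := by
      rw [show ε * (2 * d / δ + d) = 2 / 3 + δ / 3 by rw [hδ]; field_simp]
      linarith
    nlinarith [abs_nonneg (r φ), mul_le_mul_of_nonneg_left hderiv hε.le]
  have hcard : (Q.roots.toFinset.card : ℝ) ≤ 2 * d := by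
    exact_mod_cast (Multiset.toFinset_card_le _).trans ((Polynomial.card_roots' Q).trans hdeg)
  refine (measure_mono hnear).trans ((measure_biUnion_finset_le _ _).trans ?_)
  refine (Finset.sum_le_sum fun w _ => volume_exp_near_le w δ).trans ?_
  rw [Finset.sum_const, nsmul_eq_mul, ← ENNReal.ofReal_natCast,
    ← ENNReal.ofReal_mul (by positivity)]
  refine ENNReal.ofReal_le_ofReal ?_
  calc (Q.roots.toFinset.card : ℝ) * (4 * δ) ≤ 2 * d * (4 * δ) := by gcongr
    _ = 24 * d ^ 2 * ε := by rw [hδ]; ring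

end TrigPolynomial

section Anticoncentration

open MvPolynomial

instance isGaussian_stdGauss {σ : Type*} [Fintype σ] : IsGaussian (stdGauss σ) := by
  have hmap : IsGaussian ((stdGauss σ).map id) :=
    (iIndepFun.hasGaussianLaw (X := fun j (x : σ → ℝ) => x j)
      (fun j => ⟨by rw [(hasLaw_eval_stdGauss j).map_eq]; infer_instance⟩)
      iIndepFun_eval_stdGauss).isGaussian_map
  rwa [Measure.map_id] at hmap

theorem map_rotation_stdGauss {σ : Type*} [Fintype σ] (θ : ℝ) :
    ((stdGauss σ).prod (stdGauss σ)).map (ContinuousLinearMap.rotation θ) =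
      (stdGauss σ).prod (stdGauss σ) := by
  refine IsGaussian.map_rotation_eq_self ?_ θ
  ext j
  rw [← ContinuousLinearMap.proj_apply (R := ℝ) (φ := fun _ : σ => ℝ) j (∫ x, id x ∂stdGauss σ),
    ← ContinuousLinearMap.integral_comp_comm _ IsGaussian.integrable_id]
  simpa using (hasLaw_eval_stdGauss j).integral_eq

theorem prod_stdGauss_le_of_forall_rotation {σ : Type*} [Fintype σ] {S : Set ((σ → ℝ) × (σ → ℝ))}
    (hS : MeasurableSet S) {c : ENNReal}
    (h : ∀ z, volume {φ | φ ∈ Set.Icc (0 : ℝ) 1 ∧ ContinuousLinearMap.rotation φ z ∈ S} ≤ c) :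
    ((stdGauss σ).prod (stdGauss σ)) S ≤ c := by
  set μ := (stdGauss σ).prod (stdGauss σ) with hμ
  set R : ℝ × ((σ → ℝ) × (σ → ℝ)) → (σ → ℝ) × (σ → ℝ) :=
    fun u => ContinuousLinearMap.rotation u.1 u.2 with hR
  have hR_meas : Measurable R := by
    simp only [hR, ContinuousLinearMap.rotation_apply]
    fun_prop
  have hinvariant : ∀ φ : ℝ, μ (Prod.mk φ ⁻¹' (R ⁻¹' S)) = μ S := fun φ => by
    conv_rhs => rw [hμ, ← map_rotation_stdGauss φ]
    rw [Measure.map_apply (ContinuousLinearMap.measurable _) hS]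
    rfl
  have haverage : ((volume.restrict (Set.Icc (0 : ℝ) 1)).prod μ) (R ⁻¹' S) = μ S := by
    rw [Measure.prod_apply (hR_meas hS)]
    simp [hinvariant]
  have hslice : ∀ z, (volume.restrict (Set.Icc (0 : ℝ) 1)) ((fun φ => (φ, z)) ⁻¹' (R ⁻¹' S)) ≤ c :=
    fun z => by
      rw [Measure.restrict_apply (measurable_prodMk_right (hR_meas hS)), Set.inter_comm]
      exact h z
  rw [← haverage, Measure.prod_apply_symm (hR_meas hS)]
  exact (lintegral_mono hslice).trans (by simp)

@[fun_prop]
theorem measurable_eval_comp {σ α : Type*} [Countable σ] [MeasurableSpace α] (q : MvPolynomial σ ℝ)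
    {f : α → σ → ℝ} (hf : Measurable f) : Measurable fun a => eval (f a) q :=
  (MvPolynomial.continuous_eval q).measurable.comp hf

theorem prod_stdGauss_abs_lt_mul_abs_pderiv_le {σ : Type*} [Fintype σ] {d : ℕ} (hd : 0 < d)
    {q : MvPolynomial σ ℝ} (hq : q.totalDegree ≤ d) {ε : ℝ} (hε : 0 < ε) :
    ((stdGauss σ).prod (stdGauss σ))
      {z | |eval z.1 q| < ε * |∑ i, z.2 i * eval z.1 (pderiv i q)|}
      ≤ ENNReal.ofReal (24 * d ^ 2 * ε) := by
  refine prod_stdGauss_le_of_forall_rotation (measurableSet_lt (by fun_prop) (by fun_prop))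
    fun z => ?_
  have hderiv : ∀ φ, HasDerivAt
      (fun φ => eval (fun i => Real.cos φ * z.1 i + Real.sin φ * z.2 i) q)
      (∑ i, (-Real.sin φ * z.1 i + Real.cos φ * z.2 i) *
        eval (fun i => Real.cos φ * z.1 i + Real.sin φ * z.2 i) (pderiv i q)) φ := fun φ =>
    hasDerivAt_eval_curve q (c := fun φ i => Real.cos φ * z.1 i + Real.sin φ * z.2 i)
      (c' := fun φ i => -Real.sin φ * z.1 i + Real.cos φ * z.2 i) fun i =>
      ((Real.hasDerivAt_cos φ).mul_const _).add ((Real.hasDerivAt_sin φ).mul_const _)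
  exact (IsTrigPolynomial.eval_circle hq z.1 z.2).volume_abs_lt_mul_abs_deriv_le hd hderiv hε

/-- The linear form with coefficients `a`, as a polynomial. -/
noncomputable def linearForm {ι R : Type*} [Fintype ι] [CommSemiring R] (a : ι → R) :
    MvPolynomial ι R :=
  ∑ i, X i * C (a i)

theorem eval_linearForm {ι R : Type*} [Fintype ι] [CommSemiring R] (a x : ι → R) :
    eval x (linearForm a) = ∑ i, x i * a i := by
  simp [linearForm]

theorem totalDegree_linearForm_le {ι R : Type*} [Fintype ι] [CommSemiring R] (a : ι → R) :
    (linearForm a).totalDegree ≤ 1 :=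
  totalDegree_finsetSum_le fun i _ => by
    rw [mul_comm, C_mul_X_eq_monomial]
    exact (totalDegree_monomial_le _ _).trans (by simp)

variable {ι : Type*} [Fintype ι]

theorem gaussE_linearForm_sq (a : ι → ℝ) : gaussE ι (linearForm a ^ 2) = ∑ i, a i ^ 2 := by
  classical
  rw [sq, linearForm, Finset.sum_mul, map_sum]
  refine Finset.sum_congr rfl fun i _ => ?_
  rw [mul_assoc, gaussE_X_mul, pderiv_C_mul, gaussE_C_mul, map_sum]
  simp [pderiv_X, Pi.single_apply, apply_ite, sq]

theorem gaussE_linearForm_pow_four_le (a : ι → ℝ) :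
    gaussE ι (linearForm a ^ 4) ≤ 9 * (∑ i, a i ^ 2) ^ 2 := by
  simpa [gaussE_linearForm_sq] using gaussE_pow_four_le (totalDegree_linearForm_le a)

theorem two_mul_sub_sq_sub_le_indicator {l m ε T : ℝ} (hε : 0 < ε) (hT : 0 < T) :
    2 * (l ^ 2 / (81 * T)) - (l ^ 2 / (81 * T)) ^ 2 - m ^ 2 / (162 * (ε ^ 2 * T))
      ≤ if |m| < 2 * ε * |l| then 1 else 0 := by
  split_ifs with h
  · have hm : 0 ≤ m ^ 2 / (162 * (ε ^ 2 * T)) := by positivity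
    nlinarith [sq_nonneg (l ^ 2 / (81 * T) - 1)]
  · have hsq : (2 * ε) ^ 2 * l ^ 2 ≤ m ^ 2 := by
      rw [← sq_abs l, ← sq_abs m, ← mul_pow]
      exact pow_le_pow_left₀ (by positivity) (not_lt.1 h) 2
    have hle : 2 * (l ^ 2 / (81 * T)) ≤ m ^ 2 / (162 * (ε ^ 2 * T)) := by
      rw [le_div_iff₀ (by positivity)]
      refine le_trans (le_of_eq ?_) hsq
      field_simp
      ring
    nlinarith [sq_nonneg (l ^ 2 / (81 * T))]

theorem stdGauss_real_linear_lt_ge {τ : ι → ℝ} (b : ι → ℝ) {ε T : ℝ} (hε : 0 < ε) (hT : 0 < T)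
    (hτ : ∑ a, τ a ^ 2 ≤ ε ^ 2 * T) :
    2 / (81 * T) * ∑ a, b a ^ 2 - 9 / (6561 * T ^ 2) * (∑ a, b a ^ 2) ^ 2 - 1 / 162 ≤
      (stdGauss ι).real {g | |∑ a, g a * τ a| < 2 * ε * |∑ a, g a * b a|} := by
  set U : Set (ι → ℝ) := {g | |∑ a, g a * τ a| < 2 * ε * |∑ a, g a * b a|}
  have hU_meas : MeasurableSet U := measurableSet_lt (by fun_prop) (by fun_prop)
  set K : MvPolynomial ι ℝ := C (2 / (81 * T)) * linearForm b ^ 2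
    - C (1 / (6561 * T ^ 2)) * linearForm b ^ 4
    - C (1 / (162 * (ε ^ 2 * T))) * linearForm τ ^ 2 with hK
  have hK_ge : 2 / (81 * T) * ∑ a, b a ^ 2 - 9 / (6561 * T ^ 2) * (∑ a, b a ^ 2) ^ 2 - 1 / 162
      ≤ gaussE ι K := by
    rw [hK, map_sub (gaussE ι), map_sub (gaussE ι), gaussE_C_mul, gaussE_C_mul, gaussE_C_mul,
      gaussE_linearForm_sq, gaussE_linearForm_sq]
    have hfour : 1 / (6561 * T ^ 2) * gaussE ι (linearForm b ^ 4)
        ≤ 9 / (6561 * T ^ 2) * (∑ a, b a ^ 2) ^ 2 := by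
      calc 1 / (6561 * T ^ 2) * gaussE ι (linearForm b ^ 4)
          ≤ 1 / (6561 * T ^ 2) * (9 * (∑ a, b a ^ 2) ^ 2) := by
            gcongr
            exact gaussE_linearForm_pow_four_le b
        _ = 9 / (6561 * T ^ 2) * (∑ a, b a ^ 2) ^ 2 := by ring
    have htwo : 1 / (162 * (ε ^ 2 * T)) * ∑ a, τ a ^ 2 ≤ 1 / 162 := by
      calc 1 / (162 * (ε ^ 2 * T)) * ∑ a, τ a ^ 2
          ≤ 1 / (162 * (ε ^ 2 * T)) * (ε ^ 2 * T) := by gcongr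
        _ = 1 / 162 := by field_simp
    linarith
  have hK_le : gaussE ι K ≤ ∫ g, U.indicator 1 g ∂(stdGauss ι) := by
    refine integral_mono (integrable_eval_stdGauss K)
      ((integrable_const (1 : ℝ)).indicator hU_meas) fun g => ?_
    have hpointwise := two_mul_sub_sq_sub_le_indicator (l := ∑ a, g a * b a)
      (m := ∑ a, g a * τ a) hε hT
    rw [Set.indicator_apply, Pi.one_apply]
    refine le_trans (le_of_eq ?_) hpointwise
    simp only [hK, map_sub, map_mul, eval_C, map_pow, eval_linearForm]
    field_simp
    ring
  rw [integral_indicator_one hU_meas] at hK_le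
  exact hK_ge.trans hK_le

theorem ofReal_integral_le_lintegral {α : Type*} [MeasurableSpace α] {μ : Measure α} {f : α → ℝ}
    (hf : Integrable f μ) : ENNReal.ofReal (∫ x, f x ∂μ) ≤ ∫⁻ x, ENNReal.ofReal (f x) ∂μ := by
  calc ENNReal.ofReal (∫ x, f x ∂μ)
      ≤ ENNReal.ofReal (∫ x, max (f x) 0 ∂μ) := ENNReal.ofReal_le_ofReal
        (integral_mono hf hf.pos_part fun x => le_max_left _ _)
    _ = ∫⁻ x, ENNReal.ofReal (max (f x) 0) ∂μ := ofReal_integral_eq_lintegral_ofReal hf.pos_part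
        (Filter.Eventually.of_forall fun x => le_max_right _ _)
    _ = ∫⁻ x, ENNReal.ofReal (f x) ∂μ := by simp [ENNReal.ofReal_max]

variable {σ : Type*} [Fintype σ]

theorem lintegral_stdGauss_bilinear_ge (τ : ι → ℝ) (A : ι → σ → ℝ) {ε : ℝ} (hε : 0 < ε)
    (h : ∑ a, τ a ^ 2 < ε ^ 2 * ∑ a, ∑ i, A a i ^ 2) :
    ENNReal.ofReal (1 / 162) ≤ ∫⁻ y, stdGauss ι
      {g | |∑ a, g a * τ a| < 2 * ε * |∑ a, g a * ∑ i, y i * A a i|} ∂(stdGauss σ) := by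
  set T := ∑ a, ∑ i, A a i ^ 2 with hT
  have hT_pos : 0 < T :=
    pos_of_mul_pos_right ((Finset.sum_nonneg fun a _ => sq_nonneg (τ a)).trans_lt h) (sq_nonneg ε)
  set S : MvPolynomial σ ℝ := ∑ a, linearForm (A a) ^ 2 with hS
  have hES : gaussE σ S = T := by simp only [hS, map_sum, gaussE_linearForm_sq, hT]
  have hES_sq : gaussE σ (S ^ 2) ≤ 9 * T ^ 2 := by
    simpa [← hS, hES] using gaussE_sum_sq_sq_le Finset.univ fun a _ =>
      totalDegree_linearForm_le (A a)
  set H : MvPolynomial σ ℝ :=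
    C (2 / (81 * T)) * S - C (9 / (6561 * T ^ 2)) * S ^ 2 - C (1 / 162) with hH
  have hEH : 1 / 162 ≤ gaussE σ H := by
    rw [hH, map_sub, map_sub, gaussE_C_mul, gaussE_C_mul, gaussE_C, hES]
    have hsecond : 9 / (6561 * T ^ 2) * gaussE σ (S ^ 2) ≤ 1 / 81 := by
      calc 9 / (6561 * T ^ 2) * gaussE σ (S ^ 2)
          ≤ 9 / (6561 * T ^ 2) * (9 * T ^ 2) := by gcongr
        _ = 1 / 81 := by field_simp; norm_num
    have hfirst : 2 / (81 * T) * T = 2 / 81 := by field_simp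
    linarith
  calc ENNReal.ofReal (1 / 162)
      ≤ ENNReal.ofReal (gaussE σ H) := ENNReal.ofReal_le_ofReal hEH
    _ ≤ ∫⁻ y, ENNReal.ofReal (eval y H) ∂(stdGauss σ) :=
        ofReal_integral_le_lintegral (integrable_eval_stdGauss H)
    _ ≤ _ := lintegral_mono fun y => ?_
  rw [← ofReal_measureReal]
  refine ENNReal.ofReal_le_ofReal ((le_of_eq ?_).trans
    (stdGauss_real_linear_lt_ge (fun a => ∑ i, y i * A a i) hε hT_pos h.le))
  simp only [hH, hS, map_sub, map_mul, map_pow, map_sum, eval_C, eval_linearForm]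

variable {d : ℕ} {t : ι → MvPolynomial σ ℝ}

theorem prod_stdGauss_linearComb_small_le (hd : 0 < d) (ht : ∀ a, (t a).totalDegree ≤ d)
    (g : ι → ℝ) {ε : ℝ} (hε : 0 < ε) :
    ((stdGauss σ).prod (stdGauss σ)) {z | |∑ a, g a * eval z.1 (t a)| <
      ε * |∑ a, g a * ∑ i, z.2 i * eval z.1 (pderiv i (t a))|} ≤
        ENNReal.ofReal (24 * d ^ 2 * ε) := by
  have hdeg : (∑ a, C (g a) * t a).totalDegree ≤ d := totalDegree_finsetSum_le fun a _ => by
    rw [C_mul']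
    exact (totalDegree_smul_le _ _).trans (ht a)
  have hpderiv : ∀ z : (σ → ℝ) × (σ → ℝ),
      ∑ i, z.2 i * eval z.1 (pderiv i (∑ a, C (g a) * t a)) =
        ∑ a, g a * ∑ i, z.2 i * eval z.1 (pderiv i (t a)) := fun z => by
    simp only [map_sum, pderiv_C_mul, map_mul, eval_C, Finset.mul_sum]
    rw [Finset.sum_comm]
    exact Finset.sum_congr rfl fun a _ => Finset.sum_congr rfl fun i _ => mul_left_comm _ _ _
  have heval : ∀ z : (σ → ℝ) × (σ → ℝ),
      eval z.1 (∑ a, C (g a) * t a) = ∑ a, g a * eval z.1 (t a) := fun z => by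
    simp only [map_sum, map_mul, eval_C]
  refine (measure_mono fun z hz => ?_).trans (prod_stdGauss_abs_lt_mul_abs_pderiv_le hd hdeg hε)
  rw [Set.mem_ofPred_eq, hpderiv, heval]
  exact hz

theorem stdGauss_sum_sq_lt_mul_sum_pderiv_sq_le (hd : 0 < d) (ht : ∀ a, (t a).totalDegree ≤ d)
    {ε : ℝ} (hε : 0 < ε) :
    stdGauss σ {x | ∑ a, eval x (t a) ^ 2 < ε ^ 2 * ∑ a, ∑ i, eval x (pderiv i (t a)) ^ 2}
      ≤ ENNReal.ofReal (7776 * d ^ 2 * ε) := by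
  set B : Set (σ → ℝ) :=
    {x | ∑ a, eval x (t a) ^ 2 < ε ^ 2 * ∑ a, ∑ i, eval x (pderiv i (t a)) ^ 2}
  set S : Set ((ι → ℝ) × ((σ → ℝ) × (σ → ℝ))) := {u | |∑ a, u.1 a * eval u.2.1 (t a)| <
    2 * ε * |∑ a, u.1 a * ∑ i, u.2.2 i * eval u.2.1 (pderiv i (t a))|}
  have hB_meas : MeasurableSet B := measurableSet_lt (by fun_prop) (by fun_prop)
  have hS_meas : MeasurableSet S := measurableSet_lt (by fun_prop) (by fun_prop)
  have hupper : ((stdGauss ι).prod ((stdGauss σ).prod (stdGauss σ))) S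
      ≤ ENNReal.ofReal (24 * d ^ 2 * (2 * ε)) := by
    rw [Measure.prod_apply hS_meas]
    exact (lintegral_mono fun g => prod_stdGauss_linearComb_small_le hd ht g
      (by positivity : 0 < 2 * ε)).trans (by simp)
  have hlower : ENNReal.ofReal (1 / 162) * stdGauss σ B
      ≤ ((stdGauss ι).prod ((stdGauss σ).prod (stdGauss σ))) S := by
    rw [Measure.prod_apply_symm hS_meas,
      lintegral_prod _ (measurable_measure_prodMk_right hS_meas).aemeasurable,
      ← lintegral_indicator_const hB_meas]
    refine lintegral_mono fun x => ?_
    by_cases hx : x ∈ B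
    · rw [Set.indicator_of_mem hx]
      exact lintegral_stdGauss_bilinear_ge (fun a => eval x (t a))
        (fun a i => eval x (pderiv i (t a))) hε hx
    · rw [Set.indicator_of_notMem hx]
      exact zero_le
  have h162 : ENNReal.ofReal 162 * ENNReal.ofReal (1 / 162) = 1 := by
    rw [← ENNReal.ofReal_mul (by norm_num)]; norm_num
  calc stdGauss σ B = ENNReal.ofReal 162 * (ENNReal.ofReal (1 / 162) * stdGauss σ B) := by
        rw [← mul_assoc, h162, one_mul]
    _ ≤ ENNReal.ofReal 162 * ENNReal.ofReal (24 * d ^ 2 * (2 * ε)) := by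
        gcongr
        exact hlower.trans hupper
    _ = ENNReal.ofReal (7776 * d ^ 2 * ε) := by
        rw [← ENNReal.ofReal_mul (by norm_num)]; congr 1; ring

end Anticoncentration

section DerivativeMoments

open MvPolynomial

/-- The squared norm of the `k`-th derivative tensor of a polynomial. -/
noncomputable def gradSq {σ : Type*} [Fintype σ] : ℕ → MvPolynomial σ ℝ → MvPolynomial σ ℝ
  | 0, q => q ^ 2
  | k + 1, q => ∑ i, gradSq k (pderiv i q)

theorem stdGauss_sum_gradSq_lt_le.{u} {σ : Type u} [Fintype σ] {d : ℕ} (hd : 0 < d) {ε : ℝ}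
    (hε : 0 < ε) (k : ℕ) {ι : Type u} [Fintype ι] {t : ι → MvPolynomial σ ℝ}
    (ht : ∀ a, (t a).totalDegree ≤ d) :
    stdGauss σ {x | ∑ a, eval x (gradSq k (t a)) < ε ^ 2 * ∑ a, eval x (gradSq (k + 1) (t a))}
      ≤ ENNReal.ofReal (7776 * d ^ 2 * ε) := by
  induction k generalizing ι t with
  | zero =>
    simpa only [gradSq, map_pow, map_sum] using stdGauss_sum_sq_lt_mul_sum_pderiv_sq_le hd ht hε
  | succ k ih =>
    have hderiv := ih (ι := ι × σ) (t := fun u => pderiv u.2 (t u.1)) fun u =>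
      totalDegree_pderiv_le_of_le (ht u.1) u.2
    simp only [Fintype.sum_prod_type] at hderiv
    have hsucc : ∀ x k, ∑ a, eval x (gradSq (k + 1) (t a))
        = ∑ a, ∑ i, eval x (gradSq k (pderiv i (t a))) := fun x k => by simp only [gradSq, map_sum]
    simpa only [hsucc] using hderiv

section Degrees

variable {τ R : Type*} [CommSemiring R] {e : ℕ} {p q : MvPolynomial τ R}

theorem totalDegree_C_mul_le (hq : q.totalDegree ≤ e) (a : R) : (C a * q).totalDegree ≤ e := by
  rw [C_mul']
  exact (totalDegree_smul_le _ _).trans hq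

theorem totalDegree_add_le_of_le (hp : p.totalDegree ≤ e) (hq : q.totalDegree ≤ e) :
    (p + q).totalDegree ≤ e :=
  (totalDegree_add _ _).trans (max_le hp hq)

theorem totalDegree_pow_le_of_le {m k : ℕ} (hp : p.totalDegree ≤ e) (h : m * e ≤ k) :
    (p ^ m).totalDegree ≤ k :=
  (totalDegree_pow _ _).trans ((Nat.mul_le_mul_left _ hp).trans h)

end Degrees

theorem totalDegree_sub_C_le {σ R : Type*} [CommRing R] {d : ℕ} {q : MvPolynomial σ R}
    (hq : q.totalDegree ≤ d) (a : R) : (q - C a).totalDegree ≤ d :=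
  (totalDegree_sub _ _).trans (max_le hq (by simp))

variable {σ : Type*} [Fintype σ] {d : ℕ} {q : MvPolynomial σ ℝ}

theorem stdGauss_gradSq_lt_le (hd : 0 < d) {ε : ℝ} (hε : 0 < ε) (k : ℕ) (hq : q.totalDegree ≤ d) :
    stdGauss σ {x | eval x (gradSq k q) < ε ^ 2 * eval x (gradSq (k + 1) q)}
      ≤ ENNReal.ofReal (7776 * d ^ 2 * ε) := by
  simpa using stdGauss_sum_gradSq_lt_le hd hε k (ι := PUnit) (t := fun _ => q) fun _ => hq

/-- The squared distance of the `k`-th derivative tensor of a polynomial to its Gaussian mean. -/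
noncomputable def devSq : ℕ → MvPolynomial σ ℝ → MvPolynomial σ ℝ
  | 0, q => (q - C (gaussE σ q)) ^ 2
  | k + 1, q => ∑ i, devSq k (pderiv i q)

theorem eval_gradSq_nonneg (k : ℕ) (q : MvPolynomial σ ℝ) (x : σ → ℝ) :
    0 ≤ eval x (gradSq k q) := by
  induction k generalizing q with
  | zero => simp only [gradSq, map_pow]; positivity
  | succ k ih => rw [gradSq, map_sum]; exact Finset.sum_nonneg fun i _ => ih _

theorem eval_devSq_nonneg (k : ℕ) (q : MvPolynomial σ ℝ) (x : σ → ℝ) :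
    0 ≤ eval x (devSq k q) := by
  induction k generalizing q with
  | zero => simp only [devSq, map_pow]; positivity
  | succ k ih => rw [devSq, map_sum]; exact Finset.sum_nonneg fun i _ => ih _

theorem totalDegree_gradSq_le (k : ℕ) (hq : q.totalDegree ≤ d) :
    (gradSq k q).totalDegree ≤ 2 * d := by
  induction k generalizing q with
  | zero => exact totalDegree_pow_le_of_le hq le_rfl
  | succ k ih => exact totalDegree_finsetSum_le fun i _ => ih (totalDegree_pderiv_le_of_le hq i)

theorem totalDegree_devSq_le (k : ℕ) (hq : q.totalDegree ≤ d) :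
    (devSq k q).totalDegree ≤ 2 * d := by
  induction k generalizing q with
  | zero =>
    have hsub := totalDegree_sub_C_le hq (gaussE σ q)
    exact totalDegree_pow_le_of_le hsub le_rfl
  | succ k ih => exact totalDegree_finsetSum_le fun i _ => ih (totalDegree_pderiv_le_of_le hq i)

theorem meanDerivSq_eq_zero {k : ℕ} (hq : q.totalDegree ≤ d) (hk : d < k) :
    meanDerivSq k q = 0 := by
  obtain ⟨f, hf⟩ := exists_chaosDecomp hq
  rw [hf.meanDerivSq_eq, hf.eq_zero k hk]
  simp

theorem gaussE_gradSq (k : ℕ) (hq : q.totalDegree ≤ d) :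
    gaussE σ (gradSq k q) = ∑ j ∈ Finset.range (d + 1), meanDerivSq (k + j) q / j.factorial := by
  induction k generalizing q with
  | zero => simpa [gradSq] using gaussE_sq_eq_sum_meanDerivSq hq
  | succ k ih =>
    rw [gradSq, map_sum, Finset.sum_congr rfl fun i _ => ih (totalDegree_pderiv_le_of_le hq i),
      Finset.sum_comm]
    refine Finset.sum_congr rfl fun j _ => ?_
    rw [← Finset.sum_div, Nat.add_right_comm]
    rfl

theorem gaussE_devSq (k : ℕ) (q : MvPolynomial σ ℝ) :
    gaussE σ (devSq k q) = gaussE σ (gradSq k q) - meanDerivSq k q := by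
  induction k generalizing q with
  | zero =>
    have hexpand : (q - C (gaussE σ q)) ^ 2 =
        q ^ 2 - C (2 * gaussE σ q) * q + C (gaussE σ q ^ 2) := by
      simp only [map_mul, map_pow, map_ofNat]
      ring
    rw [devSq, gradSq, meanDerivSq, hexpand, map_add, map_sub, gaussE_C_mul, gaussE_C]
    ring
  | succ k ih =>
    rw [devSq, gradSq, meanDerivSq, map_sum, map_sum, ← Finset.sum_sub_distrib]
    exact Finset.sum_congr rfl fun i _ => ih _

theorem gaussE_devSq_nonneg (k : ℕ) (q : MvPolynomial σ ℝ) : 0 ≤ gaussE σ (devSq k q) :=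
  gaussE_nonneg (eval_devSq_nonneg k q)

theorem gaussE_devSq_le {k : ℕ} (hq : q.totalDegree ≤ d) {b : ℝ}
    (hb : ∀ j, k < j → meanDerivSq j q ≤ b) : gaussE σ (devSq k q) ≤ d * b := by
  rw [gaussE_devSq, gaussE_gradSq k hq, Finset.sum_range_succ']
  simp only [add_zero, Nat.factorial_zero, Nat.cast_one, div_one, add_sub_cancel_right]
  refine (Finset.sum_le_card_nsmul _ _ b fun j _ => ?_).trans (by simp)
  refine (div_le_self (meanDerivSq_nonneg _ _) ?_).trans (hb _ (by lia))
  exact_mod_cast Nat.one_le_iff_ne_zero.2 (Nat.factorial_ne_zero _)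

theorem sq_gradSq_sub_le (k : ℕ) (q : MvPolynomial σ ℝ) (x : σ → ℝ) :
    (eval x (gradSq k q) - meanDerivSq k q - eval x (devSq k q)) ^ 2
      ≤ (4 * meanDerivSq k q) * eval x (devSq k q) := by
  induction k generalizing q with
  | zero =>
    simp only [gradSq, devSq, meanDerivSq, map_pow, map_sub, eval_C]
    exact le_of_eq (by ring)
  | succ k ih =>
    simp only [gradSq, devSq, meanDerivSq, map_sum]
    rw [Finset.mul_sum _ _ (4 : ℝ), ← Finset.sum_sub_distrib, ← Finset.sum_sub_distrib]
    exact Finset.sum_sq_le_sum_mul_sum_of_sq_le_mul _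
      (fun i _ => mul_nonneg zero_le_four (meanDerivSq_nonneg k _))
      (fun i _ => eval_devSq_nonneg k _ x) fun i _ => ih _

theorem eval_gradSq_le (k : ℕ) (q : MvPolynomial σ ℝ) (x : σ → ℝ) :
    eval x (gradSq k q) ≤ 2 * meanDerivSq k q + 2 * eval x (devSq k q) := by
  have hmean := meanDerivSq_nonneg k q
  have hdev := eval_devSq_nonneg k q x
  have hsq : (eval x (gradSq k q) - meanDerivSq k q - eval x (devSq k q)) ^ 2 ≤
      (meanDerivSq k q + eval x (devSq k q)) ^ 2 :=
    (sq_gradSq_sub_le k q x).trans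
      (by nlinarith [sq_nonneg (meanDerivSq k q - eval x (devSq k q))])
  linarith [(abs_le_of_sq_le_sq' hsq (by positivity)).2]

theorem sq_gradSq_sub_mean_le (k : ℕ) (q : MvPolynomial σ ℝ) (x : σ → ℝ) :
    (eval x (gradSq k q) - meanDerivSq k q) ^ 2
      ≤ 8 * meanDerivSq k q * eval x (devSq k q) + 2 * eval x (devSq k q) ^ 2 := by
  nlinarith [sq_gradSq_sub_le k q x,
    sq_nonneg (eval x (gradSq k q) - meanDerivSq k q - 2 * eval x (devSq k q))]

theorem gaussE_devSq_sq_le (k : ℕ) (hq : q.totalDegree ≤ d) :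
    gaussE σ (devSq k q ^ 2) ≤ (3 ^ d * gaussE σ (devSq k q)) ^ 2 := by
  induction k generalizing q with
  | zero =>
    have hfour := gaussE_pow_four_le (totalDegree_sub_C_le hq (gaussE σ q))
    rwa [devSq, ← pow_mul, ← nine_pow_mul_sq]
  | succ k ih =>
    rw [devSq, sq, Finset.sum_mul_sum, map_sum, map_sum, Finset.mul_sum, sq, Finset.sum_mul_sum]
    refine Finset.sum_le_sum fun i _ => ?_
    rw [map_sum]
    refine Finset.sum_le_sum fun j _ => ?_
    have hi := ih (totalDegree_pderiv_le_of_le hq i)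
    have hj := ih (totalDegree_pderiv_le_of_le hq j)
    have hi_nonneg := gaussE_devSq_nonneg k (pderiv i q)
    have hj_nonneg := gaussE_devSq_nonneg k (pderiv j q)
    refine (abs_le_of_sq_le_sq' ((gaussE_mul_sq_le _ _).trans ?_) (by positivity)).2
    rw [mul_pow]
    exact mul_le_mul hi hj (gaussE_pow_nonneg even_two _) (by positivity)

theorem gaussE_devSq_pow_four_le (k : ℕ) (hq : q.totalDegree ≤ d) :
    gaussE σ (devSq k q ^ 4) ≤ 9 ^ (4 * d) * gaussE σ (devSq k q) ^ 4 := by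
  have hnonneg := gaussE_pow_nonneg even_two (devSq k q)
  calc gaussE σ (devSq k q ^ 4)
      ≤ 9 ^ (2 * d) * gaussE σ (devSq k q ^ 2) ^ 2 := gaussE_pow_four_le (totalDegree_devSq_le k hq)
    _ ≤ 9 ^ (2 * d) * ((3 ^ d * gaussE σ (devSq k q)) ^ 2) ^ 2 := by
      gcongr
      exact gaussE_devSq_sq_le k hq
    _ = 9 ^ (4 * d) * gaussE σ (devSq k q) ^ 4 := by
      rw [← nine_pow_mul_sq]
      ring

/-- The relative fluctuation of the squared norm of the `k`-th derivative; it is `0` if the mean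
of that derivative vanishes. -/
noncomputable def relDev (k : ℕ) (q : MvPolynomial σ ℝ) : MvPolynomial σ ℝ :=
  C (meanDerivSq k q)⁻¹ * (gradSq k q - C (meanDerivSq k q))

theorem totalDegree_relDev_le (k : ℕ) (hq : q.totalDegree ≤ d) :
    (relDev k q).totalDegree ≤ 2 * d := by
  have hsub := totalDegree_sub_C_le (totalDegree_gradSq_le k hq) (meanDerivSq k q)
  exact totalDegree_C_mul_le hsub _

theorem gaussE_relDev_sq_le_devSq {k : ℕ} (hq : q.totalDegree ≤ d) :
    gaussE σ (relDev k q ^ 2) ≤ (meanDerivSq k q)⁻¹ ^ 2 *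
      (8 * meanDerivSq k q * gaussE σ (devSq k q) + 2 * (3 ^ d * gaussE σ (devSq k q)) ^ 2) := by
  set c := meanDerivSq k q with hc
  calc gaussE σ (relDev k q ^ 2)
      ≤ gaussE σ (C (c⁻¹ ^ 2) * (C (8 * c) * devSq k q + C 2 * devSq k q ^ 2)) := by
        refine gaussE_mono fun x => ?_
        simp only [relDev, map_pow, map_mul, map_sub, eval_C, map_add, mul_pow, ← hc]
        exact mul_le_mul_of_nonneg_left (sq_gradSq_sub_mean_le k q x) (by positivity)
    _ = c⁻¹ ^ 2 * (8 * c * gaussE σ (devSq k q) + 2 * gaussE σ (devSq k q ^ 2)) := by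
        rw [gaussE_C_mul, map_add, gaussE_C_mul, gaussE_C_mul]
    _ ≤ _ := by
        gcongr
        exact gaussE_devSq_sq_le k hq

theorem natCast_le_nine_pow (d : ℕ) : (d : ℝ) ≤ 9 ^ d := by
  exact_mod_cast (Nat.lt_pow_self (by norm_num : 1 < 9)).le

theorem gaussE_relDev_sq_le {k : ℕ} (hd : 0 < d) (hq : q.totalDegree ≤ d)
    {θ : ℝ} (hθ : 0 ≤ θ) (hθd : d * θ ≤ 1)
    (hdecay : ∀ j, k < j → meanDerivSq j q ≤ θ * meanDerivSq k q) :
    gaussE σ (relDev k q ^ 2) ≤ 9 ^ (4 * d) * θ := by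
  have hc_nonneg : 0 ≤ meanDerivSq k q := meanDerivSq_nonneg k q
  rcases hc_nonneg.eq_or_lt with hc | hc
  · rw [relDev, ← hc, inv_zero, C_0, zero_mul, zero_pow two_ne_zero, map_zero]
    positivity
  set c := meanDerivSq k q
  have hv_nonneg : 0 ≤ gaussE σ (devSq k q) := gaussE_devSq_nonneg k q
  have hv : gaussE σ (devSq k q) ≤ d * θ * c := by
    rw [mul_assoc]
    exact gaussE_devSq_le hq hdecay
  have hsq : ((3 : ℝ) ^ d) ^ 2 = 9 ^ d := by rw [← pow_mul, mul_comm, pow_mul]; norm_num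
  have hnine : (9 : ℝ) ≤ 9 ^ d := le_self_pow₀ (by norm_num) hd.ne'
  have hcast := natCast_le_nine_pow d
  calc gaussE σ (relDev k q ^ 2)
      ≤ c⁻¹ ^ 2 * (8 * c * gaussE σ (devSq k q) + 2 * (3 ^ d * gaussE σ (devSq k q)) ^ 2) :=
        gaussE_relDev_sq_le_devSq hq
    _ ≤ c⁻¹ ^ 2 * (8 * c * (d * θ * c) + 2 * (3 ^ d * (d * θ * c)) ^ 2) := by gcongr
    _ = 8 * (d * θ) + 2 * 9 ^ d * (d * θ) * (d * θ) := by
      rw [mul_pow (3 ^ d), hsq]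
      field_simp
    _ ≤ 8 * (d * θ) + 2 * 9 ^ d * (d * θ) * 1 := by gcongr
    _ = (8 + 2 * 9 ^ d) * (d * θ) := by ring
    _ ≤ 9 ^ d * 9 ^ d * 9 ^ d * (9 ^ d * θ) := by
      gcongr
      nlinarith [mul_le_mul hnine hnine (by norm_num) (by positivity)]
    _ = 9 ^ (4 * d) * θ := by ring

theorem gaussE_relDev_pow_le {k : ℕ} (hd : 0 < d) (hq : q.totalDegree ≤ d) {θ : ℝ} (hθ : 0 ≤ θ)
    (hθd : d * θ ≤ 1) (hdecay : ∀ j, k < j → meanDerivSq j q ≤ θ * meanDerivSq k q) :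
    gaussE σ (relDev k q ^ 8) ≤ 9 ^ (448 * d) * θ ^ 4 ∧
      gaussE σ (relDev k q ^ 64) ≤ 9 ^ (448 * d) * θ ^ 4 := by
  have hsq := gaussE_relDev_sq_le hd hq hθ hθd hdecay
  have hsq_nonneg := gaussE_pow_nonneg even_two (relDev k q)
  have hθ1 : θ ≤ 1 := (le_mul_of_one_le_left hθ (by exact_mod_cast hd)).trans hθd
  have hdeg := totalDegree_relDev_le k hq
  constructor
  · calc gaussE σ (relDev k q ^ 8) ≤ 9 ^ (2 * d * 8) * gaussE σ (relDev k q ^ 2) ^ 4 :=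
        gaussE_pow_two_pow_le 2 hdeg
      _ ≤ 9 ^ (2 * d * 8) * (9 ^ (4 * d) * θ) ^ 4 := by gcongr
      _ = 9 ^ (32 * d) * θ ^ 4 := by ring
      _ ≤ 9 ^ (448 * d) * θ ^ 4 := by gcongr <;> norm_num
  · calc gaussE σ (relDev k q ^ 64) ≤ 9 ^ (2 * d * 160) * gaussE σ (relDev k q ^ 2) ^ 32 :=
        gaussE_pow_two_pow_le 5 hdeg
      _ ≤ 9 ^ (2 * d * 160) * (9 ^ (4 * d) * θ) ^ 32 := by gcongr
      _ = 9 ^ (448 * d) * θ ^ 32 := by ring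
      _ ≤ 9 ^ (448 * d) * θ ^ 4 :=
        mul_le_mul_of_nonneg_left (pow_le_pow_of_le_one hθ hθ1 (by norm_num)) (by positivity)

end DerivativeMoments

section SmoothCutoff

/-- A smooth cutoff, equal to `1` on `(-∞, 1/4]` and to `0` on `[1/2, ∞)`. -/
noncomputable def smoothCutoff (x : ℝ) : ℝ := Real.smoothTransition (2 - 4 * x)

theorem smoothCutoff_nonneg (x : ℝ) : 0 ≤ smoothCutoff x := Real.smoothTransition.nonneg _

theorem smoothCutoff_le_one (x : ℝ) : smoothCutoff x ≤ 1 := Real.smoothTransition.le_one _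

theorem abs_smoothCutoff_le_one (x : ℝ) : |smoothCutoff x| ≤ 1 := by
  rw [abs_of_nonneg (smoothCutoff_nonneg x)]
  exact smoothCutoff_le_one x

theorem smoothCutoff_eq_one {x : ℝ} (h : x ≤ 1 / 4) : smoothCutoff x = 1 :=
  Real.smoothTransition.one_of_one_le (by linarith)

theorem smoothCutoff_eq_zero {x : ℝ} (h : 1 / 2 ≤ x) : smoothCutoff x = 0 :=
  Real.smoothTransition.zero_of_nonpos (by linarith)

theorem contDiff_smoothCutoff {n : ℕ∞} : ContDiff ℝ n smoothCutoff :=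
  Real.smoothTransition.contDiff.comp (by fun_prop)

theorem exists_bound_iteratedDeriv_smoothCutoff (j : ℕ) :
    ∃ K, ∀ x, |iteratedDeriv j smoothCutoff x| ≤ K := by
  have hcont : Continuous (iteratedDeriv j smoothCutoff) :=
    (contDiff_smoothCutoff (n := j)).continuous_iteratedDeriv j le_rfl
  obtain ⟨K, hK⟩ := (isCompact_Icc (a := (0 : ℝ)) (b := 1)).exists_bound_of_continuousOn
    hcont.continuousOn
  have hconst : ∀ (c x : ℝ), |c| ≤ 1 → smoothCutoff =ᶠ[nhds x] (fun _ => c) →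
      |iteratedDeriv j smoothCutoff x| ≤ 1 := by
    intro c x hc h
    rw [h.iteratedDeriv_eq j, iteratedDeriv_const]
    split_ifs
    · exact hc
    · simp
  refine ⟨max K 1, fun x => ?_⟩
  rcases lt_or_ge x 0 with hx_neg | hx_nonneg
  · refine (hconst 1 x (by simp) ?_).trans (le_max_right _ _)
    filter_upwards [Iio_mem_nhds hx_neg] with y hy
    exact smoothCutoff_eq_one (hy.le.trans (by norm_num))
  rcases lt_or_ge 1 x with hx_gt | hx_le
  · refine (hconst 0 x (by simp) ?_).trans (le_max_right _ _)
    filter_upwards [Ioi_mem_nhds hx_gt] with y hy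
    exact smoothCutoff_eq_zero (le_trans (by norm_num) hy.le)
  · exact (hK x ⟨hx_nonneg, hx_le⟩).trans (le_max_left _ _)

theorem one_le_cast_factorial (n : ℕ) : (1 : ℝ) ≤ n.factorial := by
  exact_mod_cast n.factorial_pos

theorem abs_sub_taylor_le {f : ℝ → ℝ} {n : ℕ} (hf : ContDiff ℝ (n + 1 : ℕ) f) {K : ℝ}
    (hK : ∀ x, |iteratedDeriv (n + 1) f x| ≤ K) (a x : ℝ) :
    |f x - ∑ j ∈ Finset.range (n + 1), iteratedDeriv j f a / j.factorial * (x - a) ^ j|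
      ≤ K * |x - a| ^ (n + 1) := by
  rcases eq_or_ne a x with rfl | hne
  · rw [Finset.sum_range_succ']
    simp
  obtain ⟨y, -, hy⟩ := taylor_mean_remainder_lagrange_iteratedDeriv (n := n) hne
    (hf.contDiffOn (s := Set.uIcc a x))
  rw [taylor_within_apply] at hy
  have hsum : ∑ k ∈ Finset.range (n + 1), ((k.factorial : ℝ)⁻¹ * (x - a) ^ k) •
      iteratedDerivWithin k f (Set.uIcc a x) a =
      ∑ j ∈ Finset.range (n + 1), iteratedDeriv j f a / j.factorial * (x - a) ^ j := by
    refine Finset.sum_congr rfl fun k hk => ?_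
    have hfk : ContDiff ℝ k f := hf.of_le (by exact_mod_cast (Finset.mem_range.1 hk).le)
    rw [iteratedDerivWithin_eq_iteratedDeriv (uniqueDiffOn_uIcc hne) hfk.contDiffAt
      Set.left_mem_uIcc, smul_eq_mul]
    ring
  rw [← hsum, hy, abs_div, abs_mul, abs_pow, Nat.abs_cast]
  exact (div_le_self (by positivity) (one_le_cast_factorial _)).trans
    (mul_le_mul_of_nonneg_right (hK y) (by positivity))

/-- `K` is a Lipschitz constant for `f` and bounds the coefficients and the relative error of an
expansion of `f` to seventh order around each point. -/
structure HasTaylorBound (f : ℝ → ℝ) (K : ℝ) : Prop where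
  one_le : 1 ≤ K
  lipschitz : ∀ x y, |f x - f y| ≤ K * |x - y|
  taylor : ∀ a, ∃ c : ℕ → ℝ, (∀ j ∈ Finset.range 8, |c j| ≤ K) ∧
    ∀ x, |f x - ∑ j ∈ Finset.range 8, c j * (x - a) ^ j| ≤ K * |x - a| ^ 8

theorem exists_hasTaylorBound_smoothCutoff : ∃ K, HasTaylorBound smoothCutoff K := by
  choose b hb using exists_bound_iteratedDeriv_smoothCutoff
  have hb_nonneg : ∀ j, 0 ≤ b j := fun j => (abs_nonneg _).trans (hb j 0)
  set K : ℝ := 1 + ∑ j ∈ Finset.range 9, b j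
  have hderiv : ∀ j ∈ Finset.range 9, ∀ x, |iteratedDeriv j smoothCutoff x| ≤ K := fun j hj x =>
    (hb j x).trans (by linarith [Finset.single_le_sum (fun i _ => hb_nonneg i) hj])
  refine ⟨K, ?_, fun x y => ?_, fun a => ⟨fun j => iteratedDeriv j smoothCutoff a / j.factorial,
    fun j hj => ?_, abs_sub_taylor_le (n := 7) (contDiff_smoothCutoff (n := (8 : ℕ)))
      (hderiv 8 (by simp)) a⟩⟩
  · linarith [Finset.sum_nonneg fun i (_ : i ∈ Finset.range 9) => hb_nonneg i]
  · simpa using abs_sub_taylor_le (n := 0) (contDiff_smoothCutoff (n := (1 : ℕ)))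
      (hderiv 1 (by simp)) y x
  · rw [abs_div, Nat.abs_cast]
    exact (div_le_self (abs_nonneg _) (one_le_cast_factorial j)).trans
      (hderiv j (Finset.range_subset_range.2 (by norm_num) hj) a)

/-- The share `α = b / (a + b)` after the relative perturbations `u` of `a` and `u'` of `b`. -/
noncomputable def perturbedShare (α u u' : ℝ) : ℝ :=
  α * (1 + u') / (1 + ((1 - α) * u + α * u'))

/-- The expansion of `perturbedShare` to seventh order, which also makes sense for polynomial
perturbations. -/
noncomputable def shareApprox {A : Type*} [Ring A] [Algebra ℝ A] (α : ℝ) (u u' : A) : A :=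
  α • (1 + u') * ∑ j ∈ Finset.range 8, (-((1 - α) • u + α • u')) ^ j

variable {α u u' m : ℝ}

theorem abs_convexComb_le (hα : α ∈ Set.Icc (0 : ℝ) 1) (hu : |u| ≤ m) (hu' : |u'| ≤ m) :
    |(1 - α) * u + α * u'| ≤ m := by
  obtain ⟨hα_nonneg, hα_le⟩ := hα
  rw [abs_le] at *
  constructor <;> nlinarith

theorem sum_neg_pow_eq_div {v : ℝ} (hv : 1 + v ≠ 0) :
    ∑ j ∈ Finset.range 8, (-v) ^ j = (1 - v ^ 8) / (1 + v) := by
  rw [eq_div_iff hv]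
  simp only [Finset.sum_range_succ, Finset.sum_range_zero]
  ring

theorem abs_perturbedShare_sub_shareApprox_le (hα : α ∈ Set.Icc (0 : ℝ) 1) (hu : |u| ≤ m)
    (hu' : |u'| ≤ m) (hm : m ≤ 1 / 2) :
    |perturbedShare α u u' - shareApprox α u u'| ≤ 3 * m ^ 8 := by
  have hv := abs_convexComb_le hα hu hu'
  set v := (1 - α) * u + α * u' with hv_def
  have hv_ge : 1 / 2 ≤ 1 + v := by linarith [(abs_le.1 hv).1]
  have hv_pos : 0 < 1 + v := by linarith
  have hnum : |α * (1 + u')| ≤ 3 / 2 := by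
    obtain ⟨hα_nonneg, hα_le⟩ := hα
    rw [abs_mul, abs_of_nonneg hα_nonneg, abs_of_nonneg (by linarith [(abs_le.1 hu').1])]
    nlinarith [(abs_le.1 hu').2]
  have hdiff : perturbedShare α u u' - shareApprox α u u' =
      α * (1 + u') * (v ^ 8 / (1 + v)) := by
    simp only [perturbedShare, shareApprox, smul_eq_mul, ← hv_def,
      sum_neg_pow_eq_div hv_pos.ne']
    field_simp
    ring
  rw [hdiff, abs_mul, abs_div, abs_pow, abs_of_pos hv_pos]
  calc |α * (1 + u')| * (|v| ^ 8 / (1 + v)) ≤ 3 / 2 * (m ^ 8 / (1 / 2)) := by gcongr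
    _ = 3 * m ^ 8 := by ring

theorem abs_perturbedShare_sub_le (hα : α ∈ Set.Icc (0 : ℝ) 1) (hu : |u| ≤ m)
    (hu' : |u'| ≤ m) (hm : m ≤ 1 / 2) : |perturbedShare α u u' - α| ≤ 4 * m := by
  have hv := abs_convexComb_le hα hu hu'
  set v := (1 - α) * u + α * u' with hv_def
  have hm_nonneg : 0 ≤ m := (abs_nonneg _).trans hu
  have hv_ge : 1 / 2 ≤ 1 + v := by linarith [(abs_le.1 hv).1]
  have hv_pos : 0 < 1 + v := by linarith
  have hdiff : perturbedShare α u u' - α = α * (u' - v) / (1 + v) := by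
    rw [perturbedShare, ← hv_def]
    field_simp
    ring
  have hsub : |u' - v| ≤ 2 * m := (abs_sub _ _).trans (by linarith)
  rw [hdiff, abs_div, abs_mul, abs_of_pos hv_pos, abs_of_nonneg hα.1]
  calc α * |u' - v| / (1 + v) ≤ 1 * (2 * m) / (1 / 2) := by gcongr; exact hα.2
    _ = 4 * m := by ring

theorem abs_shareApprox_sub_le (hα : α ∈ Set.Icc (0 : ℝ) 1) (hu : |u| ≤ m)
    (hu' : |u'| ≤ m) (hm : m ≤ 1 / 2) : |shareApprox α u u' - α| ≤ 7 * m := by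
  have hm_nonneg : 0 ≤ m := (abs_nonneg _).trans hu
  have hpow : m ^ 8 ≤ m := pow_le_of_le_one hm_nonneg (by linarith) (by norm_num)
  have happrox := abs_perturbedShare_sub_shareApprox_le hα hu hu' hm
  rw [abs_sub_comm] at happrox
  linarith [abs_sub_le (shareApprox α u u') (perturbedShare α u u') α,
    abs_perturbedShare_sub_le hα hu hu' hm]

theorem abs_sum_range_le {n : ℕ} {f : ℕ → ℝ} {b : ℝ} (h : ∀ l ∈ Finset.range n, |f l| ≤ b) :
    |∑ l ∈ Finset.range n, f l| ≤ n * b :=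
  (Finset.abs_sum_le_sum_abs _ _).trans ((Finset.sum_le_card_nsmul _ _ b h).trans (by simp))

theorem abs_shareApprox_sub_le_of_one_le (hα : α ∈ Set.Icc (0 : ℝ) 1) (hu : |u| ≤ m)
    (hu' : |u'| ≤ m) (hm : 1 ≤ m) : |shareApprox α u u' - α| ≤ 17 * m ^ 8 := by
  have hv := abs_convexComb_le hα hu hu'
  obtain ⟨hα_nonneg, hα_le⟩ := hα
  set v := (1 - α) * u + α * u' with hv_def
  have hgeom : |∑ j ∈ Finset.range 8, (-v) ^ j| ≤ 8 * m ^ 7 := by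
    refine (abs_sum_range_le (b := m ^ 7) fun j hj => ?_).trans_eq (by norm_num)
    rw [abs_pow, abs_neg]
    exact (pow_le_pow_left₀ (abs_nonneg _) hv j).trans
      (pow_le_pow_right₀ hm (Nat.le_of_lt_succ (Finset.mem_range.1 hj)))
  have hnum : |α * (1 + u')| ≤ 2 * m := by
    have hadd : |1 + u'| ≤ 2 * m := (abs_add_le _ _).trans (by rw [abs_one]; linarith)
    rw [abs_mul, abs_of_nonneg hα_nonneg]
    calc α * |1 + u'| ≤ 1 * (2 * m) := by gcongr
      _ = 2 * m := one_mul _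
  have hshare : |shareApprox α u u'| ≤ 16 * m ^ 8 := by
    simp only [shareApprox, smul_eq_mul, ← hv_def, abs_mul (α * (1 + u'))]
    calc |α * (1 + u')| * |∑ j ∈ Finset.range 8, (-v) ^ j| ≤ 2 * m * (8 * m ^ 7) := by gcongr
      _ = 16 * m ^ 8 := by ring
  refine (abs_sub _ _).trans ?_
  rw [abs_of_nonneg hα_nonneg]
  linarith [one_le_pow₀ hm (n := 8)]

end SmoothCutoff

section CutoffApproximation

/-- The polynomial with coefficients `c` in the total displacement of the shares `α l` under the
perturbations `u`, each share being expanded to seventh order. -/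
noncomputable def taylorShares {A : Type*} [Ring A] [Algebra ℝ A] (c : ℕ → ℝ) (d : ℕ)
    (α : ℕ → ℝ) (u : ℕ → A) : A :=
  ∑ j ∈ Finset.range 8, c j • (∑ l ∈ Finset.range d, shareApprox (α l) (u l) (u (l + 1))
    - algebraMap ℝ A (∑ l ∈ Finset.range d, α l)) ^ j

variable {K : ℝ} {d : ℕ} {α u : ℕ → ℝ} {c : ℕ → ℝ} {f : ℝ → ℝ} {m : ℝ}

theorem abs_sub_taylorShares_le (hK : 0 ≤ K) (hlip : ∀ x y, |f x - f y| ≤ K * |x - y|)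
    (hα : ∀ l, α l ∈ Set.Icc (0 : ℝ) 1)
    (htaylor : ∀ x, |f x - ∑ j ∈ Finset.range 8, c j * (x - ∑ l ∈ Finset.range d, α l) ^ j|
      ≤ K * |x - ∑ l ∈ Finset.range d, α l| ^ 8)
    (hu : ∀ l ≤ d, |u l| ≤ m) (hm : m ≤ 1 / 2) :
    |f (∑ l ∈ Finset.range d, perturbedShare (α l) (u l) (u (l + 1))) -
      taylorShares c d α u| ≤ (3 * d + 7 ^ 8 * d ^ 8) * (K * m ^ 8) := by
  simp only [taylorShares, smul_eq_mul, Algebra.algebraMap_self, RingHom.id_apply]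
  set S₀ := ∑ l ∈ Finset.range d, α l with hS₀
  set S₁ := ∑ l ∈ Finset.range d, shareApprox (α l) (u l) (u (l + 1)) with hS₁
  set S := ∑ l ∈ Finset.range d, perturbedShare (α l) (u l) (u (l + 1)) with hS
  have hu' : ∀ l ∈ Finset.range d, |u l| ≤ m ∧ |u (l + 1)| ≤ m := fun l hl =>
    have hl := Finset.mem_range.1 hl
    ⟨hu l hl.le, hu (l + 1) hl⟩
  have hshare : |S - S₁| ≤ d * (3 * m ^ 8) := by
    rw [hS, hS₁, ← Finset.sum_sub_distrib]
    exact abs_sum_range_le fun l hl =>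
      abs_perturbedShare_sub_shareApprox_le (hα l) (hu' l hl).1 (hu' l hl).2 hm
  have hmove : |S₁ - S₀| ≤ d * (7 * m) := by
    rw [hS₀, hS₁, ← Finset.sum_sub_distrib]
    exact abs_sum_range_le fun l hl => abs_shareApprox_sub_le (hα l) (hu' l hl).1 (hu' l hl).2 hm
  calc |f S - ∑ j ∈ Finset.range 8, c j * (S₁ - S₀) ^ j|
      ≤ |f S - f S₁| + |f S₁ - ∑ j ∈ Finset.range 8, c j * (S₁ - S₀) ^ j| := abs_sub_le _ _ _
    _ ≤ K * |S - S₁| + K * |S₁ - S₀| ^ 8 := add_le_add (hlip S S₁) (htaylor S₁)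
    _ ≤ K * (d * (3 * m ^ 8)) + K * (d * (7 * m)) ^ 8 := by gcongr
    _ = (3 * d + 7 ^ 8 * d ^ 8) * (K * m ^ 8) := by ring

theorem abs_taylorShares_le (hd : 0 < d) (hK : 0 ≤ K) (hα : ∀ l, α l ∈ Set.Icc (0 : ℝ) 1)
    (hc : ∀ j ∈ Finset.range 8, |c j| ≤ K) (hu : ∀ l ≤ d, |u l| ≤ m) (hm : 1 ≤ m) :
    |taylorShares c d α u| ≤ 8 * (K * (d * (17 * m ^ 8)) ^ 7) := by
  simp only [taylorShares, smul_eq_mul, Algebra.algebraMap_self, RingHom.id_apply]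
  have hmove : |∑ l ∈ Finset.range d, shareApprox (α l) (u l) (u (l + 1))
      - ∑ l ∈ Finset.range d, α l| ≤ d * (17 * m ^ 8) := by
    rw [← Finset.sum_sub_distrib]
    exact abs_sum_range_le fun l hl =>
      have hl := Finset.mem_range.1 hl
      abs_shareApprox_sub_le_of_one_le (hα l) (hu l hl.le) (hu (l + 1) hl) hm
  have hbase : 1 ≤ d * (17 * m ^ 8) :=
    one_le_mul_of_one_le_of_one_le (by exact_mod_cast hd) (by linarith [one_le_pow₀ hm (n := 8)])
  refine (abs_sum_range_le (b := K * (d * (17 * m ^ 8)) ^ 7) fun j hj => ?_).trans_eq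
    (by norm_num)
  rw [abs_mul, abs_pow]
  exact mul_le_mul (hc j hj) ((pow_le_pow_left₀ (abs_nonneg _) hmove j).trans
    (pow_le_pow_right₀ hbase (Nat.le_of_lt_succ (Finset.mem_range.1 hj)))) (by positivity) hK

theorem one_add_taylor_bound_le (hd : 0 < d) (hK : 1 ≤ K) (hm : 1 / 2 ≤ m) :
    1 + 8 * (K * (d * (17 * (2 * m) ^ 8)) ^ 7) ≤ 9 ^ 40 * K * d ^ 8 * m ^ 64 := by
  have hd1 : (1 : ℝ) ≤ d := by exact_mod_cast hd
  set M := 2 * m with hM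
  have hM1 : 1 ≤ M := by linarith
  have hone : 1 ≤ K * d ^ 8 * M ^ 64 := one_le_mul_of_one_le_of_one_le
    (one_le_mul_of_one_le_of_one_le hK (one_le_pow₀ hd1)) (one_le_pow₀ hM1)
  calc 1 + 8 * (K * (d * (17 * M ^ 8)) ^ 7)
      = 1 + 8 * 17 ^ 7 * (K * d ^ 7 * M ^ 56) := by ring
    _ ≤ K * d ^ 8 * M ^ 64 + 8 * 17 ^ 7 * (K * d ^ 8 * M ^ 64) := by
        gcongr <;> first | assumption | norm_num
    _ = (1 + 8 * 17 ^ 7) * 2 ^ 64 * (K * d ^ 8 * m ^ 64) := by rw [hM]; ring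
    _ ≤ 9 ^ 40 * (K * d ^ 8 * m ^ 64) := by gcongr; norm_num
    _ = 9 ^ 40 * K * d ^ 8 * m ^ 64 := by ring

theorem HasTaylorBound.exists_abs_sub_taylorShares_le (hfK : HasTaylorBound f K)
    (hf : ∀ x, |f x| ≤ 1) (hd : 0 < d) (hα : ∀ l, α l ∈ Set.Icc (0 : ℝ) 1) :
    ∃ c : ℕ → ℝ, ∀ u : ℕ → ℝ,
      |f (∑ l ∈ Finset.range d, perturbedShare (α l) (u l) (u (l + 1))) - taylorShares c d α u|
        ≤ 9 ^ 40 * K * d ^ 8 * ∑ l ∈ Finset.range (d + 1), (u l ^ 8 + u l ^ 64) := by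
  have hK_nonneg : 0 ≤ K := zero_le_one.trans hfK.one_le
  obtain ⟨c, hc, htaylor⟩ := hfK.taylor (∑ l ∈ Finset.range d, α l)
  refine ⟨c, fun u => ?_⟩
  obtain ⟨l₀, hl₀, hmax⟩ := Finset.exists_max_image (Finset.range (d + 1)) (fun l => |u l|)
    ⟨0, by simp⟩
  set m := |u l₀| with hm
  have hu : ∀ l ≤ d, |u l| ≤ m := fun l hl => hmax l (Finset.mem_range_succ_iff.2 hl)
  have hsum : m ^ 8 + m ^ 64 ≤ ∑ l ∈ Finset.range (d + 1), (u l ^ 8 + u l ^ 64) := by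
    rw [hm, (show Even 8 by decide).pow_abs, (show Even 64 by decide).pow_abs]
    exact Finset.single_le_sum (f := fun l => u l ^ 8 + u l ^ 64) (fun l _ => by positivity) hl₀
  refine le_trans ?_ (mul_le_mul_of_nonneg_left hsum (by positivity))
  have h64 : 0 ≤ 9 ^ 40 * K * d ^ 8 * m ^ 64 := by positivity
  have h8 : 0 ≤ 9 ^ 40 * K * d ^ 8 * m ^ 8 := by positivity
  rw [mul_add]
  rcases le_or_gt m (1 / 2) with hsmall | hlarge
  · have hd8 : (d : ℝ) ≤ d ^ 8 := le_self_pow₀ (by exact_mod_cast hd) (by norm_num)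
    have hcoeff : (3 * d + 7 ^ 8 * d ^ 8) * (K * m ^ 8) ≤ 9 ^ 40 * d ^ 8 * (K * m ^ 8) := by
      gcongr
      linarith [show (0 : ℝ) ≤ d ^ 8 by positivity]
    linarith [abs_sub_taylorShares_le hK_nonneg hfK.lipschitz hα htaylor hu hsmall]
  · have htail := abs_taylorShares_le hd hK_nonneg hα hc (m := 2 * m)
      (fun l hl => (hu l hl).trans (by linarith)) (by linarith)
    refine (abs_sub _ _).trans ?_
    linarith [one_add_taylor_bound_le hd hfK.one_le hlarge.le,
      hf (∑ l ∈ Finset.range d, perturbedShare (α l) (u l) (u (l + 1)))]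

end CutoffApproximation

section SignLike

/-- The functions `s` of a polynomial for which the comparison is carried out: they are bounded by
one and do not change under small relative perturbations of the argument. The instances of interest
are the sign and the constant `1`, which handles the cutoff by itself. -/
structure IsSignLike (s : ℝ → ℝ) : Prop where
  measurable : Measurable s
  abs_le_one : ∀ t, |s t| ≤ 1
  mul_eq : ∀ a w, |w| ≤ 1 / 2 → s (a * (1 + w)) = s a

variable {s : ℝ → ℝ}

theorem isSignLike_one : IsSignLike fun _ => 1 := ⟨measurable_const, by simp, by simp⟩

theorem isSignLike_sign : IsSignLike Real.sign := by
  refine ⟨?_, fun t => ?_, fun a w hw => ?_⟩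
  · unfold Real.sign
    exact Measurable.ite measurableSet_Iio measurable_const
      (Measurable.ite measurableSet_Ioi measurable_const measurable_const)
  · rcases Real.sign_apply_eq t with h | h | h <;> simp [h]
  · have hpos : 0 < 1 + w := by linarith [(abs_le.1 hw).1]
    rcases lt_trichotomy a 0 with h | h | h
    · rw [Real.sign_of_neg h, Real.sign_of_neg (mul_neg_of_neg_of_pos h hpos)]
    · simp [h]
    · rw [Real.sign_of_pos h, Real.sign_of_pos (mul_pos h hpos)]

theorem one_le_two_pow_mul_pow_eight {w : ℝ} (hw : 1 / 2 ≤ |w|) : 1 ≤ 2 ^ 8 * w ^ 8 := by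
  rw [← (show Even 8 by decide).pow_abs w, ← mul_pow]
  exact one_le_pow₀ (by linarith)

theorem IsSignLike.abs_mul_sub_mul_le (hs : IsSignLike s) {G A R a w : ℝ} (hG : |G| ≤ 1)
    (hA : |G - A| ≤ R) : |s (a * (1 + w)) * G - s a * A| ≤ R + 2 ^ 9 * w ^ 8 := by
  have hw_nonneg : 0 ≤ w ^ 8 := by positivity
  have habs : |s a * (G - A)| ≤ R := by
    rw [abs_mul]
    exact (mul_le_of_le_one_left (abs_nonneg _) (hs.abs_le_one a)).trans hA
  rcases le_total |w| (1 / 2) with hsmall | hlarge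
  · rw [hs.mul_eq a w hsmall, ← mul_sub]
    linarith
  · have htriangle : |s (a * (1 + w)) - s a| ≤ 2 :=
      (abs_sub _ _).trans (by linarith [hs.abs_le_one (a * (1 + w)), hs.abs_le_one a])
    calc |s (a * (1 + w)) * G - s a * A|
        = |(s (a * (1 + w)) - s a) * G + s a * (G - A)| := by ring_nf
      _ ≤ 2 * 1 + R := by
        refine (abs_add_le _ _).trans (add_le_add ?_ habs)
        rw [abs_mul]
        gcongr
      _ ≤ R + 2 ^ 9 * w ^ 8 := by linarith [one_le_two_pow_mul_pow_eight hlarge]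

end SignLike

section TruncatedSign

open MvPolynomial

/-- The share of `κ² b` in `a + κ² b`, which is close to `0` if `a` dominates `κ² b`. -/
noncomputable def stepRatio (κ a b : ℝ) : ℝ := κ ^ 2 * b / (a + κ ^ 2 * b)

theorem stepRatio_mem_Icc {a b : ℝ} (κ : ℝ) (ha : 0 ≤ a) (hb : 0 ≤ b) :
    stepRatio κ a b ∈ Set.Icc (0 : ℝ) 1 := by
  have hκb : 0 ≤ κ ^ 2 * b := by positivity
  exact ⟨div_nonneg hκb (by positivity), div_le_one_of_le₀ (by linarith) (by positivity)⟩

theorem stepRatio_mul_one_add {κ a b : ℝ} (ha : 0 ≤ a) (hb : 0 ≤ b) (u u' : ℝ) :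
    stepRatio κ (a * (1 + u)) (b * (1 + u')) = perturbedShare (stepRatio κ a b) u u' := by
  have hκb : 0 ≤ κ ^ 2 * b := by positivity
  rw [perturbedShare, stepRatio, stepRatio]
  rcases (add_nonneg ha hκb).eq_or_lt with hsum | hsum
  · have ha_zero : a = 0 := by linarith
    have hκb_zero : κ ^ 2 * b = 0 := by linarith
    simp [ha_zero, ← mul_assoc, hκb_zero]
  · have hden : 1 + ((1 - κ ^ 2 * b / (a + κ ^ 2 * b)) * u + κ ^ 2 * b / (a + κ ^ 2 * b) * u')
        = (a * (1 + u) + κ ^ 2 * (b * (1 + u'))) / (a + κ ^ 2 * b) := by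
      field_simp
      ring
    rw [hden]
    field_simp

variable {σ : Type*} [Fintype σ] {s : ℝ → ℝ}

/-- The weight of the `(l + 1)`-st derivative of `q` at `x`, relative to the `l`-th one. -/
noncomputable def gradRatio (κ : ℝ) (q : MvPolynomial σ ℝ) (l : ℕ) (x : σ → ℝ) : ℝ :=
  stepRatio κ (eval x (gradSq l q)) (eval x (gradSq (l + 1) q))

theorem gradRatio_nonneg (κ : ℝ) (q : MvPolynomial σ ℝ) (l : ℕ) (x : σ → ℝ) :
    0 ≤ gradRatio κ q l x :=
  (stepRatio_mem_Icc κ (eval_gradSq_nonneg l q x) (eval_gradSq_nonneg (l + 1) q x)).1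

/-- A smooth cutoff to the points where the derivatives of `q` of order up to `d` grow slowly with
their order. -/
noncomputable def gradCutoff (d : ℕ) (κ : ℝ) (q : MvPolynomial σ ℝ) (x : σ → ℝ) : ℝ :=
  smoothCutoff (∑ l ∈ Finset.range d, gradRatio κ q l x)

@[fun_prop]
theorem measurable_gradCutoff (d : ℕ) (κ : ℝ) (q : MvPolynomial σ ℝ) :
    Measurable (gradCutoff d κ q) := by
  refine (contDiff_smoothCutoff (n := 0)).continuous.measurable.comp
    (Finset.measurable_sum _ fun l _ => ?_)
  unfold gradRatio stepRatio
  fun_prop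

theorem abs_gradCutoff_le_one (d : ℕ) (κ : ℝ) (q : MvPolynomial σ ℝ) (x : σ → ℝ) :
    |gradCutoff d κ q x| ≤ 1 :=
  abs_smoothCutoff_le_one _

theorem gradCutoff_eq_zero {d l : ℕ} (hl : l < d) {κ : ℝ} {q : MvPolynomial σ ℝ} {x : σ → ℝ}
    (h : 1 / 2 ≤ gradRatio κ q l x) : gradCutoff d κ q x = 0 :=
  smoothCutoff_eq_zero <| h.trans <| Finset.single_le_sum (f := fun l => gradRatio κ q l x)
    (fun i _ => gradRatio_nonneg κ q i x) (Finset.mem_range.2 hl)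

/-- The composite of `s` with a polynomial `q`, cut off to the points where the derivatives of `q`
grow slowly with their order. -/
noncomputable def truncSign (s : ℝ → ℝ) (d : ℕ) (κ : ℝ) (q : MvPolynomial σ ℝ) (x : σ → ℝ) : ℝ :=
  s (eval x q) * gradCutoff d κ q x

@[fun_prop]
theorem measurable_truncSign (hs : IsSignLike s) (d : ℕ) (κ : ℝ) (q : MvPolynomial σ ℝ) :
    Measurable (truncSign s d κ q) := by
  have := hs.measurable
  unfold truncSign
  fun_prop

theorem abs_truncSign_le_one (hs : IsSignLike s) (d : ℕ) (κ : ℝ) (q : MvPolynomial σ ℝ)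
    (x : σ → ℝ) : |truncSign s d κ q x| ≤ 1 := by
  rw [truncSign, abs_mul]
  exact mul_le_one₀ (hs.abs_le_one _) (abs_nonneg _) (abs_gradCutoff_le_one d κ q x)

end TruncatedSign

section LocalComparison

open MvPolynomial

theorem integrable_of_abs_le_one {α : Type*} [MeasurableSpace α] {μ : Measure α}
    [IsFiniteMeasure μ] {F : α → ℝ} (hF : Measurable F) (hF1 : ∀ x, |F x| ≤ 1) : Integrable F μ :=
  Integrable.of_bound hF.aestronglyMeasurable 1 (Filter.Eventually.of_forall hF1)

theorem abs_integral_sub_integral_le_two {α β : Type*} [MeasurableSpace α] [MeasurableSpace β]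
    {P : Measure α} [IsProbabilityMeasure P] {Q : Measure β} [IsProbabilityMeasure Q]
    {f : α → ℝ} {g : β → ℝ} (hf : ∀ x, |f x| ≤ 1) (hg : ∀ x, |g x| ≤ 1) :
    |∫ x, f x ∂P - ∫ x, g x ∂Q| ≤ 2 := by
  have hP : |∫ x, f x ∂P| ≤ 1 := by
    simpa using norm_integral_le_of_norm_le_const (μ := P) (f := f)
      (Filter.Eventually.of_forall hf)
  have hQ : |∫ x, g x ∂Q| ≤ 1 := by
    simpa using norm_integral_le_of_norm_le_const (μ := Q) (f := g)
      (Filter.Eventually.of_forall hg)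
  exact (abs_sub _ _).trans (by linarith)

variable {σ : Type*} {d k l : ℕ}

theorem eval_shareApprox (α : ℝ) (u u' : MvPolynomial σ ℝ) (x : σ → ℝ) :
    eval x (shareApprox α u u') = shareApprox α (eval x u) (eval x u') := by
  simp only [shareApprox, smul_eval, smul_eq_mul, map_mul, map_add, map_sum, map_pow, map_neg,
    map_one]

theorem eval_taylorShares (c : ℕ → ℝ) (d : ℕ) (α : ℕ → ℝ) (u : ℕ → MvPolynomial σ ℝ) (x : σ → ℝ) :
    eval x (taylorShares c d α u) = taylorShares c d α fun l => eval x (u l) := by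
  simp [taylorShares, eval_shareApprox]

theorem totalDegree_shareApprox_le {α : ℝ} {u u' : MvPolynomial σ ℝ} {e : ℕ}
    (hu : u.totalDegree ≤ e) (hu' : u'.totalDegree ≤ e) :
    (shareApprox α u u').totalDegree ≤ 8 * e := by
  have hsmul : ∀ (a : ℝ) {q : MvPolynomial σ ℝ}, q.totalDegree ≤ e → (a • q).totalDegree ≤ e :=
    fun a q hq => (totalDegree_smul_le a q).trans hq
  have hnum : (α • (1 + u')).totalDegree ≤ e := hsmul α (totalDegree_add_le_of_le (by simp) hu')
  have hconv : (-((1 - α) • u + α • u')).totalDegree ≤ e := by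
    rw [totalDegree_neg]
    exact totalDegree_add_le_of_le (hsmul _ hu) (hsmul _ hu')
  have hgeom : (∑ j ∈ Finset.range 8, (-((1 - α) • u + α • u')) ^ j).totalDegree ≤ 7 * e :=
    totalDegree_finsetSum_le fun j hj => totalDegree_pow_le_of_le hconv
      (Nat.mul_le_mul_right _ (Nat.le_of_lt_succ (Finset.mem_range.1 hj)))
  refine (totalDegree_mul _ _).trans ?_
  omega

theorem totalDegree_taylorShares_le {c α : ℕ → ℝ} {u : ℕ → MvPolynomial σ ℝ} {e : ℕ}
    (hu : ∀ l, (u l).totalDegree ≤ e) : (taylorShares c d α u).totalDegree ≤ 56 * e := by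
  refine totalDegree_finsetSum_le fun j hj => (totalDegree_smul_le _ _).trans ?_
  have hsum : (∑ l ∈ Finset.range d, shareApprox (α l) (u l) (u (l + 1))).totalDegree ≤ 8 * e :=
    totalDegree_finsetSum_le fun l _ => totalDegree_shareApprox_le (hu l) (hu (l + 1))
  have hsub := totalDegree_sub_C_le hsum (∑ l ∈ Finset.range d, α l)
  refine totalDegree_pow_le_of_le hsub ?_
  nlinarith [Finset.mem_range.1 hj]

variable [Fintype σ] {ν : Measure (σ → ℝ)} {q : MvPolynomial σ ℝ}

theorem MatchesGaussian.abs_integral_sub_gaussE_le [IsProbabilityMeasure ν]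
    (hν : MatchesGaussian k ν) {F : (σ → ℝ) → ℝ} (hF : Measurable F) (hF1 : ∀ x, |F x| ≤ 1)
    {A R : MvPolynomial σ ℝ} (hA : A.totalDegree ≤ k) (hR : R.totalDegree ≤ k)
    (hle : ∀ᵐ x ∂ν, |F x - eval x A| ≤ eval x R) : |∫ x, F x ∂ν - gaussE σ A| ≤ gaussE σ R := by
  have hF_int : Integrable F ν := integrable_of_abs_le_one hF hF1
  have hA_int := hν.integrable A hA
  rw [← hν.integral_eq A hA, ← hν.integral_eq R hR, ← integral_sub hF_int hA_int]
  exact abs_integral_le_integral_abs.trans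
    (integral_mono_ae (hF_int.sub hA_int).abs (hν.integrable R hR) hle)

theorem MatchesGaussian.abs_integral_sub_le [IsProbabilityMeasure ν]
    (hν : MatchesGaussian k ν) {F : (σ → ℝ) → ℝ} (hF : Measurable F) (hF1 : ∀ x, |F x| ≤ 1)
    {A R : MvPolynomial σ ℝ} (hA : A.totalDegree ≤ k) (hR : R.totalDegree ≤ k)
    (hle : ∀ ν' : Measure (σ → ℝ), MatchesGaussian k ν' →
      ∀ᵐ x ∂ν', |F x - eval x A| ≤ eval x R) :
    |∫ x, F x ∂ν - ∫ x, F x ∂(stdGauss σ)| ≤ 2 * gaussE σ R := by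
  have hstd := matchesGaussian_stdGauss (σ := σ) k
  have hν_close := hν.abs_integral_sub_gaussE_le hF hF1 hA hR (hle ν hν)
  have hstd_close := hstd.abs_integral_sub_gaussE_le hF hF1 hA hR (hle _ hstd)
  rw [abs_sub_comm] at hstd_close
  linarith [abs_sub_le (∫ x, F x ∂ν) (gaussE σ A) (∫ x, F x ∂(stdGauss σ))]

theorem MatchesGaussian.ae_eq_zero (hν : MatchesGaussian k ν) (hq : q.totalDegree ≤ k)
    (hpos : ∀ x, 0 ≤ eval x q) (hzero : gaussE σ q = 0) : ∀ᵐ x ∂ν, eval x q = 0 :=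
  (integral_eq_zero_iff_of_nonneg hpos (hν.integrable q hq)).1 ((hν.integral_eq q hq).trans hzero)

theorem MatchesGaussian.ae_gradSq_eq (hν : MatchesGaussian k ν) (hk : 2 * d ≤ k)
    (hq : q.totalDegree ≤ d) {θ : ℝ}
    (hdecay : ∀ j, l < j → meanDerivSq j q ≤ θ * meanDerivSq l q) :
    ∀ᵐ x ∂ν, eval x (gradSq l q) = meanDerivSq l q * (1 + eval x (relDev l q)) := by
  rcases eq_or_ne (meanDerivSq l q) 0 with hmean | hmean
  · have hdev := gaussE_devSq_le hq hdecay
    have hgrad := gaussE_devSq l q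
    rw [hmean, mul_zero, mul_zero] at hdev
    rw [hmean, sub_zero] at hgrad
    have hgrad_zero : gaussE σ (gradSq l q) = 0 := by
      linarith [gaussE_devSq_nonneg l q]
    filter_upwards [hν.ae_eq_zero ((totalDegree_gradSq_le l hq).trans hk)
      (eval_gradSq_nonneg l q) hgrad_zero] with x hx
    rw [hx, hmean, zero_mul]
  · refine Filter.Eventually.of_forall fun x => ?_
    simp only [relDev, map_mul, map_sub, eval_C]
    field_simp
    ring

/-- The relative fluctuation of a polynomial around its Gaussian mean; it is `0` if the mean
vanishes. -/
noncomputable def relDevLin (q : MvPolynomial σ ℝ) : MvPolynomial σ ℝ :=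
  C (gaussE σ q)⁻¹ * (q - C (gaussE σ q))

theorem totalDegree_relDevLin_le (hq : q.totalDegree ≤ d) : (relDevLin q).totalDegree ≤ d := by
  have hsub := totalDegree_sub_C_le hq (gaussE σ q)
  exact totalDegree_C_mul_le hsub _

theorem gaussE_relDevLin_sq_le (hq : q.totalDegree ≤ d) {θ : ℝ} (hθ : 0 ≤ θ)
    (hdecay : ∀ j, 0 < j → meanDerivSq j q ≤ θ * meanDerivSq 0 q) :
    gaussE σ (relDevLin q ^ 2) ≤ 9 ^ d * θ := by
  have hdev := gaussE_devSq_le hq hdecay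
  rw [devSq, meanDerivSq] at hdev
  rw [relDevLin, mul_pow, ← C_pow, gaussE_C_mul]
  rcases eq_or_ne (gaussE σ q) 0 with hmean | hmean
  · rw [hmean, inv_zero, zero_pow two_ne_zero, zero_mul]
    positivity
  · calc (gaussE σ q)⁻¹ ^ 2 * gaussE σ ((q - C (gaussE σ q)) ^ 2)
        ≤ (gaussE σ q)⁻¹ ^ 2 * (d * (θ * gaussE σ q ^ 2)) := by gcongr
      _ = d * θ := by field_simp
      _ ≤ 9 ^ d * θ := mul_le_mul_of_nonneg_right (natCast_le_nine_pow d) hθ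

theorem gaussE_relDevLin_pow_le (hq : q.totalDegree ≤ d) {θ : ℝ} (hθ : 0 ≤ θ)
    (hdecay : ∀ j, 0 < j → meanDerivSq j q ≤ θ * meanDerivSq 0 q) :
    gaussE σ (relDevLin q ^ 8) ≤ 9 ^ (448 * d) * θ ^ 4 := by
  have hmoment := gaussE_pow_two_pow_le 2 (totalDegree_relDevLin_le hq)
  norm_num at hmoment
  calc gaussE σ (relDevLin q ^ 8) ≤ 9 ^ (d * 8) * gaussE σ (relDevLin q ^ 2) ^ 4 := hmoment
    _ ≤ 9 ^ (d * 8) * (9 ^ d * θ) ^ 4 := by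
      gcongr
      · exact gaussE_pow_nonneg even_two _
      · exact gaussE_relDevLin_sq_le hq hθ hdecay
    _ = 9 ^ (12 * d) * θ ^ 4 := by
      rw [mul_pow, ← pow_mul, ← mul_assoc, ← pow_add, show d * 8 + d * 4 = 12 * d by ring]
    _ ≤ 9 ^ (448 * d) * θ ^ 4 := by
      gcongr <;> norm_num

theorem MatchesGaussian.ae_eq_relDevLin (hν : MatchesGaussian k ν) (hk : 2 * d ≤ k)
    (hq : q.totalDegree ≤ d) {θ : ℝ}
    (hdecay : ∀ j, 0 < j → meanDerivSq j q ≤ θ * meanDerivSq 0 q) :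
    ∀ᵐ x ∂ν, eval x q = gaussE σ q * (1 + eval x (relDevLin q)) := by
  rcases eq_or_ne (gaussE σ q) 0 with hmean | hmean
  · filter_upwards [hν.ae_gradSq_eq hk hq hdecay] with x hx
    rw [gradSq, meanDerivSq, hmean, map_pow] at hx
    rw [hmean, zero_mul]
    simpa using hx
  · refine Filter.Eventually.of_forall fun x => ?_
    simp only [relDevLin, map_mul, map_sub, eval_C]
    field_simp
    ring

end LocalComparison

section LocalBound

open MvPolynomial

variable {σ : Type*} [Fintype σ] {d l : ℕ} {q : MvPolynomial σ ℝ} {s : ℝ → ℝ} {κ θ : ℝ}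
  {ν : Measure (σ → ℝ)}

theorem meanDerivSq_le_of_decay (hθ : θ ≤ 1)
    (h : ∀ j, l ≤ j → meanDerivSq (j + 1) q ≤ θ * meanDerivSq j q) {i j : ℕ} (hi : l ≤ i)
    (hij : i < j) : meanDerivSq j q ≤ θ * meanDerivSq i q := by
  induction j, hij using Nat.le_induction with
  | base => exact h i hi
  | succ j hj ih =>
    calc meanDerivSq (j + 1) q ≤ θ * meanDerivSq j q := h j (by omega)
      _ ≤ meanDerivSq j q := mul_le_of_le_one_left (meanDerivSq_nonneg j q) hθ
      _ ≤ θ * meanDerivSq i q := ih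

theorem natCast_pow_eight_mul_le (hd : 0 < d) : (d : ℝ) ^ 8 * ((d + 1) * 2) ≤ 9 ^ (10 * d) := by
  have hcast := natCast_le_nine_pow d
  have hd1 : (1 : ℝ) ≤ d := by exact_mod_cast hd
  have hnine : (9 : ℝ) ≤ 9 ^ d := le_self_pow₀ (by norm_num) hd.ne'
  calc (d : ℝ) ^ 8 * ((d + 1) * 2) ≤ (9 ^ d) ^ 8 * ((9 ^ d) * 9 ^ d) := by
        gcongr ?_ ^ 8 * ?_
        nlinarith
    _ = 9 ^ (10 * d) := by ring

theorem mul_le_of_natCast_mul_le_one (hd : 0 < d) (hθ : 0 ≤ θ) (hθd : d * θ ≤ 1) : θ ≤ 1 :=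
  (le_mul_of_one_le_left hθ (by exact_mod_cast hd)).trans hθd

/-- A polynomial dominating the error of expanding `gradCutoff` in the relative fluctuations of the
derivatives. -/
noncomputable def cutoffError (K : ℝ) (d : ℕ) (q : MvPolynomial σ ℝ) : MvPolynomial σ ℝ :=
  C (9 ^ 40 * K * d ^ 8) * ∑ l ∈ Finset.range (d + 1), (relDev l q ^ 8 + relDev l q ^ 64)

theorem totalDegree_cutoffError_le (K : ℝ) (hq : q.totalDegree ≤ d) :
    (cutoffError K d q).totalDegree ≤ 128 * d := by
  refine totalDegree_C_mul_le (totalDegree_finsetSum_le fun l _ => ?_) _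
  have hdev := totalDegree_relDev_le l hq
  exact totalDegree_add_le_of_le (totalDegree_pow_le_of_le hdev (by omega))
    (totalDegree_pow_le_of_le hdev (by omega))

theorem exists_abs_gradCutoff_sub_taylorShares_le {K : ℝ} (hK : HasTaylorBound smoothCutoff K)
    (hd : 0 < d) (κ : ℝ) (q : MvPolynomial σ ℝ) :
    ∃ c α : ℕ → ℝ, ∀ x : σ → ℝ,
      (∀ l, eval x (gradSq l q) = meanDerivSq l q * (1 + eval x (relDev l q))) →
      |gradCutoff d κ q x - eval x (taylorShares c d α fun l => relDev l q)|
        ≤ eval x (cutoffError K d q) := by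
  set α : ℕ → ℝ := fun l => stepRatio κ (meanDerivSq l q) (meanDerivSq (l + 1) q)
  have hα : ∀ l, α l ∈ Set.Icc (0 : ℝ) 1 := fun l =>
    stepRatio_mem_Icc κ (meanDerivSq_nonneg l q) (meanDerivSq_nonneg (l + 1) q)
  obtain ⟨c, hc⟩ := hK.exists_abs_sub_taylorShares_le abs_smoothCutoff_le_one hd hα
  refine ⟨c, α, fun x hx => ?_⟩
  have hratio : ∀ l, gradRatio κ q l x =
      perturbedShare (α l) (eval x (relDev l q)) (eval x (relDev (l + 1) q)) := fun l => by
    rw [gradRatio, hx l, hx (l + 1),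
      stepRatio_mul_one_add (meanDerivSq_nonneg l q) (meanDerivSq_nonneg (l + 1) q)]
  simpa only [gradCutoff, hratio, eval_taylorShares, cutoffError, map_mul, map_sum, map_add,
    map_pow, eval_C] using hc fun l => eval x (relDev l q)

theorem gaussE_cutoffError_le {K : ℝ} (hK : 0 ≤ K) (hd : 0 < d) (hq : q.totalDegree ≤ d)
    (hθ : 0 ≤ θ) (hθd : d * θ ≤ 1)
    (hdecay : ∀ i j, i < j → meanDerivSq j q ≤ θ * meanDerivSq i q) :
    gaussE σ (cutoffError K d q) ≤ 9 ^ 40 * K * (9 ^ (458 * d) * θ ^ 4) := by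
  have hsum : ∑ l ∈ Finset.range (d + 1), gaussE σ (relDev l q ^ 8 + relDev l q ^ 64)
      ≤ (d + 1) * (2 * (9 ^ (448 * d) * θ ^ 4)) := by
    refine (Finset.sum_le_card_nsmul _ _ (2 * (9 ^ (448 * d) * θ ^ 4)) fun l _ => ?_).trans
      (by simp)
    obtain ⟨h8, h64⟩ := gaussE_relDev_pow_le hd hq hθ hθd (hdecay l)
    rw [map_add]
    linarith
  rw [cutoffError, gaussE_C_mul, map_sum]
  calc 9 ^ 40 * K * d ^ 8 *
        ∑ l ∈ Finset.range (d + 1), gaussE σ (relDev l q ^ 8 + relDev l q ^ 64)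
      ≤ 9 ^ 40 * K * d ^ 8 * ((d + 1) * (2 * (9 ^ (448 * d) * θ ^ 4))) := by gcongr
    _ = 9 ^ 40 * K * (d ^ 8 * ((d + 1) * 2) * (9 ^ (448 * d) * θ ^ 4)) := by ring
    _ ≤ 9 ^ 40 * K * (9 ^ (10 * d) * (9 ^ (448 * d) * θ ^ 4)) := by
      gcongr
      exact natCast_pow_eight_mul_le hd
    _ = 9 ^ 40 * K * (9 ^ (458 * d) * θ ^ 4) := by
      rw [← mul_assoc (9 ^ (10 * d)), ← pow_add, ← add_mul]

theorem MatchesGaussian.abs_integral_truncSign_sub_le_of_decay {K : ℝ}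
    (hK : HasTaylorBound smoothCutoff K) (hs : IsSignLike s) (hd : 0 < d) [IsProbabilityMeasure ν]
    (hν : MatchesGaussian (128 * d) ν) (hq : q.totalDegree ≤ d) (κ : ℝ) (hθ : 0 ≤ θ)
    (hθd : d * θ ≤ 1) (hdecay : ∀ j, meanDerivSq (j + 1) q ≤ θ * meanDerivSq j q) :
    |∫ x, truncSign s d κ q x ∂ν - ∫ x, truncSign s d κ q x ∂(stdGauss σ)|
      ≤ 9 ^ 44 * K * (9 ^ (458 * d) * θ ^ 4) := by
  have hdec : ∀ i j, i < j → meanDerivSq j q ≤ θ * meanDerivSq i q := fun i j =>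
    meanDerivSq_le_of_decay (mul_le_of_natCast_mul_le_one hd hθ hθd) (fun j _ => hdecay j)
      (Nat.zero_le i)
  obtain ⟨c, α, hc⟩ := exists_abs_gradCutoff_sub_taylorShares_le hK hd κ q
  set A := taylorShares c d α fun l => relDev l q
  have hA : A.totalDegree ≤ 128 * d :=
    (totalDegree_taylorShares_le fun l => totalDegree_relDev_le l hq).trans (by omega)
  have hlin : (C (2 ^ 9) * relDevLin q ^ 8).totalDegree ≤ 128 * d :=
    totalDegree_C_mul_le (totalDegree_pow_le_of_le (totalDegree_relDevLin_le hq) (by omega)) _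
  have hclose : ∀ ν' : Measure (σ → ℝ), MatchesGaussian (128 * d) ν' → ∀ᵐ x ∂ν',
      |truncSign s d κ q x - eval x (C (s (gaussE σ q)) * A)|
        ≤ eval x (cutoffError K d q + C (2 ^ 9) * relDevLin q ^ 8) := by
    intro ν' hν'
    have hgrad : ∀ᵐ x ∂ν', ∀ l, eval x (gradSq l q) =
        meanDerivSq l q * (1 + eval x (relDev l q)) :=
      ae_all_iff.2 fun l => hν'.ae_gradSq_eq (by omega) hq (hdec l)
    filter_upwards [hgrad, hν'.ae_eq_relDevLin (by omega) hq (hdec 0)] with x hx hx_lin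
    simp only [truncSign, map_add, map_mul, map_pow, eval_C]
    rw [hx_lin]
    exact hs.abs_mul_sub_mul_le (abs_gradCutoff_le_one d κ q x) (hc x hx)
  refine (hν.abs_integral_sub_le (measurable_truncSign hs d κ q) (abs_truncSign_le_one hs d κ q)
    (totalDegree_C_mul_le hA _)
    (totalDegree_add_le_of_le (totalDegree_cutoffError_le K hq) hlin) hclose).trans ?_
  rw [map_add, gaussE_C_mul]
  have hcut := gaussE_cutoffError_le (zero_le_one.trans hK.one_le) hd hq hθ hθd hdec
  have hlin_le : gaussE σ (relDevLin q ^ 8) ≤ K * (9 ^ (458 * d) * θ ^ 4) := by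
    refine (gaussE_relDevLin_pow_le hq hθ (hdec 0)).trans
      (le_trans ?_ (le_mul_of_one_le_left (by positivity) hK.one_le))
    gcongr <;> norm_num
  have hbound_nonneg : 0 ≤ K * (9 ^ (458 * d) * θ ^ 4) :=
    (gaussE_pow_nonneg (by decide) (relDevLin q)).trans hlin_le
  linarith

/-- A polynomial dominating `gradCutoff` if the mean of the `(l + 1)`-st derivative of `q` is large
relative to the one of the `l`-th derivative. -/
noncomputable def growthError (κ : ℝ) (l : ℕ) (q : MvPolynomial σ ℝ) : MvPolynomial σ ℝ :=
  C (2 ^ 8) * relDev (l + 1) q ^ 8 + C ((8 / (κ ^ 2 * meanDerivSq (l + 1) q)) ^ 4) * devSq l q ^ 4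

theorem totalDegree_growthError_le (κ : ℝ) (l : ℕ) (hq : q.totalDegree ≤ d) :
    (growthError κ l q).totalDegree ≤ 128 * d :=
  totalDegree_add_le_of_le
    (totalDegree_C_mul_le (totalDegree_pow_le_of_le (totalDegree_relDev_le _ hq) (by omega)) _)
    (totalDegree_C_mul_le (totalDegree_pow_le_of_le (totalDegree_devSq_le l hq) (by omega)) _)

theorem eval_growthError_nonneg (κ : ℝ) (l : ℕ) (q : MvPolynomial σ ℝ) (x : σ → ℝ) :
    0 ≤ eval x (growthError κ l q) := by
  simp only [growthError, map_add, map_mul, map_pow, eval_C]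
  positivity

theorem half_le_abs_relDev {x : σ → ℝ} (hmean : 0 < meanDerivSq l q)
    (h : eval x (gradSq l q) ≤ meanDerivSq l q / 2) : 1 / 2 ≤ |eval x (relDev l q)| := by
  have hdev : eval x (relDev l q) =
      (eval x (gradSq l q) - meanDerivSq l q) / meanDerivSq l q := by
    simp only [relDev, map_mul, map_sub, eval_C]
    rw [inv_mul_eq_div]
  rw [hdev, abs_div, abs_of_pos hmean, le_div_iff₀ hmean, abs_of_nonpos (by linarith)]
  linarith

theorem mul_meanDerivSq_le_devSq {x : σ → ℝ} (hκ : 0 < κ)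
    (hgrowth : 8 * meanDerivSq l q ≤ κ ^ 2 * meanDerivSq (l + 1) q)
    (hratio : gradRatio κ q l x < 1 / 2) (hmean : 0 < meanDerivSq (l + 1) q)
    (h : meanDerivSq (l + 1) q / 2 ≤ eval x (gradSq (l + 1) q)) :
    κ ^ 2 * meanDerivSq (l + 1) q ≤ 8 * eval x (devSq l q) := by
  have hgrad_nonneg := eval_gradSq_nonneg l q x
  have hnext : κ ^ 2 * (meanDerivSq (l + 1) q / 2) ≤ κ ^ 2 * eval x (gradSq (l + 1) q) := by
    gcongr
  have hnext_pos : 0 < κ ^ 2 * (meanDerivSq (l + 1) q / 2) := by positivity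
  rw [gradRatio, stepRatio, div_lt_iff₀ (by linarith)] at hratio
  linarith [eval_gradSq_le l q x]

theorem one_le_eval_growthError {x : σ → ℝ} (hκ : 0 < κ)
    (hgrowth : 8 * meanDerivSq l q ≤ κ ^ 2 * meanDerivSq (l + 1) q)
    (hmean : 0 < meanDerivSq (l + 1) q) (hratio : gradRatio κ q l x < 1 / 2) :
    1 ≤ eval x (growthError κ l q) := by
  simp only [growthError, map_add, map_mul, map_pow, eval_C, ← mul_pow _ (eval x (devSq l q))]
  rcases le_total (eval x (gradSq (l + 1) q)) (meanDerivSq (l + 1) q / 2) with hsmall | hlarge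
  · exact (one_le_two_pow_mul_pow_eight (half_le_abs_relDev hmean hsmall)).trans
      (le_add_of_nonneg_right (by positivity))
  · have hdev := mul_meanDerivSq_le_devSq hκ hgrowth hratio hmean hlarge
    have hone : 1 ≤ 8 / (κ ^ 2 * meanDerivSq (l + 1) q) * eval x (devSq l q) := by
      rwa [div_mul_eq_mul_div, one_le_div (by positivity)]
    exact (one_le_pow₀ hone).trans (le_add_of_nonneg_left (by positivity))

theorem gaussE_growthError_le (hd : 0 < d) (hq : q.totalDegree ≤ d) (hκ : 0 < κ)
    (hθd : d * (8 / κ ^ 2) ≤ 1) (hmean : 0 < meanDerivSq (l + 1) q)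
    (hdecay : ∀ j, l + 1 < j → meanDerivSq j q ≤ 8 / κ ^ 2 * meanDerivSq (l + 1) q) :
    gaussE σ (growthError κ l q) ≤ 257 * (9 ^ (458 * d) * (8 / κ ^ 2) ^ 4) := by
  have hθ : 0 ≤ 8 / κ ^ 2 := by positivity
  have hθ1 := mul_le_of_natCast_mul_le_one hd hθ hθd
  have hdev_nonneg := gaussE_devSq_nonneg l q
  have hdev : gaussE σ (devSq l q) ≤ d * meanDerivSq (l + 1) q := gaussE_devSq_le hq fun j hj => by
    rcases (Nat.succ_le_of_lt hj).eq_or_lt with rfl | hlt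
    · exact le_rfl
    · exact (hdecay j hlt).trans (mul_le_of_le_one_left hmean.le hθ1)
  have hfirst : gaussE σ (relDev (l + 1) q ^ 8) ≤ 9 ^ (458 * d) * (8 / κ ^ 2) ^ 4 := by
    refine (gaussE_relDev_pow_le hd hq hθ hθd hdecay).1.trans ?_
    gcongr <;> norm_num
  have hsecond : (8 / (κ ^ 2 * meanDerivSq (l + 1) q)) ^ 4 * gaussE σ (devSq l q ^ 4)
      ≤ 9 ^ (458 * d) * (8 / κ ^ 2) ^ 4 := by
    calc (8 / (κ ^ 2 * meanDerivSq (l + 1) q)) ^ 4 * gaussE σ (devSq l q ^ 4)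
        ≤ (8 / (κ ^ 2 * meanDerivSq (l + 1) q)) ^ 4 *
            (9 ^ (4 * d) * (9 ^ d * meanDerivSq (l + 1) q) ^ 4) := by
          gcongr
          refine (gaussE_devSq_pow_four_le l hq).trans ?_
          gcongr
          exact hdev.trans (mul_le_mul_of_nonneg_right (natCast_le_nine_pow d) hmean.le)
      _ = 9 ^ (4 * d) * 9 ^ (4 * d) * (8 / κ ^ 2) ^ 4 := by
        field_simp
        ring
      _ ≤ 9 ^ (458 * d) * (8 / κ ^ 2) ^ 4 := by
        rw [← pow_add]
        gcongr <;> [norm_num; omega]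
  rw [growthError, map_add, gaussE_C_mul, gaussE_C_mul]
  linarith

theorem MatchesGaussian.abs_integral_truncSign_sub_le_of_growth (hs : IsSignLike s) (hd : 0 < d)
    [IsProbabilityMeasure ν] (hν : MatchesGaussian (128 * d) ν) (hq : q.totalDegree ≤ d)
    (hκ : 0 < κ) (hθd : d * (8 / κ ^ 2) ≤ 1) (hl : l < d)
    (hgrowth : 8 / κ ^ 2 * meanDerivSq l q < meanDerivSq (l + 1) q)
    (hdecay : ∀ j, l < j → meanDerivSq (j + 1) q ≤ 8 / κ ^ 2 * meanDerivSq j q) :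
    |∫ x, truncSign s d κ q x ∂ν - ∫ x, truncSign s d κ q x ∂(stdGauss σ)|
      ≤ 9 ^ 44 * (9 ^ (458 * d) * (8 / κ ^ 2) ^ 4) := by
  have hmean : 0 < meanDerivSq (l + 1) q :=
    (mul_nonneg (by positivity) (meanDerivSq_nonneg l q)).trans_lt hgrowth
  have hgrowth_mul : 8 * meanDerivSq l q ≤ κ ^ 2 * meanDerivSq (l + 1) q := by
    rw [div_mul_eq_mul_div, div_lt_iff₀ (by positivity)] at hgrowth
    linarith
  have hclose : ∀ x, |truncSign s d κ q x - eval x (0 : MvPolynomial σ ℝ)|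
      ≤ eval x (growthError κ l q) := by
    intro x
    rw [map_zero, sub_zero]
    rcases le_or_gt (1 / 2) (gradRatio κ q l x) with hlarge | hsmall
    · rw [truncSign, gradCutoff_eq_zero hl hlarge, mul_zero, abs_zero]
      exact eval_growthError_nonneg κ l q x
    · exact (abs_truncSign_le_one hs d κ q x).trans
        (one_le_eval_growthError hκ hgrowth_mul hmean hsmall)
  refine (hν.abs_integral_sub_le (measurable_truncSign hs d κ q) (abs_truncSign_le_one hs d κ q)
    (by simp) (totalDegree_growthError_le κ l hq)
    fun ν' _ => Filter.Eventually.of_forall hclose).trans ?_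
  have herror := gaussE_growthError_le hd hq hκ hθd hmean fun j =>
    meanDerivSq_le_of_decay (mul_le_of_natCast_mul_le_one hd (by positivity) hθd) hdecay le_rfl
  linarith [show 0 ≤ 9 ^ (458 * d) * (8 / κ ^ 2) ^ 4 by positivity]

theorem forall_or_exists_last_not {P : ℕ → Prop} {d : ℕ} (h : ∀ j, d ≤ j → P j) :
    (∀ j, P j) ∨ ∃ l < d, ¬ P l ∧ ∀ j, l < j → P j := by
  induction d with
  | zero => exact Or.inl fun j => h j (Nat.zero_le j)
  | succ d ih =>
    by_cases hPd : P d
    · refine (ih fun j hj => hj.eq_or_lt.elim (fun hdj => hdj ▸ hPd) (h j)).imp_right ?_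
      rintro ⟨l, hl, hPl⟩
      exact ⟨l, hl.trans d.lt_succ_self, hPl⟩
    · exact Or.inr ⟨d, d.lt_succ_self, hPd, h⟩

theorem MatchesGaussian.abs_integral_truncSign_sub_le {K : ℝ}
    (hK : HasTaylorBound smoothCutoff K) (hs : IsSignLike s) (hd : 0 < d) [IsProbabilityMeasure ν]
    (hν : MatchesGaussian (128 * d) ν) (hq : q.totalDegree ≤ d) (hκ : 0 < κ) :
    |∫ x, truncSign s d κ q x ∂ν - ∫ x, truncSign s d κ q x ∂(stdGauss σ)|
      ≤ 9 ^ 44 * K * (9 ^ (458 * d) * (8 / κ ^ 2) ^ 4) := by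
  have hθ : 0 ≤ 8 / κ ^ 2 := by positivity
  have hlarge : (9 : ℝ) ^ 44 ≤ 9 ^ 44 * K := le_mul_of_one_le_right (by positivity) hK.one_le
  rcases le_or_gt (d * (8 / κ ^ 2)) 1 with hθd | hθd
  · have htail : ∀ j, d ≤ j → meanDerivSq (j + 1) q ≤ 8 / κ ^ 2 * meanDerivSq j q := fun j hj => by
      rw [meanDerivSq_eq_zero hq (Nat.lt_succ_of_le hj)]
      exact mul_nonneg hθ (meanDerivSq_nonneg j q)
    rcases forall_or_exists_last_not htail with hdecay | ⟨l, hl, hgrowth, hdecay⟩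
    · exact hν.abs_integral_truncSign_sub_le_of_decay hK hs hd hq κ hθ hθd hdecay
    · exact (hν.abs_integral_truncSign_sub_le_of_growth hs hd hq hκ hθd hl (not_le.1 hgrowth)
        hdecay).trans (by gcongr)
  · have hone : 1 ≤ 9 ^ d * (8 / κ ^ 2) :=
      hθd.le.trans (mul_le_mul_of_nonneg_right (natCast_le_nine_pow d) hθ)
    have hone_pow : 1 ≤ 9 ^ (458 * d) * (8 / κ ^ 2) ^ 4 :=
      calc (1 : ℝ) ≤ (9 ^ d * (8 / κ ^ 2)) ^ 4 := one_le_pow₀ hone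
        _ = 9 ^ (4 * d) * (8 / κ ^ 2) ^ 4 := by rw [mul_pow, ← pow_mul, mul_comm d 4]
        _ ≤ 9 ^ (458 * d) * (8 / κ ^ 2) ^ 4 := by gcongr <;> norm_num
    calc |∫ x, truncSign s d κ q x ∂ν - ∫ x, truncSign s d κ q x ∂(stdGauss σ)|
        ≤ 2 * 1 := by
          rw [mul_one]
          exact abs_integral_sub_integral_le_two (abs_truncSign_le_one hs d κ q)
            (abs_truncSign_le_one hs d κ q)
      _ ≤ 9 ^ 44 * K * (9 ^ (458 * d) * (8 / κ ^ 2) ^ 4) := by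
        gcongr
        exact le_trans (by norm_num) hlarge

theorem exists_forall_abs_integral_truncSign_sub_le : ∃ D : ℝ, 1 ≤ D ∧
    ∀ {σ : Type*} [Fintype σ] {s : ℝ → ℝ} (_ : IsSignLike s) {d : ℕ} (_ : 0 < d)
      {ν : Measure (σ → ℝ)} [IsProbabilityMeasure ν] (_ : MatchesGaussian (128 * d) ν)
      {q : MvPolynomial σ ℝ} (_ : q.totalDegree ≤ d) {κ : ℝ} (_ : 0 < κ),
      |∫ x, truncSign s d κ q x ∂ν - ∫ x, truncSign s d κ q x ∂(stdGauss σ)| ≤ D ^ d / κ ^ 8 := by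
  obtain ⟨K, hK⟩ := exists_hasTaylorBound_smoothCutoff
  have hconst : 1 ≤ 9 ^ 44 * K * 8 ^ 4 := by linarith [hK.one_le]
  refine ⟨9 ^ 44 * K * 8 ^ 4 * 9 ^ 458,
    one_le_mul_of_one_le_of_one_le hconst (one_le_pow₀ (by norm_num)), ?_⟩
  intro σ _ s hs d hd ν _ hν q hq κ hκ
  calc |∫ x, truncSign s d κ q x ∂ν - ∫ x, truncSign s d κ q x ∂(stdGauss σ)|
      ≤ 9 ^ 44 * K * (9 ^ (458 * d) * (8 / κ ^ 2) ^ 4) :=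
        hν.abs_integral_truncSign_sub_le hK hs hd hq hκ
    _ = 9 ^ 44 * K * 8 ^ 4 * 9 ^ (458 * d) / κ ^ 8 := by ring
    _ ≤ (9 ^ 44 * K * 8 ^ 4) ^ d * 9 ^ (458 * d) / κ ^ 8 := by
      gcongr
      exact le_self_pow₀ hconst hd.ne'
    _ = (9 ^ 44 * K * 8 ^ 4 * 9 ^ 458) ^ d / κ ^ 8 := by rw [mul_pow _ (9 ^ 458), ← pow_mul]

end LocalBound

section AffineSubstitution

open MvPolynomial

section Substitution

variable {σ R : Type*} [CommSemiring R]

/-- The polynomial `x ↦ p (v + a • x)`. -/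
noncomputable def affineSubst (v : σ → R) (a : R) : MvPolynomial σ R →ₐ[R] MvPolynomial σ R :=
  aeval fun i => C (v i) + C a * X i

theorem affineSubst_X (v : σ → R) (a : R) (i : σ) :
    affineSubst v a (X i) = C (v i) + C a * X i :=
  aeval_X _ i

theorem eval_affineSubst (v : σ → R) (a : R) (p : MvPolynomial σ R) (x : σ → R) :
    eval x (affineSubst v a p) = eval (v + a • x) p := by
  induction p using MvPolynomial.induction_on with
  | C b => rw [affineSubst, aeval_C, algebraMap_eq, eval_C, eval_C]
  | add p q hp hq => rw [map_add, map_add, map_add, hp, hq]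
  | mul_X p i hp => simp [hp, affineSubst_X]

theorem totalDegree_affineSubst_le (v : σ → R) (a : R) (p : MvPolynomial σ R) :
    (affineSubst v a p).totalDegree ≤ p.totalDegree := by
  rw [affineSubst, aeval_def, eval₂_eq]
  refine totalDegree_finsetSum_le fun α hα => totalDegree_C_mul_le ?_ _
  have hlinear : ∀ i, (C (v i) + C a * X i).totalDegree ≤ 1 := fun i =>
    totalDegree_add_le_of_le (by simp)
      (totalDegree_C_mul_le ((totalDegree_monomial_le _ _).trans (by simp)) a)
  calc (∏ i ∈ α.support, (C (v i) + C a * X i) ^ α i).totalDegree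
      ≤ ∑ i ∈ α.support, ((C (v i) + C a * X i) ^ α i).totalDegree := totalDegree_finsetProd _ _
    _ ≤ ∑ i ∈ α.support, α i := by
      gcongr with i
      exact totalDegree_pow_le_of_le (hlinear i) (mul_one _).le
    _ ≤ p.totalDegree := le_totalDegree hα

theorem pderiv_affineSubst (v : σ → R) (a : R) (p : MvPolynomial σ R) (i : σ) :
    pderiv i (affineSubst v a p) = C a * affineSubst v a (pderiv i p) := by
  classical
  induction p using MvPolynomial.induction_on with
  | C b => rw [pderiv_C, map_zero, mul_zero, affineSubst, aeval_C, algebraMap_eq, pderiv_C]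
  | add p q hp hq => rw [map_add, map_add, hp, hq, map_add, map_add, mul_add]
  | mul_X p j hp =>
    simp only [map_mul, pderiv_mul, hp, affineSubst_X, map_add, pderiv_C, pderiv_X, zero_mul,
      zero_add, Pi.single_apply]
    split_ifs <;> simp <;> ring

end Substitution

variable {σ : Type*} [Fintype σ]

theorem gradSq_C_mul (l : ℕ) (a : ℝ) (q : MvPolynomial σ ℝ) :
    gradSq l (C a * q) = C (a ^ 2) * gradSq l q := by
  induction l generalizing q with
  | zero => rw [gradSq, gradSq, mul_pow, C_pow]
  | succ l ih => simp only [gradSq, pderiv_C_mul, ih, Finset.mul_sum]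

theorem eval_gradSq_affineSubst (v : σ → ℝ) (a : ℝ) (l : ℕ) (p : MvPolynomial σ ℝ) (x : σ → ℝ) :
    eval x (gradSq l (affineSubst v a p)) = a ^ (2 * l) * eval (v + a • x) (gradSq l p) := by
  induction l generalizing p with
  | zero => simp [gradSq, eval_affineSubst]
  | succ l ih =>
    simp only [gradSq, pderiv_affineSubst, gradSq_C_mul, map_sum, map_mul, ih, Finset.mul_sum,
      eval_C]
    exact Finset.sum_congr rfl fun i _ => by ring

theorem stepRatio_mul_left {c : ℝ} (hc : c ≠ 0) (κ η a b : ℝ) :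
    stepRatio κ (c * a) (c * η ^ 2 * b) = stepRatio (κ * η) a b := by
  rw [stepRatio, stepRatio, ← mul_div_mul_left ((κ * η) ^ 2 * b) _ hc]
  congr 1 <;> ring

theorem truncSign_affineSubst (s : ℝ → ℝ) (d : ℕ) (κ : ℝ) (v : σ → ℝ) {a : ℝ} (ha : a ≠ 0)
    (p : MvPolynomial σ ℝ) (x : σ → ℝ) :
    truncSign s d κ (affineSubst v a p) x = truncSign s d (κ * a) p (v + a • x) := by
  have hratio : ∀ l, gradRatio κ (affineSubst v a p) l x = gradRatio (κ * a) p l (v + a • x) :=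
    fun l => by
      rw [gradRatio, gradRatio, eval_gradSq_affineSubst, eval_gradSq_affineSubst, Nat.mul_succ,
        pow_add, stepRatio_mul_left (pow_ne_zero _ ha)]
  simp only [truncSign, gradCutoff, eval_affineSubst, hratio]

end AffineSubstitution

section Lindeberg

theorem map_smul_stdGauss_conv {σ : Type*} [Fintype σ] (a b : ℝ) :
    (stdGauss σ).map (a • ·) ∗ (stdGauss σ).map (b • ·) =
      (stdGauss σ).map (√(a ^ 2 + b ^ 2) • ·) := by
  set w : ℂ := ⟨a, b⟩
  have hw : ‖w‖ = √(a ^ 2 + b ^ 2) := Complex.norm_eq_sqrt_sq_add_sq w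
  have hrotation : ∀ z : (σ → ℝ) × (σ → ℝ), a • z.1 + b • z.2 =
      √(a ^ 2 + b ^ 2) • (ContinuousLinearMap.rotation w.arg z).1 := fun z => by
    rw [ContinuousLinearMap.rotation_apply, smul_add, smul_smul, smul_smul, ← hw,
      Complex.norm_mul_cos_arg, Complex.norm_mul_sin_arg]
  have hsmul : ∀ c : ℝ, Measurable fun x : σ → ℝ => c • x := fun c => by fun_prop
  rw [Measure.conv, Measure.map_prod_map _ _ (hsmul a) (hsmul b),
    Measure.map_map (by fun_prop) ((hsmul a).prodMap (hsmul b))]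
  calc ((stdGauss σ).prod (stdGauss σ)).map
        ((fun z : (σ → ℝ) × (σ → ℝ) => z.1 + z.2) ∘ Prod.map (a • ·) (b • ·))
      = ((stdGauss σ).prod (stdGauss σ)).map
        ((√(a ^ 2 + b ^ 2) • ·) ∘ Prod.fst ∘ ContinuousLinearMap.rotation w.arg) :=
        congrArg (Measure.map · _) (funext hrotation)
    _ = (stdGauss σ).map (√(a ^ 2 + b ^ 2) • ·) := by
      rw [← Measure.map_map (hsmul _) (by fun_prop), ← Measure.map_map measurable_fst (by fun_prop),
        map_rotation_stdGauss, Measure.map_fst_prod, measure_univ, one_smul]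

section Convolution

variable {E : Type*} [AddCommMonoid E] [MeasurableSpace E] [MeasurableAdd₂ E] {F : E → ℝ}
  {P P' Q Q' : Measure E} [IsProbabilityMeasure P] [IsProbabilityMeasure P']
  [IsProbabilityMeasure Q] [IsProbabilityMeasure Q'] {δ δ' : ℝ}

theorem abs_integral_conv_left_sub_le (hF : Measurable F) (hF1 : ∀ x, |F x| ≤ 1)
    (h : ∀ v, |∫ x, F (v + x) ∂Q - ∫ x, F (v + x) ∂Q'| ≤ δ) (v : E) :
    |∫ x, F (v + x) ∂(P ∗ Q) - ∫ x, F (v + x) ∂(P ∗ Q')| ≤ δ := by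
  have hFv : Measurable fun x => F (v + x) := by fun_prop
  have hint : ∀ (ν : Measure E) [IsProbabilityMeasure ν],
      Integrable (fun z : E × E => F (v + (z.1 + z.2))) (P.prod ν) := fun ν _ =>
    integrable_of_abs_le_one (by fun_prop) fun _ => hF1 _
  rw [integral_conv (integrable_of_abs_le_one hFv fun _ => hF1 _),
    integral_conv (integrable_of_abs_le_one hFv fun _ => hF1 _),
    ← integral_sub (hint Q).integral_prod_left (hint Q').integral_prod_left]
  simpa using norm_integral_le_of_norm_le_const (μ := P)
    (f := fun x => ∫ y, F (v + (x + y)) ∂Q - ∫ y, F (v + (x + y)) ∂Q')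
    (Filter.Eventually.of_forall fun x => by
      simpa only [add_assoc, Real.norm_eq_abs] using h (v + x))

theorem abs_integral_conv_sub_le (hF : Measurable F) (hF1 : ∀ x, |F x| ≤ 1)
    (hP : ∀ v, |∫ x, F (v + x) ∂P - ∫ x, F (v + x) ∂P'| ≤ δ)
    (hQ : ∀ v, |∫ x, F (v + x) ∂Q - ∫ x, F (v + x) ∂Q'| ≤ δ') (v : E) :
    |∫ x, F (v + x) ∂(P ∗ Q) - ∫ x, F (v + x) ∂(P' ∗ Q')| ≤ δ + δ' := by
  have hright := abs_integral_conv_left_sub_le (P := P') hF hF1 hQ v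
  have hleft := abs_integral_conv_left_sub_le (P := Q) hF hF1 hP v
  rw [Measure.conv_comm Q P, Measure.conv_comm Q P'] at hleft
  exact (abs_sub_le _ _ _).trans (add_le_add hleft hright)

end Convolution

variable {σ : Type*} [Fintype σ]

theorem abs_integral_map_sum_sub_le {Ω ι : Type*} [MeasurableSpace Ω] {μ : Measure Ω}
    [IsProbabilityMeasure μ] {X : ι → Ω → σ → ℝ} (hX : ∀ i, AEMeasurable (X i) μ)
    (hind : iIndepFun X μ) {F : (σ → ℝ) → ℝ} (hF : Measurable F) (hF1 : ∀ x, |F x| ≤ 1) {δ : ℝ}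
    (hδ : ∀ i v, |∫ x, F (v + x) ∂(μ.map (X i)) - ∫ x, F (v + x) ∂(stdGauss σ)| ≤ δ)
    (s : Finset ι) (v : σ → ℝ) :
    |∫ x, F (v + x) ∂(μ.map (∑ i ∈ s, X i))
      - ∫ x, F (v + x) ∂((stdGauss σ).map (√s.card • ·))| ≤ s.card * δ := by
  classical
  induction s using Finset.induction_on generalizing v with
  | empty => rw [Finset.sum_empty, Pi.zero_def, Measure.map_const]; simp
  | insert j s hj ih =>
    have hsum : AEMeasurable (∑ i ∈ s, X i) μ := Finset.aemeasurable_sum s fun i _ => hX i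
    have := Measure.isProbabilityMeasure_map hsum
    have := Measure.isProbabilityMeasure_map (hX j)
    have hsmul : Measurable fun x : σ → ℝ => √s.card • x := by fun_prop
    have := Measure.isProbabilityMeasure_map (μ := stdGauss σ) hsmul.aemeasurable
    have hlaw : μ.map (∑ i ∈ insert j s, X i) = μ.map (X j) ∗ μ.map (∑ i ∈ s, X i) := by
      rw [Finset.sum_insert hj]
      exact (hind.indepFun_finsetSum_of_notMem₀ hX hj).symm.map_add_eq_map_conv_map₀ (hX j) hsum
    have hgauss : (stdGauss σ).map (√(insert j s).card • ·) =
        stdGauss σ ∗ (stdGauss σ).map (√s.card • ·) := by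
      have hconv := map_smul_stdGauss_conv (σ := σ) 1 √s.card
      simp only [one_smul, Measure.map_id'] at hconv
      rw [hconv, one_pow, Real.sq_sqrt (Nat.cast_nonneg _), Finset.card_insert_of_notMem hj,
        Nat.cast_succ, add_comm (1 : ℝ)]
    rw [hlaw, hgauss, Finset.card_insert_of_notMem hj, Nat.cast_succ, add_one_mul, add_comm _ δ]
    exact abs_integral_conv_sub_le hF hF1 (hδ j) ih v

end Lindeberg

section ThresholdComparison

open MvPolynomial

section Cutoff

variable {σ : Type*} [Fintype σ] {d : ℕ} {q : MvPolynomial σ ℝ} {κ : ℝ}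

theorem stepRatio_le {a b : ℝ} (ha : 0 ≤ a) (hb : 0 ≤ b) (hd : 0 < d)
    (h : (2 * d * κ) ^ 2 * b ≤ a) : stepRatio κ a b ≤ 1 / (4 * d) := by
  have hd1 : (1 : ℝ) ≤ d := by exact_mod_cast hd
  have hκb : 0 ≤ κ ^ 2 * b := by positivity
  refine div_le_of_le_mul₀ (by positivity) (by positivity) ?_
  rw [one_div, inv_mul_eq_div, le_div_iff₀ (by positivity)]
  have hsq : (d : ℝ) * (κ ^ 2 * b) ≤ d ^ 2 * (κ ^ 2 * b) := by
    gcongr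
    exact le_self_pow₀ hd1 two_ne_zero
  linarith

theorem gradCutoff_eq_one (hd : 0 < d) {x : σ → ℝ}
    (h : ∀ l < d, (2 * d * κ) ^ 2 * eval x (gradSq (l + 1) q) ≤ eval x (gradSq l q)) :
    gradCutoff d κ q x = 1 := by
  refine smoothCutoff_eq_one ?_
  calc ∑ l ∈ Finset.range d, gradRatio κ q l x ≤ ∑ l ∈ Finset.range d, 1 / (4 * d : ℝ) :=
        Finset.sum_le_sum fun l hl => stepRatio_le (eval_gradSq_nonneg l q x)
          (eval_gradSq_nonneg (l + 1) q x) hd (h l (Finset.mem_range.1 hl))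
    _ = 1 / 4 := by
      rw [Finset.sum_const, Finset.card_range, nsmul_eq_mul]
      field_simp

theorem stdGauss_gradCutoff_ne_one_le (hd : 0 < d) (hκ : 0 < κ) (hq : q.totalDegree ≤ d) :
    stdGauss σ {x | gradCutoff d κ q x ≠ 1} ≤ ENNReal.ofReal (15552 * d ^ 4 * κ) := by
  have hsubset : {x | gradCutoff d κ q x ≠ 1} ⊆ ⋃ l ∈ Finset.range d,
      {x | eval x (gradSq l q) < (2 * d * κ) ^ 2 * eval x (gradSq (l + 1) q)} := by
    intro x hx
    by_contra hnot
    refine hx (gradCutoff_eq_one hd fun l hl => not_lt.1 fun hlt => hnot ?_)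
    exact Set.mem_biUnion (Finset.mem_coe.2 (Finset.mem_range.2 hl)) hlt
  calc stdGauss σ {x | gradCutoff d κ q x ≠ 1}
      ≤ ∑ l ∈ Finset.range d, stdGauss σ
          {x | eval x (gradSq l q) < (2 * d * κ) ^ 2 * eval x (gradSq (l + 1) q)} :=
        (measure_mono hsubset).trans (measure_biUnion_finset_le _ _)
    _ ≤ ∑ l ∈ Finset.range d, ENNReal.ofReal (7776 * d ^ 2 * (2 * d * κ)) :=
        Finset.sum_le_sum fun l _ => stdGauss_gradSq_lt_le hd (by positivity) l hq
    _ = ENNReal.ofReal (15552 * d ^ 4 * κ) := by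
      rw [Finset.sum_const, Finset.card_range, nsmul_eq_mul, ← ENNReal.ofReal_natCast,
        ← ENNReal.ofReal_mul (Nat.cast_nonneg d)]
      congr 1
      ring

theorem one_sub_integral_gradCutoff_le (hd : 0 < d) (hκ : 0 < κ) (hq : q.totalDegree ≤ d) :
    1 - ∫ x, gradCutoff d κ q x ∂(stdGauss σ) ≤ 15552 * d ^ 4 * κ := by
  set U : Set (σ → ℝ) := {x | gradCutoff d κ q x ≠ 1}
  have hU : MeasurableSet U :=
    (measurable_gradCutoff d κ q (measurableSet_singleton 1)).compl
  have hindicator : ∀ x, 1 - U.indicator 1 x ≤ gradCutoff d κ q x := by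
    intro x
    by_cases hx : x ∈ U
    · simpa [hx, gradCutoff] using smoothCutoff_nonneg _
    · simpa [hx] using (not_not.1 hx).ge
  have hint : Integrable (U.indicator (1 : (σ → ℝ) → ℝ)) (stdGauss σ) :=
    (integrable_const (1 : ℝ)).indicator hU
  have hmono : ∫ x, (1 - U.indicator (1 : (σ → ℝ) → ℝ) x) ∂(stdGauss σ)
      ≤ ∫ x, gradCutoff d κ q x ∂(stdGauss σ) :=
    integral_mono ((integrable_const 1).sub hint)
      (integrable_of_abs_le_one (measurable_gradCutoff d κ q) (abs_gradCutoff_le_one d κ q))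
      hindicator
  rw [integral_sub (integrable_const 1) hint, integral_indicator_one hU, integral_const,
    probReal_univ, one_smul] at hmono
  have hmeasure : (stdGauss σ).real U ≤ 15552 * d ^ 4 * κ :=
    ENNReal.toReal_le_of_le_ofReal (by positivity) (stdGauss_gradCutoff_ne_one_le hd hκ hq)
  linarith

end Cutoff

section Comparison

variable {α : Type*} [MeasurableSpace α] {P Q : Measure α} [IsProbabilityMeasure P]
  [IsProbabilityMeasure Q] {f G : α → ℝ}

theorem abs_integral_sub_integral_mul_le (hf : Measurable f) (hf1 : ∀ x, |f x| ≤ 1)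
    (hG : Measurable G) (hG1 : ∀ x, |G x| ≤ 1) :
    |∫ x, f x ∂P - ∫ x, f x * G x ∂P| ≤ 1 - ∫ x, G x ∂P := by
  have hf_int : Integrable f P := integrable_of_abs_le_one hf hf1
  have hG_int : Integrable G P := integrable_of_abs_le_one hG hG1
  have hfG_int : Integrable (fun x => f x * G x) P :=
    integrable_of_abs_le_one (hf.mul hG) fun x => by
      rw [abs_mul]
      exact mul_le_one₀ (hf1 x) (abs_nonneg _) (hG1 x)
  have hpointwise : ∀ x, |f x - f x * G x| ≤ 1 - G x := fun x => by
    have hG_le : 0 ≤ 1 - G x := sub_nonneg.2 (abs_le.1 (hG1 x)).2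
    rw [← mul_one_sub, abs_mul, abs_of_nonneg hG_le]
    exact mul_le_of_le_one_left hG_le (hf1 x)
  calc |∫ x, f x ∂P - ∫ x, f x * G x ∂P| ≤ ∫ x, |f x - f x * G x| ∂P := by
        rw [← integral_sub hf_int hfG_int]
        exact abs_integral_le_integral_abs
    _ ≤ ∫ x, (1 - G x) ∂P :=
        integral_mono (hf_int.sub hfG_int).abs ((integrable_const 1).sub hG_int) hpointwise
    _ = 1 - ∫ x, G x ∂P := by rw [integral_sub (integrable_const 1) hG_int]; simp

theorem abs_integral_sub_integral_le_of_cutoff (hf : Measurable f) (hf1 : ∀ x, |f x| ≤ 1)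
    (hG : Measurable G) (hG1 : ∀ x, |G x| ≤ 1) {a b : ℝ}
    (hfG : |∫ x, f x * G x ∂P - ∫ x, f x * G x ∂Q| ≤ a) (hPQ : |∫ x, G x ∂P - ∫ x, G x ∂Q| ≤ a)
    (hQ : 1 - ∫ x, G x ∂Q ≤ b) : |∫ x, f x ∂P - ∫ x, f x ∂Q| ≤ 2 * a + 2 * b := by
  have hP_cut := abs_integral_sub_integral_mul_le (P := P) hf hf1 hG hG1
  have hQ_cut := abs_integral_sub_integral_mul_le (P := Q) hf hf1 hG hG1
  rw [abs_le] at *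
  constructor <;> linarith

end Comparison

theorem aemeasurable_smul_sum {Ω ι σ : Type*} [MeasurableSpace Ω] [Fintype ι] {μ : Measure Ω}
    {X : ι → Ω → σ → ℝ} (hX : ∀ i, AEMeasurable (X i) μ) (a : ℝ) :
    AEMeasurable (fun ω => a • ∑ i, X i ω) μ :=
  (Finset.aemeasurable_fun_sum Finset.univ fun i _ => hX i).const_smul a

theorem abs_integral_map_normalizedSum_sub_le {Ω ι σ : Type*} [MeasurableSpace Ω] [Fintype ι]
    [Nonempty ι] [Fintype σ] {μ : Measure Ω} [IsProbabilityMeasure μ] {X : ι → Ω → σ → ℝ}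
    (hX : ∀ i, AEMeasurable (X i) μ) (hind : iIndepFun X μ) {F : (σ → ℝ) → ℝ}
    (hF : Measurable F) (hF1 : ∀ x, |F x| ≤ 1) {δ : ℝ}
    (hδ : ∀ i v, |∫ x, F (v + (1 / √(Fintype.card ι : ℝ)) • x) ∂(μ.map (X i))
      - ∫ x, F (v + (1 / √(Fintype.card ι : ℝ)) • x) ∂(stdGauss σ)| ≤ δ) :
    |∫ x, F x ∂(μ.map fun ω => (1 / √(Fintype.card ι : ℝ)) • ∑ i, X i ω)
      - ∫ x, F x ∂(stdGauss σ)| ≤ Fintype.card ι * δ := by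
  set r : ℝ := √(Fintype.card ι : ℝ)
  have hr : r ≠ 0 := (Real.sqrt_pos.2 (by exact_mod_cast Fintype.card_pos)).ne'
  have hFr : Measurable fun x : σ → ℝ => F ((1 / r) • x) := by fun_prop
  have hsum : AEMeasurable (∑ i, X i) μ := Finset.aemeasurable_sum _ fun i _ => hX i
  have hsum_map : ∫ x, F x ∂(μ.map fun ω => (1 / r) • ∑ i, X i ω)
      = ∫ x, F ((1 / r) • x) ∂(μ.map (∑ i, X i)) := by
    rw [integral_map (aemeasurable_smul_sum hX _) hF.aestronglyMeasurable,
      integral_map hsum hFr.aestronglyMeasurable]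
    simp only [Finset.sum_apply]
  have hgauss_map : ∫ x, F ((1 / r) • x) ∂((stdGauss σ).map (r • ·))
      = ∫ x, F x ∂(stdGauss σ) := by
    rw [integral_map (by fun_prop) hFr.aestronglyMeasurable]
    simp only [smul_smul, one_div_mul_cancel hr, one_smul]
  have hlindeberg := abs_integral_map_sum_sub_le hX hind hFr (fun x => hF1 _) (δ := δ)
    (fun i v => by simpa only [smul_add] using hδ i ((1 / r) • v)) Finset.univ 0
  simpa only [zero_add, Finset.card_univ, hsum_map, ← hgauss_map] using hlindeberg

theorem exists_forall_abs_integral_truncSign_map_normalizedSum_sub_le : ∃ D : ℝ, 1 ≤ D ∧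
    ∀ {Ω ι σ : Type*} [MeasurableSpace Ω] [Fintype ι] [Nonempty ι] [Fintype σ] {μ : Measure Ω}
      [IsProbabilityMeasure μ] {X : ι → Ω → σ → ℝ} (_ : ∀ i, AEMeasurable (X i) μ) {d : ℕ}
      (_ : 0 < d) (_ : ∀ i, MatchesGaussian (128 * d) (μ.map (X i))) (_ : iIndepFun X μ)
      {q : MvPolynomial σ ℝ} (_ : q.totalDegree ≤ d) {κ : ℝ} (_ : 0 < κ) {s : ℝ → ℝ}
      (_ : IsSignLike s),
      |∫ x, truncSign s d κ q x ∂(μ.map fun ω => (1 / √(Fintype.card ι : ℝ)) • ∑ i, X i ω)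
        - ∫ x, truncSign s d κ q x ∂(stdGauss σ)| ≤ D ^ d / (κ ^ 8 * Fintype.card ι ^ 3) := by
  obtain ⟨D, hD1, hD⟩ := exists_forall_abs_integral_truncSign_sub_le
  refine ⟨D, hD1, ?_⟩
  intro Ω ι σ _ _ _ _ μ _ X hX d hd hmatch hind q hq κ hκ s hs
  have hcard : (0 : ℝ) < Fintype.card ι := by exact_mod_cast Fintype.card_pos
  set r : ℝ := √(Fintype.card ι : ℝ)
  have hr : 0 < r := Real.sqrt_pos.2 hcard
  have hstep : ∀ i v, |∫ x, truncSign s d κ q (v + (1 / r) • x) ∂(μ.map (X i))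
      - ∫ x, truncSign s d κ q (v + (1 / r) • x) ∂(stdGauss σ)| ≤ D ^ d / (κ * r) ^ 8 := by
    intro i v
    have := Measure.isProbabilityMeasure_map (hX i)
    simpa only [truncSign_affineSubst s d _ _ (one_div_ne_zero hr.ne'), mul_assoc κ,
      mul_one_div_cancel hr.ne', mul_one] using hD hs hd (hmatch i)
        ((totalDegree_affineSubst_le v (1 / r) q).trans hq) (mul_pos hκ hr)
  refine (abs_integral_map_normalizedSum_sub_le hX hind (measurable_truncSign hs d κ q)
    (abs_truncSign_le_one hs d κ q) hstep).trans_eq ?_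
  have hr8 : r ^ 8 = (Fintype.card ι : ℝ) ^ 4 := by
    rw [show r ^ 8 = (r ^ 2) ^ 4 by ring, Real.sq_sqrt hcard.le]
  rw [mul_pow, hr8]
  field_simp

theorem exists_forall_abs_integral_sign_map_normalizedSum_sub_le : ∃ D : ℝ, 1 ≤ D ∧
    ∀ {Ω ι σ : Type*} [MeasurableSpace Ω] [Fintype ι] [Nonempty ι] [Fintype σ] {μ : Measure Ω}
      [IsProbabilityMeasure μ] {X : ι → Ω → σ → ℝ} (_ : ∀ i, AEMeasurable (X i) μ) {d : ℕ}
      (_ : 0 < d) (_ : ∀ i, MatchesGaussian (128 * d) (μ.map (X i))) (_ : iIndepFun X μ)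
      {q : MvPolynomial σ ℝ} (_ : q.totalDegree ≤ d) {κ : ℝ} (_ : 0 < κ),
      |∫ x, Real.sign (eval x q) ∂(μ.map fun ω => (1 / √(Fintype.card ι : ℝ)) • ∑ i, X i ω)
        - ∫ x, Real.sign (eval x q) ∂(stdGauss σ)|
      ≤ 2 * (D ^ d / (κ ^ 8 * Fintype.card ι ^ 3)) + 2 * (15552 * d ^ 4 * κ) := by
  obtain ⟨D, hD1, hD⟩ := exists_forall_abs_integral_truncSign_map_normalizedSum_sub_le
  refine ⟨D, hD1, ?_⟩
  intro Ω ι σ _ _ _ _ μ _ X hX d hd hmatch hind q hq κ hκ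
  have : IsProbabilityMeasure
      (μ.map fun ω => (1 / √(Fintype.card ι : ℝ)) • ∑ i, X i ω) :=
    Measure.isProbabilityMeasure_map (aemeasurable_smul_sum hX _)
  have htrunc {s : ℝ → ℝ} (hs : IsSignLike s) := hD hX hd hmatch hind hq hκ hs
  refine abs_integral_sub_integral_le_of_cutoff (isSignLike_sign.measurable.comp
    (measurable_eval_comp q measurable_id)) (fun _ => isSignLike_sign.abs_le_one _)
    (measurable_gradCutoff d κ q) (abs_gradCutoff_le_one d κ q) (htrunc isSignLike_sign) ?_
    (one_sub_integral_gradCutoff_le hd hκ hq)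
  simpa only [truncSign, one_mul] using htrunc isSignLike_one

theorem mul_natCast_pow_four_le {d : ℕ} (hd : 0 < d) :
    131072 * (d : ℝ) ^ 4 ≤ (131072 * 9 ^ 4) ^ d :=
  calc 131072 * (d : ℝ) ^ 4 ≤ 131072 ^ d * (9 ^ d) ^ 4 := by
        gcongr
        · exact le_self_pow₀ (by norm_num) hd.ne'
        · exact natCast_le_nine_pow d
    _ = (131072 * 9 ^ 4) ^ d := by rw [mul_pow, ← pow_mul, ← pow_mul, mul_comm d 4]

theorem lindeberg_error_lt {D M ε N : ℝ} {d : ℕ} (hd : 0 < d) (hD : 1 ≤ D) (hM : 1 ≤ M)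
    (hε : 0 < ε) (hN : 0 < N) (h : (5 * D * M ^ 8) ^ d ≤ N * ε ^ 3) :
    2 * (D ^ d / ((ε / M ^ d) ^ 8 * N ^ 3)) < ε / 2 := by
  have hbase : 1 ≤ 5 * D * M ^ 8 := by
    have : 1 ≤ M ^ 8 := one_le_pow₀ hM
    nlinarith
  have hfive : (5 : ℝ) ≤ 5 ^ d := le_self_pow₀ (by norm_num) hd.ne'
  have hcube : 4 * (D ^ d * (M ^ d) ^ 8) < (N * ε ^ 3) ^ 3 := by
    calc 4 * (D ^ d * (M ^ d) ^ 8) < 5 ^ d * (D ^ d * (M ^ d) ^ 8) := by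
          gcongr
          linarith
      _ = (5 * D * M ^ 8) ^ d := by ring
      _ ≤ ((5 * D * M ^ 8) ^ d) ^ 3 := le_self_pow₀ (one_le_pow₀ hbase) three_ne_zero
      _ ≤ (N * ε ^ 3) ^ 3 := by gcongr
  calc 2 * (D ^ d / ((ε / M ^ d) ^ 8 * N ^ 3))
      = ε / 2 * (4 * (D ^ d * (M ^ d) ^ 8) / (N * ε ^ 3) ^ 3) := by
        field_simp
        norm_num
    _ < ε / 2 := mul_lt_of_lt_one_right (half_pos hε) ((div_lt_one (by positivity)).2 hcube)

theorem exists_forall_abs_integral_sign_map_normalizedSum_sub_lt : ∃ A : ℝ, 128 ≤ A ∧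
    ∀ {Ω ι σ : Type*} [MeasurableSpace Ω] [Fintype ι] [Nonempty ι] [Fintype σ] {μ : Measure Ω}
      [IsProbabilityMeasure μ] {X : ι → Ω → σ → ℝ} (_ : ∀ i, AEMeasurable (X i) μ) {d : ℕ}
      (_ : 0 < d) (_ : ∀ i, MatchesGaussian (128 * d) (μ.map (X i))) (_ : iIndepFun X μ)
      {q : MvPolynomial σ ℝ} (_ : q.totalDegree ≤ d) {ε : ℝ} (_ : 0 < ε)
      (_ : A ^ d ≤ Fintype.card ι * ε ^ 3),
      |∫ x, Real.sign (eval x q) ∂(μ.map fun ω => (1 / √(Fintype.card ι : ℝ)) • ∑ i, X i ω)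
        - ∫ x, Real.sign (eval x q) ∂(stdGauss σ)| < ε := by
  obtain ⟨D, hD1, hD⟩ := exists_forall_abs_integral_sign_map_normalizedSum_sub_le
  set M : ℝ := 131072 * 9 ^ 4 with hM
  have hM1 : 1 ≤ M := by rw [hM]; norm_num
  have hA : 128 ≤ 5 * D * M ^ 8 := by
    have : 128 ≤ M ^ 8 := by rw [hM]; norm_num
    nlinarith
  refine ⟨5 * D * M ^ 8, hA, ?_⟩
  intro Ω ι σ _ _ _ _ μ _ X hX d hd hmatch hind q hq ε hε hcard
  have hcutoff : 2 * (15552 * d ^ 4 * (ε / M ^ d)) ≤ ε / 4 := by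
    have := mul_natCast_pow_four_le hd
    rw [← mul_div_assoc, ← mul_div_assoc, div_le_div_iff₀ (by positivity) (by norm_num)]
    have hd4 : (0 : ℝ) ≤ (d : ℝ) ^ 4 := by positivity
    nlinarith
  have hlindeberg := lindeberg_error_lt hd hD1 hM1 hε
    (by exact_mod_cast Fintype.card_pos) hcard
  refine (hD hX hd hmatch hind hq (κ := ε / M ^ d) (by positivity)).trans_lt ?_
  linarith

/-- Since `ε ≤ 2`, the surplus power `ε ^ (1 + c)` is absorbed by the factor `2 ^ (1 + c)`. -/
theorem pow_le_mul_pow_three_of_mul_rpow_le {A c ε N : ℝ} {d : ℕ} (hA : 0 ≤ A) (hc : -1 ≤ c)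
    (hε : 0 < ε) (hε2 : ε ≤ 2) (hd : 0 < d)
    (h : (A * 2 ^ (1 + c)) ^ d * ε ^ (-4 - c) ≤ N) : A ^ d ≤ N * ε ^ 3 := by
  have hε_le : ε ^ (1 + c) ≤ (2 ^ (1 + c)) ^ d :=
    (Real.rpow_le_rpow hε.le hε2 (by linarith)).trans
      (le_self_pow₀ (Real.one_le_rpow one_le_two (by linarith)) hd.ne')
  have hexponents : ε ^ (-4 - c) * ε ^ (1 + c) * ε ^ 3 = 1 := by
    rw [← Real.rpow_natCast ε 3, ← Real.rpow_add hε, ← Real.rpow_add hε]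
    convert Real.rpow_zero ε using 2
    push_cast
    ring
  calc A ^ d = A ^ d * (ε ^ (-4 - c) * ε ^ (1 + c) * ε ^ 3) := by rw [hexponents, mul_one]
    _ ≤ A ^ d * (ε ^ (-4 - c) * (2 ^ (1 + c)) ^ d * ε ^ 3) := by gcongr
    _ = (A * 2 ^ (1 + c)) ^ d * ε ^ (-4 - c) * ε ^ 3 := by
        rw [mul_pow]
        ring
    _ ≤ N * ε ^ 3 := by gcongr

end ThresholdComparison

theorem theorem1_general (c : ℝ) (hc : -1 ≤ c) :
    ∃ B : ℝ, 1 < B ∧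
      ∀ (ε : ℝ) (d N k n : ℕ), 0 < ε → 0 < d →
        B ^ d * ε ^ (-4 - c) ≤ (N : ℝ) → B * (d : ℝ) ≤ (k : ℝ) →
        ∀ {Ω Ω' : Type*} [MeasurableSpace Ω] [MeasurableSpace Ω']
          (μ : Measure Ω) [IsProbabilityMeasure μ] (ν : Measure Ω') [IsProbabilityMeasure ν]
          (X : Fin N → Ω → Fin n → ℝ) (Y : Ω' → Fin n → ℝ),
          (∀ i, AEMeasurable (X i) μ) → (∀ i, MatchesGaussian k (μ.map (X i))) →
          iIndepFun X μ → HasLaw Y (stdGauss (Fin n)) ν →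
          ∀ f : (Fin n → ℝ) → ℝ, IsPTF d f →
            |(∫ ω, f ((1 / √(N : ℝ)) • ∑ i, X i ω) ∂μ) - ∫ ω, f (Y ω) ∂ν| < ε := by
  obtain ⟨A, hA, hcompare⟩ := exists_forall_abs_integral_sign_map_normalizedSum_sub_lt
  have htwo : 1 ≤ (2 : ℝ) ^ (1 + c) := Real.one_le_rpow one_le_two (by linarith)
  have hB : 128 ≤ A * 2 ^ (1 + c) := by nlinarith
  refine ⟨A * 2 ^ (1 + c), by linarith, ?_⟩
  rintro ε d N k n hε hd hN hk Ω Ω' _ _ μ _ ν _ X Y hX hmatch hind hY f ⟨p, hp, hfp⟩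
  obtain rfl : f = fun x => Real.sign (MvPolynomial.eval x p) := funext hfp
  have hsign : ∀ x : Fin n → ℝ, |Real.sign (MvPolynomial.eval x p)| ≤ 1 := fun _ =>
    isSignLike_sign.abs_le_one _
  rcases lt_or_ge 2 ε with hε2 | hε2
  · exact (abs_integral_sub_integral_le_two (fun _ => hsign _) fun _ => hsign _).trans_lt hε2
  have hN0 : 0 < N := by
    exact_mod_cast (by positivity : 0 < (A * 2 ^ (1 + c)) ^ d * ε ^ (-4 - c)).trans_le hN
  have : Nonempty (Fin N) := ⟨⟨0, hN0⟩⟩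
  have hdk : 128 * d ≤ k := by
    exact_mod_cast (by gcongr : (128 : ℝ) * d ≤ A * 2 ^ (1 + c) * d).trans hk
  have hNε := pow_le_mul_pow_three_of_mul_rpow_le (by linarith) hc hε hε2 hd hN
  have hmeas : Measurable fun x : Fin n → ℝ => Real.sign (MvPolynomial.eval x p) :=
    isSignLike_sign.measurable.comp (measurable_eval_comp p measurable_id)
  have hfinal := hcompare hX hd (fun i => (hmatch i).mono hdk) hind hp hε (by simpa using hNε)
  rwa [Fintype.card_fin, integral_map (aemeasurable_smul_sum hX _) hmeas.aestronglyMeasurable,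
    ← hY.map_eq, integral_map hY.aemeasurable hmeas.aestronglyMeasurable] at hfinal

theorem theorem1 (c : ℝ) (hc : 0 < c) :
    ∃ B : ℝ, 1 < B ∧
      ∀ (ε : ℝ) (d N k n : ℕ), 0 < ε → 0 < d →
        B ^ d * ε ^ (-4 - c) ≤ (N : ℝ) → B * (d : ℝ) ≤ (k : ℝ) →
        ∀ {Ω Ω' : Type*} [MeasurableSpace Ω] [MeasurableSpace Ω']
          (μ : Measure Ω) [IsProbabilityMeasure μ] (ν : Measure Ω') [IsProbabilityMeasure ν]
          (X : Fin N → Ω → Fin n → ℝ) (Y : Ω' → Fin n → ℝ),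
          (∀ i, IsKIndepStdGaussian k (X i) μ) → iIndepFun X μ →
          IsIndepStdGaussian Y ν →
          ∀ f : (Fin n → ℝ) → ℝ, IsPTF d f →
            |(∫ ω, f ((1 / √(N : ℝ)) • ∑ i, X i ω) ∂μ) - ∫ ω, f (Y ω) ∂ν| < ε := by
  obtain ⟨B, hB, hcompare⟩ := theorem1_general c (by linarith)
  exact ⟨B, hB, fun ε d N k n hε hd hN hk _ _ _ _ μ _ ν _ X Y hX hind hY =>
    hcompare ε d N k n hε hd hN hk μ ν X Y (fun i => (hX i).aemeasurable)
      (fun i => (hX i).matchesGaussian) hind hY.hasLaw_stdGauss⟩
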